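/- \textbf{Restriction semigroups.} A restriction semigroup $(S,E,\lambda,\rho)$ is a semigroup $S$ with a non-empty commutative subsemigroup $E\subseteq S$ of idempotents (the \emph{projections}) and maps $\lambda,\rho:S\to E$ such that, for all $s,t\in S$ and $f\in E$: $\lambda(f)=f=\rho(f)$, $s=s\lambda(s)=\rho(s)s$, $\lambda(st)=\lambda(\lambda(s)t)$, $\rho(st)=\rho(s\rho(t))$, $fs=s\lambda(fs)$ and $sf=\rho(sf)s$. For a set $Y$, let $\mathcal I(Y)$ be the semigroup of bijections between subsets of $Y$, composed on the largest possible domain; it is a restriction semigroup with projections the partial identities, $\lambda(\varphi)=\varphi^{-1}\varphi$ and $\rho(\varphi)=\varphi\varphi^{-1}$. A restriction semigroup homomorphism is a semigroup homomorphism that commutes with $\lambda$ and $\rho$. \textbf{Étale actions.} An étale action of $S$ on a locally compact Hausdorff space $X$ is a restriction semigroup homomorphism $\theta:S\to\mathcal I(X)$ such that the domain $D_e$ of $\theta_e$ is open for every $e\in E$, $X=\bigcup_{e\in E}D_e$, and $\theta_s:D_{\lambda(s)}\to D_{\rho(s)}$ is a homeomorphism for every $s\in S$. An étale action of $S$ on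 a $C^*$-algebra $A$ is a restriction semigroup homomorphism $\alpha:S\to\mathcal I(A)$ such that the domain $J_e$ of $\alpha_e$ is a closed two-sided ideal of $A$ for every $e\in E$, $A=\overline{\operatorname{span}}\bigcup_{e\in E}J_e$, and $\alpha_s:J_{\lambda(s)}\to J_{\rho(s)}$ is a $*$-isomorphism for every $s\in S$. An étale action $\theta$ on $X$ induces an étale action $\alpha$ on $C_0(X)$ with $J_e=C_0(D_e)$ and $\alpha_s(f)=f\circ\theta_s^{-1}$ (functions on $D_e$ being extended by $0$). \textbf{The category of germs.} Given an étale action $\theta$ on $X$, call two pairs $(s,x),(t,y)$ with $x\in D_{\lambda(s)}$, $y\in D_{\lambda(t)}$ equivalent if $x=y$ and $sf=tf$ for some $f\in E$ with $x\in D_f$; let $[s,x]$ be the class of $(s,x)$. The category of germs $\mathcal C=\mathcal C(\theta,S,X)$ has object space $X$ and the classes $[s,x]$ as arrows, with source $\mathbf d([s,x])=x$, range $\mathbf r([s,x])=\theta_s(x)$, composition $[s,\theta_t(y)][t,y]=[st,y]$ and units $\mathbf u(x)=[e,x]$ for any $e\in E$ with $x\in D_e$. The sets $\{[s,x]:x\in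 U\}$, for $s\in S$ and $U\subseteq D_{\lambda(s)}$ open, form a basis of the topology on the arrow space, which is also denoted $\mathcal C$. This makes $\mathcal C$ an étale category: the structure maps are continuous, $\mathbf d,\mathbf r$ are local homeomorphisms and $\mathbf u$ is an embedding, by which $X$ is identified with the open subset $\mathcal C^{(0)}=\mathbf u(X)$ of $\mathcal C$. (The space $\mathcal C$ need not be Hausdorff.) \textbf{The operator algebra of $\mathcal C$.} For $U\subseteq\mathcal C$ open, $C_c(U)$ is the set of functions $f:\mathcal C\to\mathbb C$ that vanish outside $U$ and whose restriction to $U$ is continuous with compact support. Let $\mathcal A_0(\mathcal C)$ be the linear span of the sets $C_c(U)$, $U\subseteq\mathcal C$ open and Hausdorff; it is an associative algebra for the product $(f*g)(z)=\sum_{xy=z}f(x)g(y)$. A bisection is an open set $U\subseteq\mathcal C$ on which $\mathbf d$ and $\mathbf r$ are injective. A representation of $\mathcal A_0(\mathcal C)$ on a Hilbert space $H$ is an algebra homomorphism $\pi:\mathcal A_0(\mathcal C)\to B(H)$ such that $\|\pi(f)\|\le\|f\|_\infty$ whenever $f\in C_c(U)$ for some bisection $U$, and $\pi(\bar f)=\pi(f)^*$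 for every $f\in C_c(\mathcal C^{(0)})$. The full operator algebra $\mathcal A(\mathcal C)$ is the Hausdorff completion (the completion of the quotient by the elements of seminorm zero) of $\mathcal A_0(\mathcal C)$ for the seminorm $\|f\|_0=\sup_\pi\|\pi(f)\|$, the supremum being over all representations $\pi$ on Hilbert spaces. \textbf{The semicrossed product.} Let $\alpha$ be an étale action of $S$ on a $C^*$-algebra $A$. Let $L_\alpha$ be the vector space of finite formal sums $\sum_{s\in S}a_s\delta_s$ with $a_s\in J_{\rho(s)}$; it is an associative algebra for the product determined by $(a\delta_s)(b\delta_t)=\alpha_s(\alpha_s^{-1}(a)b)\delta_{st}$. A representation of $S$ on a Hilbert space $H$ is a semigroup homomorphism $\sigma:S\to B(H)$ with $\|\sigma_s\|\le1$ for all $s\in S$ and $\sigma_e^*=\sigma_e^2=\sigma_e$ for all $e\in E$. A covariant pair for $\alpha$ on $H$ is a pair $(\pi,\sigma)$ of a $*$-homomorphism $\pi:A\to B(H)$ and a representation $\sigma$ of $S$ on $H$ such that $\pi(\alpha_s(a))\sigma_s=\sigma_s\pi(a)$ for all $s\in S$, $a\in J_{\lambda(s)}$, and $\overline{\operatorname{span}}\,\pi(J_e)H=\sigma_e(H)$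 for all $e\in E$. The semicrossed product $A\rtimes_\alpha S$ is the Hausdorff completion of $L_\alpha$ for the seminorm $\big\|\sum_s a_s\delta_s\big\|_0=\sup_{(\pi,\sigma)}\big\|\sum_s\pi(a_s)\sigma_s\big\|$, the supremum being over all covariant pairs on Hilbert spaces. \textbf{Theorem.} Let $(S,E,\lambda,\rho)$ be a restriction semigroup, let $\theta$ be an étale action of $S$ on a second countable locally compact Hausdorff space $X$, and let $\alpha$ be the étale action of $S$ on $C_0(X)$ induced by $\theta$. Then $\mathcal A(\mathcal C(\theta,S,X))$ and $C_0(X)\rtimes_\alpha S$ are isometrically isomorphic as Banach algebras: there is a linear isometric bijection between them that preserves products. -/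

import Mathlib

open scoped ZeroAtInfty

set_option linter.unusedSectionVars false

universe u v w

/-- A seminorm on a (not necessarily unital) complex algebra which is submultiplicative. -/
structure AlgebraSeminorm (A : Type u) [NonUnitalRing A] [Module ℂ A] extends Seminorm ℂ A where
  mul_le' : ∀ a b : A, toFun (a * b) ≤ toFun a * toFun b

namespace AlgebraSeminorm

variable {A : Type u} [NonUnitalRing A] [Module ℂ A] [IsScalarTower ℂ A A] [SMulCommClass ℂ A A]

/-- The algebra `A`, regarded as a seminormed algebra for the seminorm `p`. -/
def Seminormed (_p : AlgebraSeminorm A) : Type u := A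

variable (p : AlgebraSeminorm A)

noncomputable instance : NonUnitalSeminormedRing p.Seminormed where
  __ : NonUnitalRing p.Seminormed := inferInstanceAs (NonUnitalRing A)
  __ : SeminormedAddCommGroup p.Seminormed :=
    AddGroupSeminorm.toSeminormedAddCommGroup (E := A) p.toSeminorm.toAddGroupSeminorm
  norm_mul_le := p.mul_le'

noncomputable instance : NormedSpace ℂ p.Seminormed where
  __ : Module ℂ p.Seminormed := inferInstanceAs (Module ℂ A)
  norm_smul_le c a := (map_smul_eq_mul p.toSeminorm c a).le

instance : IsScalarTower ℂ p.Seminormed p.Seminormed :=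
  ⟨smul_mul_assoc (α := ℂ) (β := A)⟩

instance : SMulCommClass ℂ p.Seminormed p.Seminormed :=
  ⟨fun c a b => (mul_smul_comm (α := ℂ) (β := A) c a b).symm⟩

/-- The identity map from `A` to its seminormed copy. -/
def of : A →ₙₐ[ℂ] p.Seminormed where
  toFun a := a
  map_smul' _ _ := rfl
  map_zero' := rfl
  map_add' _ _ := rfl
  map_mul' _ _ := rfl

theorem norm_of (a : A) : ‖p.of a‖ = p.toSeminorm a := rfl

/-- The Hausdorff completion of the seminormed algebra `(A, p)`: the completion of the quotient of
`A` by the ideal of elements of seminorm zero. (The completion of a uniform space in Mathlib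
includes the passage to the separated quotient.) -/
def HausdorffCompletion : Type u := UniformSpace.Completion p.Seminormed

namespace HausdorffCompletion

open UniformSpace

noncomputable instance : NormedAddCommGroup p.HausdorffCompletion :=
  inferInstanceAs (NormedAddCommGroup (Completion p.Seminormed))

noncomputable instance : NormedSpace ℂ p.HausdorffCompletion :=
  inferInstanceAs (NormedSpace ℂ (Completion p.Seminormed))

instance : CompleteSpace p.HausdorffCompletion :=
  inferInstanceAs (CompleteSpace (Completion p.Seminormed))

/-- The canonical map of `A` into its Hausdorff completion. -/
noncomputable def coe (a : A) : p.HausdorffCompletion :=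
  ((p.of a : p.Seminormed) : Completion p.Seminormed)

theorem norm_coe (a : A) : ‖coe p a‖ = p.toSeminorm a :=
  Completion.norm_coe (p.of a)

theorem coe_add (a b : A) : coe p (a + b) = coe p a + coe p b :=
  Completion.coe_add (p.of a) (p.of b)

theorem coe_smul (c : ℂ) (a : A) : coe p (c • a) = c • coe p a :=
  Completion.coe_smul c (p.of a)

theorem denseRange_coe : DenseRange (coe p) :=
  Completion.denseRange_coe (α := p.Seminormed)

theorem isDenseInducing_coe :
    IsDenseInducing (Completion.toCompl : p.Seminormed → Completion p.Seminormed) :=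
  Completion.isDenseInducing_coe

/-- The multiplication of the Hausdorff completion is the continuous extension of the
multiplication of `A`. -/
noncomputable instance : Mul p.HausdorffCompletion :=
  ⟨fun x y => ((isDenseInducing_coe p).prodMap (isDenseInducing_coe p)).extend
    (fun q : p.Seminormed × p.Seminormed => ((q.1 * q.2 : p.Seminormed) : Completion p.Seminormed))
    (x, y)⟩

theorem coe_mul (a b : A) : coe p (a * b) = coe p a * coe p b :=
  (((isDenseInducing_coe p).prodMap (isDenseInducing_coe p)).extend_eq
    ((Completion.continuous_coe p.Seminormed).comp continuous_mul) (p.of a, p.of b)).symm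

instance : ContinuousMul p.HausdorffCompletion where
  continuous_mul := by
    let m := (AddMonoidHom.mul : p.Seminormed →+ p.Seminormed →+ p.Seminormed).compr₂
      Completion.toCompl
    have h : Continuous fun q : p.Seminormed × p.Seminormed => m q.1 q.2 :=
      (Completion.continuous_coe p.Seminormed).comp continuous_mul
    exact (isDenseInducing_coe p).extend_Z_bilin (isDenseInducing_coe p) h

variable {p}

@[elab_as_elim]
theorem induction₁ {P : p.HausdorffCompletion → Prop} (x : p.HausdorffCompletion)
    (hP : IsClosed {x | P x}) (h : ∀ a, P (coe p a)) : P x :=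
  Completion.induction_on x hP h

@[elab_as_elim]
theorem induction₂ {P : p.HausdorffCompletion → p.HausdorffCompletion → Prop}
    (x y : p.HausdorffCompletion)
    (hP : IsClosed {x : p.HausdorffCompletion × p.HausdorffCompletion | P x.1 x.2})
    (h : ∀ a b, P (coe p a) (coe p b)) : P x y :=
  Completion.induction_on₂ x y hP h

@[elab_as_elim]
theorem induction₃
    {P : p.HausdorffCompletion → p.HausdorffCompletion → p.HausdorffCompletion → Prop}
    (x y z : p.HausdorffCompletion)
    (hP : IsClosed {x : p.HausdorffCompletion × p.HausdorffCompletion × p.HausdorffCompletion |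
      P x.1 x.2.1 x.2.2})
    (h : ∀ a b c, P (coe p a) (coe p b) (coe p c)) : P x y z :=
  Completion.induction_on₃ x y z hP h

variable (p)

theorem coe_zero : coe p 0 = 0 := Completion.coe_zero

/-- The Hausdorff completion is a Banach algebra. -/
noncomputable instance : NonUnitalNormedRing p.HausdorffCompletion where
  __ : NormedAddCommGroup p.HausdorffCompletion := inferInstance
  mul x y := x * y
  zero_mul x := by
    induction x using induction₁ with
    | hP => exact isClosed_eq (by fun_prop) (by fun_prop)
    | h a => rw [← coe_zero, ← coe_mul, zero_mul]
  mul_zero x := by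
    induction x using induction₁ with
    | hP => exact isClosed_eq (by fun_prop) (by fun_prop)
    | h a => rw [← coe_zero, ← coe_mul, mul_zero]
  mul_assoc x y z := by
    induction x, y, z using induction₃ with
    | hP => exact isClosed_eq (by fun_prop) (by fun_prop)
    | h a b c => rw [← coe_mul, ← coe_mul, ← coe_mul, ← coe_mul, mul_assoc]
  left_distrib x y z := by
    induction x, y, z using induction₃ with
    | hP => exact isClosed_eq (by fun_prop) (by fun_prop)
    | h a b c => rw [← coe_add, ← coe_mul, ← coe_mul, ← coe_mul, ← coe_add, mul_add]
  right_distrib x y z := by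
    induction x, y, z using induction₃ with
    | hP => exact isClosed_eq (by fun_prop) (by fun_prop)
    | h a b c => rw [← coe_add, ← coe_mul, ← coe_mul, ← coe_mul, ← coe_add, add_mul]
  norm_mul_le x y := by
    induction x, y using induction₂ with
    | hP => exact isClosed_le (by fun_prop) (by fun_prop)
    | h a b =>
      rw [← coe_mul, norm_coe, norm_coe, norm_coe]
      exact p.mul_le' a b

instance : IsScalarTower ℂ p.HausdorffCompletion p.HausdorffCompletion where
  smul_assoc c x y := by
    induction x, y using induction₂ with
    | hP => exact isClosed_eq ((continuous_fst.const_smul c).mul continuous_snd)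
              ((continuous_fst.mul continuous_snd).const_smul c)
    | h a b =>
      rw [smul_eq_mul, smul_eq_mul, ← coe_smul, ← coe_mul, ← coe_mul, ← coe_smul, smul_mul_assoc]

instance : SMulCommClass ℂ p.HausdorffCompletion p.HausdorffCompletion where
  smul_comm c x y := by
    induction x, y using induction₂ with
    | hP => exact isClosed_eq ((continuous_fst.mul continuous_snd).const_smul c)
              (continuous_fst.mul (continuous_snd.const_smul c))
    | h a b =>
      rw [smul_eq_mul, smul_eq_mul, ← coe_smul, ← coe_mul, ← coe_mul, ← coe_smul, mul_smul_comm]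

end HausdorffCompletion

end AlgebraSeminorm

/-- A pointwise supremum of submultiplicative seminorms is submultiplicative. -/
theorem mul_le_sSup {A : Type u} [NonUnitalRing A] [Module ℂ A] {P : Set (Seminorm ℂ A)}
    (hP : BddAbove P) (h : ∀ p ∈ P, ∀ a b, p (a * b) ≤ p a * p b) (a b : A) :
    (sSup P) (a * b) ≤ (sSup P) a * (sSup P) b := by
  rw [Seminorm.sSup_apply hP]
  refine Real.iSup_le ?_ (mul_nonneg (apply_nonneg _ _) (apply_nonneg _ _))
  rintro ⟨p, hp⟩
  have hle : p ≤ sSup P := le_csSup hP hp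
  exact (h p hp a b).trans (mul_le_mul (hle a) (hle b) (apply_nonneg _ _) (apply_nonneg _ _))

/-- For a subset `U` of a topological space `Z`, the functions `f : Z → ℂ` which vanish outside `U`
and whose restriction to the subspace `U` is continuous with compact support. -/
def CcOn {Z : Type w} [TopologicalSpace Z] (U : Set Z) : Set (Z → ℂ) :=
  {f | Continuous (fun z : U => f z) ∧ HasCompactSupport (fun z : U => f z) ∧ ∀ z, z ∉ U → f z = 0}

theorem mem_CcOn_iff {Z : Type w} [TopologicalSpace Z] {U : Set Z} [T2Space U] {f : Z → ℂ} :
    f ∈ CcOn U ↔ ContinuousOn f U ∧ ∃ K ⊆ U, IsCompact K ∧ ∀ z, z ∉ K → f z = 0 := by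
  constructor
  · rintro ⟨h1, h2, h3⟩
    refine ⟨continuousOn_iff_continuous_domRestrict.2 h1,
      Subtype.val '' tsupport (fun z : U => f z), ?_, ?_, ?_⟩
    · rintro _ ⟨z, -, rfl⟩
      exact z.2
    · exact IsCompact.image h2 continuous_subtype_val
    · intro z hz
      by_cases hzU : z ∈ U
      · by_contra hne
        exact hz ⟨⟨z, hzU⟩, subset_tsupport _ hne, rfl⟩
      · exact h3 z hzU
  · rintro ⟨h1, K, hKU, hK, h2⟩
    refine ⟨continuousOn_iff_continuous_domRestrict.1 h1, ?_, fun z hz => h2 z fun h => hz (hKU h)⟩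
    refine HasCompactSupport.intro (K := Subtype.val ⁻¹' K) ?_ fun z hz => h2 z hz
    exact (Topology.IsInducing.subtypeVal.isCompact_preimage_iff (by simpa using hKU)).2 hK

/-- An étale category with space of objects `X` and space of arrows `C`: a small topological
category, with locally compact Hausdorff space of objects, whose source and range maps are local
homeomorphisms and whose unit map is a topological embedding.

`src` and `tgt` are the source and range maps, `unit` assigns to an object its identity arrow, and
`comp x y` is the composite `xy`, defined when the source of `x` is the range of `y`. -/
structure EtaleCategory (X : Type v) (C : Type w) [TopologicalSpace X] [TopologicalSpace C] where
  src : C → X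
  tgt : C → X
  unit : X → C
  comp : ∀ x y : C, src x = tgt y → C
  src_unit : ∀ a, src (unit a) = a
  tgt_unit : ∀ a, tgt (unit a) = a
  src_comp : ∀ x y h, src (comp x y h) = src y
  tgt_comp : ∀ x y h, tgt (comp x y h) = tgt x
  comp_unit : ∀ x, comp x (unit (src x)) (tgt_unit (src x)).symm = x
  unit_comp : ∀ x, comp (unit (tgt x)) x (src_unit (tgt x)) = x
  assoc : ∀ x y z (h : src x = tgt y) (k : src y = tgt z),
    comp (comp x y h) z ((src_comp x y h).trans k) =
      comp x (comp y z k) (h.trans (tgt_comp y z k).symm)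
  continuous_comp : Continuous fun p : {p : C × C // src p.1 = tgt p.2} => comp p.1.1 p.1.2 p.2
  t2Space : T2Space X
  locallyCompactSpace : LocallyCompactSpace X
  isLocalHomeomorph_src : IsLocalHomeomorph src
  isLocalHomeomorph_tgt : IsLocalHomeomorph tgt
  isEmbedding_unit : Topology.IsEmbedding unit

namespace EtaleCategory

variable {X : Type v} {C : Type w} [TopologicalSpace X] [TopologicalSpace C]
variable (𝒞 : EtaleCategory X C)

/-- An open set of arrows on which the source and range maps are injective. -/
structure IsBisection (U : Set C) : Prop where
  isOpen : IsOpen U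
  injOn_src : Set.InjOn 𝒞.src U
  injOn_tgt : Set.InjOn 𝒞.tgt U

/-- The subspace `A₀(𝒞)` of the space of functions on arrows: the linear span of the functions
belonging to `C_c(U)` for some open Hausdorff set `U` of arrows. -/
def A0 (_𝒞 : EtaleCategory X C) : Submodule ℂ (C → ℂ) :=
  Submodule.span ℂ {f | ∃ U : Set C, IsOpen U ∧ T2Space U ∧ f ∈ CcOn U}

/-- The convolution product: `(f * g)(z)` is the sum of `f(x) g(y)` over all factorizations
`z = xy`. (For `f` and `g` in `A₀(𝒞)` only finitely many terms are non-zero.) -/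
noncomputable def conv (f g : C → ℂ) (z : C) : ℂ :=
  ∑ᶠ p : {p : C × C // ∃ h : 𝒞.src p.1 = 𝒞.tgt p.2, 𝒞.comp p.1 p.2 h = z}, f p.1.1 * g p.1.2

variable {𝒞}

theorem IsBisection.t2Space {U : Set C} (hU : 𝒞.IsBisection U) : T2Space U := by
  have := 𝒞.t2Space
  exact T2Space.of_injective_continuous (f := fun z : U => 𝒞.src z)
    (fun a b h => Subtype.ext (hU.injOn_src a.2 b.2 h))
    (𝒞.isLocalHomeomorph_src.continuous.comp continuous_subtype_val)

theorem IsBisection.inter {U V : Set C} (hU : 𝒞.IsBisection U) (hV : IsOpen V) :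
    𝒞.IsBisection (U ∩ V) :=
  ⟨hU.isOpen.inter hV, hU.injOn_src.mono Set.inter_subset_left,
    hU.injOn_tgt.mono Set.inter_subset_left⟩

variable (𝒞)

theorem exists_isBisection (z : C) : ∃ U, 𝒞.IsBisection U ∧ z ∈ U := by
  obtain ⟨e, hz, he⟩ := 𝒞.isLocalHomeomorph_src z
  obtain ⟨e', hz', he'⟩ := 𝒞.isLocalHomeomorph_tgt z
  refine ⟨e.source ∩ e'.source, ⟨e.open_source.inter e'.open_source, ?_, ?_⟩, hz, hz'⟩
  · rw [he]
    exact e.injOn.mono Set.inter_subset_left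
  · rw [he']
    exact e'.injOn.mono Set.inter_subset_right

theorem isLocallyCompact_of_isOpen (𝒞 : EtaleCategory X C) {V : Set C} (hV : IsOpen V) :
    LocallyCompactSpace V := by
  have := 𝒞.locallyCompactSpace
  have h : IsLocalHomeomorph (fun z : V => 𝒞.src z) :=
    𝒞.isLocalHomeomorph_src.comp hV.isOpenEmbedding_subtypeVal.isLocalHomeomorph
  constructor
  intro z n hn
  obtain ⟨e, hz, he⟩ := h z
  obtain ⟨K, hK, hKs, hKc⟩ := LocallyCompactSpace.local_compact_nhds (e z) (e.target ∩ e.symm ⁻¹' n)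
    (Filter.inter_mem (e.open_target.mem_nhds (e.map_source hz))
      ((e.continuousAt_symm (e.map_source hz)).preimage_mem_nhds (by rwa [e.left_inv hz])))
  refine ⟨e.symm '' K, ?_, ?_, ?_⟩
  · have := e.symm.image_mem_nhds (e.map_source hz) hK
    rwa [e.left_inv hz] at this
  · rintro _ ⟨k, hk, rfl⟩
    exact (hKs hk).2
  · exact hKc.image_of_continuousOn (e.continuousOn_symm.mono fun k hk => (hKs hk).1)

/-- Bisections suffice to generate `A₀(𝒞)`. -/
theorem A0_eq_span :
    𝒞.A0 = Submodule.span ℂ {f | ∃ U, 𝒞.IsBisection U ∧ f ∈ CcOn U} := by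
  apply le_antisymm
  · refine Submodule.span_le.2 ?_
    rintro f ⟨V, hV, hV2, hf⟩
    obtain ⟨hfc, K, hKV, hK, hf0⟩ := mem_CcOn_iff.1 hf
    have := 𝒞.isLocallyCompact_of_isOpen hV
    choose U hU hzU using 𝒞.exists_isBisection
    have hK' : IsCompact (Subtype.val ⁻¹' K : Set V) :=
      (Topology.IsInducing.subtypeVal.isCompact_preimage_iff (by simpa using hKV)).2 hK
    obtain ⟨t, ht⟩ := hK'.elim_finite_subcover (fun z : C => (Subtype.val ⁻¹' U z : Set V))
      (fun z => (hU z).isOpen.preimage continuous_subtype_val)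
      (fun z _ => Set.mem_iUnion.2 ⟨z, hzU z⟩)
    obtain ⟨η, h1, h2, h3, h4⟩ := exists_continuous_sum_one_of_isOpen_isCompact (n := t.card)
      (s := fun i => (Subtype.val ⁻¹' U (t.equivFin.symm i) : Set V))
      (fun i => (hU _).isOpen.preimage continuous_subtype_val) hK' (by
        intro z hz
        obtain ⟨i, hi, hzi⟩ := Set.mem_iUnion₂.1 (ht hz)
        exact Set.mem_iUnion.2 ⟨t.equivFin ⟨i, hi⟩, by simpa using hzi⟩)
    classical
    let g : Fin t.card → C → ℂ := fun i z => if h : z ∈ V then (η i ⟨z, h⟩ : ℂ) * f z else 0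
    have hfg : f = ∑ i, g i := by
      funext z
      rw [Finset.sum_apply]
      by_cases hz : z ∈ V
      · simp only [g, hz, dite_true]
        rw [← Finset.sum_mul]
        by_cases hzK : z ∈ K
        · have := h2 (x := ⟨z, hz⟩) hzK
          simp only [Finset.sum_apply, Pi.one_apply] at this
          rw [← Complex.ofReal_sum, this]
          simp
        · simp [hf0 z hzK]
      · simp [g, hz, hf0 z fun h => hz (hKV h)]
    rw [SetLike.mem_coe, hfg]
    refine Submodule.sum_mem _ fun i _ => Submodule.subset_span ?_
    have hB := (hU (t.equivFin.symm i)).inter hV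
    refine ⟨_, hB, ?_⟩
    have := hB.t2Space
    refine mem_CcOn_iff.2 ⟨?_, Subtype.val '' tsupport (η i) ∩ K, ?_, ?_, ?_⟩
    · have hc : ContinuousOn (g i) V := by
        rw [continuousOn_iff_continuous_domRestrict] at hfc ⊢
        have : V.domRestrict (g i) = fun z : V => (η i z : ℂ) * V.domRestrict f z := by
          funext z
          simp [g, Set.domRestrict]
        rw [this]
        exact (Complex.continuous_ofReal.comp (η i).continuous).mul hfc
      exact hc.mono Set.inter_subset_right
    · rintro _ ⟨⟨z, hz, rfl⟩, -⟩
      exact ⟨h1 i hz, z.2⟩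
    · have hc : IsCompact (Subtype.val '' (tsupport (η i) ∩ Subtype.val ⁻¹' K)) :=
        (hK'.inter_left (isClosed_tsupport _)).image continuous_subtype_val
      rwa [Set.image_inter_preimage] at hc
    · intro z hz
      by_cases hzV : z ∈ V
      · simp only [g, hzV, dite_true]
        by_cases hzK : z ∈ K
        · have : (η i) ⟨z, hzV⟩ = 0 := by
            by_contra hne
            exact hz ⟨⟨⟨z, hzV⟩, subset_tsupport _ hne, rfl⟩, hzK⟩
          simp [this]
        · simp [hf0 z hzK]
      · simp [g, hzV]
  · refine Submodule.span_mono ?_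
    rintro f ⟨U, hU, hf⟩
    exact ⟨U, hU.isOpen, hU.t2Space, hf⟩

/-- Functions which are finitely supported on each source fibre and on each range fibre. -/
def FibreFinite (f : C → ℂ) : Prop :=
  ∀ a, {x | f x ≠ 0 ∧ 𝒞.src x = a}.Finite ∧ {x | f x ≠ 0 ∧ 𝒞.tgt x = a}.Finite

theorem fibreFinite_of_mem {f : C → ℂ} (hf : f ∈ 𝒞.A0) : 𝒞.FibreFinite f := by
  rw [A0_eq_span] at hf
  induction hf using Submodule.span_induction with
  | mem f hf =>
    obtain ⟨U, hU, hf⟩ := hf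
    have hfU : ∀ x, f x ≠ 0 → x ∈ U := fun x hx => by
      by_contra h
      exact hx (hf.2.2 x h)
    exact fun a => ⟨Set.Subsingleton.finite fun x hx y hy =>
        hU.injOn_src (hfU x hx.1) (hfU y hy.1) (hx.2.trans hy.2.symm),
      Set.Subsingleton.finite fun x hx y hy =>
        hU.injOn_tgt (hfU x hx.1) (hfU y hy.1) (hx.2.trans hy.2.symm)⟩
  | zero => exact fun a => by simp
  | add f g _ _ hf hg =>
    have key : ∀ x, (f + g) x ≠ 0 → f x ≠ 0 ∨ g x ≠ 0 := fun x hx => by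
      by_contra! h
      exact hx (by simp [h.1, h.2])
    exact fun a => ⟨((hf a).1.union (hg a).1).subset fun x hx =>
        (key x hx.1).imp (fun h => ⟨h, hx.2⟩) (fun h => ⟨h, hx.2⟩),
      ((hf a).2.union (hg a).2).subset fun x hx =>
        (key x hx.1).imp (fun h => ⟨h, hx.2⟩) (fun h => ⟨h, hx.2⟩)⟩
  | smul c f _ hf =>
    have key : ∀ x, (c • f) x ≠ 0 → f x ≠ 0 := fun x hx h => hx (by simp [h])
    exact fun a => ⟨(hf a).1.subset fun x hx => ⟨key x hx.1, hx.2⟩,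
      (hf a).2.subset fun x hx => ⟨key x hx.1, hx.2⟩⟩

theorem finite_support_conv {f g : C → ℂ} (hf : 𝒞.FibreFinite f) (hg : 𝒞.FibreFinite g) (z : C) :
    (Function.support fun p : {p : C × C // ∃ h : 𝒞.src p.1 = 𝒞.tgt p.2, 𝒞.comp p.1 p.2 h = z} =>
      f p.1.1 * g p.1.2).Finite := by
  refine Set.Finite.of_finite_image (f := Subtype.val) ?_ Subtype.val_injective.injOn
  refine (((hf (𝒞.tgt z)).2).prod ((hg (𝒞.src z)).1)).subset ?_
  rintro _ ⟨⟨⟨x, y⟩, h, rfl⟩, hxy, rfl⟩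
  have hxy' : f x * g y ≠ 0 := hxy
  exact ⟨⟨left_ne_zero_of_mul hxy', (𝒞.tgt_comp x y h).symm⟩,
    ⟨right_ne_zero_of_mul hxy', (𝒞.src_comp x y h).symm⟩⟩

theorem conv_add {f g h : C → ℂ} (hf : 𝒞.FibreFinite f) (hg : 𝒞.FibreFinite g)
    (hh : 𝒞.FibreFinite h) : 𝒞.conv f (g + h) = 𝒞.conv f g + 𝒞.conv f h := by
  funext z
  simp only [conv, Pi.add_apply, mul_add]
  exact finsum_add_distrib (𝒞.finite_support_conv hf hg z) (𝒞.finite_support_conv hf hh z)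

theorem add_conv {f g h : C → ℂ} (hf : 𝒞.FibreFinite f) (hg : 𝒞.FibreFinite g)
    (hh : 𝒞.FibreFinite h) : 𝒞.conv (f + g) h = 𝒞.conv f h + 𝒞.conv g h := by
  funext z
  simp only [conv, Pi.add_apply, add_mul]
  exact finsum_add_distrib (𝒞.finite_support_conv hf hh z) (𝒞.finite_support_conv hg hh z)

theorem smul_conv (c : ℂ) (f g : C → ℂ) : 𝒞.conv (c • f) g = c • 𝒞.conv f g := by
  funext z
  simp only [conv, Pi.smul_apply, smul_eq_mul, mul_assoc]
  exact (smul_finsum (R := ℂ) c fun p : {p : C × C // ∃ h : 𝒞.src p.1 = 𝒞.tgt p.2,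
    𝒞.comp p.1 p.2 h = z} => f p.1.1 * g p.1.2).symm

theorem conv_smul (c : ℂ) (f g : C → ℂ) : 𝒞.conv f (c • g) = c • 𝒞.conv f g := by
  funext z
  simp only [conv, Pi.smul_apply, smul_eq_mul, mul_left_comm _ c]
  exact (smul_finsum (R := ℂ) c fun p : {p : C × C // ∃ h : 𝒞.src p.1 = 𝒞.tgt p.2,
    𝒞.comp p.1 p.2 h = z} => f p.1.1 * g p.1.2).symm

theorem zero_conv (f : C → ℂ) : 𝒞.conv 0 f = 0 := by
  funext z
  simp [conv]

theorem conv_zero (f : C → ℂ) : 𝒞.conv f 0 = 0 := by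
  funext z
  simp [conv]

/-- The set of composites `xy` with `x ∈ U` and `y ∈ V`. -/
def mulSet (U V : Set C) : Set C :=
  {z | ∃ x ∈ U, ∃ y ∈ V, ∃ h : 𝒞.src x = 𝒞.tgt y, 𝒞.comp x y h = z}

variable {𝒞}

theorem comp_congr {x x' y y' : C} (hx : x = x') (hy : y = y') (h : 𝒞.src x = 𝒞.tgt y)
    (h' : 𝒞.src x' = 𝒞.tgt y') : 𝒞.comp x y h = 𝒞.comp x' y' h' := by
  subst hx hy
  rfl

theorem unique_factor {U V : Set C} (hU : 𝒞.IsBisection U) (hV : 𝒞.IsBisection V) {x x' y y' : C}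
    (hx : x ∈ U) (hx' : x' ∈ U) (hy : y ∈ V) (hy' : y' ∈ V) (h : 𝒞.src x = 𝒞.tgt y)
    (h' : 𝒞.src x' = 𝒞.tgt y') (he : 𝒞.comp x y h = 𝒞.comp x' y' h') : x = x' ∧ y = y' := by
  constructor
  · refine hU.injOn_tgt hx hx' ?_
    rw [← 𝒞.tgt_comp x y h, he, 𝒞.tgt_comp]
  · refine hV.injOn_src hy hy' ?_
    rw [← 𝒞.src_comp x y h, he, 𝒞.src_comp]

theorem conv_comp {U V : Set C} (hU : 𝒞.IsBisection U) (hV : 𝒞.IsBisection V) {f g : C → ℂ}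
    (hf : ∀ x, x ∉ U → f x = 0) (hg : ∀ y, y ∉ V → g y = 0) {x y : C} (hx : x ∈ U) (hy : y ∈ V)
    (h : 𝒞.src x = 𝒞.tgt y) : 𝒞.conv f g (𝒞.comp x y h) = f x * g y := by
  unfold conv
  refine finsum_eq_single _ (⟨(x, y), h, rfl⟩ : {p : C × C // ∃ h' : 𝒞.src p.1 = 𝒞.tgt p.2,
    𝒞.comp p.1 p.2 h' = 𝒞.comp x y h}) ?_
  rintro ⟨⟨x', y'⟩, h', he⟩ hne
  by_cases hx' : x' ∈ U
  · by_cases hy' : y' ∈ V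
    · obtain ⟨rfl, rfl⟩ := unique_factor hU hV hx' hx hy' hy h' h he
      exact absurd rfl hne
    · simp [hg y' hy']
  · simp [hf x' hx']

theorem mem_mulSet_of_conv_ne_zero {U V : Set C} {f g : C → ℂ}
    (hf : ∀ x, x ∉ U → f x = 0) (hg : ∀ y, y ∉ V → g y = 0) {z : C} (hz : 𝒞.conv f g z ≠ 0) :
    z ∈ 𝒞.mulSet U V := by
  obtain ⟨⟨⟨x, y⟩, h, he⟩, hne⟩ : ∃ p : {p : C × C // ∃ h : 𝒞.src p.1 = 𝒞.tgt p.2,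
      𝒞.comp p.1 p.2 h = z}, f p.1.1 * g p.1.2 ≠ 0 := by
    by_contra! h
    exact hz (finsum_eq_zero_of_forall_eq_zero h)
  refine ⟨x, ?_, y, ?_, h, he⟩
  · by_contra hx
    exact hne (by simp [hf x hx])
  · by_contra hy
    exact hne (by simp [hg y hy])

/-- Locally around a composite `xy` with `x ∈ U` and `y ∈ V`, factorizations through the bisections
`U` and `V` exist and depend continuously on the arrow. -/
theorem exists_local_factor {U V : Set C} (hU : 𝒞.IsBisection U) (hV : 𝒞.IsBisection V) {x y : C}
    (hx : x ∈ U) (hy : y ∈ V) (h : 𝒞.src x = 𝒞.tgt y) :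
    ∃ a b : C → C, ContinuousAt a (𝒞.comp x y h) ∧ ContinuousAt b (𝒞.comp x y h) ∧
      a (𝒞.comp x y h) = x ∧ b (𝒞.comp x y h) = y ∧
      ∀ᶠ z in nhds (𝒞.comp x y h), a z ∈ U ∧ b z ∈ V ∧
        ∃ hz : 𝒞.src (a z) = 𝒞.tgt (b z), 𝒞.comp (a z) (b z) hz = z := by
  set z₀ := 𝒞.comp x y h with hz₀
  obtain ⟨e, hye, he⟩ := 𝒞.isLocalHomeomorph_src y
  obtain ⟨e', hxe', he'⟩ := 𝒞.isLocalHomeomorph_src x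
  obtain ⟨W, hW, hzW⟩ := 𝒞.exists_isBisection z₀
  have hs : Continuous 𝒞.src := 𝒞.isLocalHomeomorph_src.continuous
  have ht : Continuous 𝒞.tgt := 𝒞.isLocalHomeomorph_tgt.continuous
  have hz₀s : 𝒞.src z₀ = e y := by rw [hz₀, 𝒞.src_comp, he]
  let b : C → C := fun z => e.symm (𝒞.src z)
  let a : C → C := fun z => e'.symm (𝒞.tgt (b z))
  have hb0 : b z₀ = y := by
    change e.symm (𝒞.src z₀) = y
    rw [hz₀s, e.left_inv hye]
  have htb : 𝒞.tgt (b z₀) = e' x := by rw [hb0, ← h, he']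
  have ha0 : a z₀ = x := by
    change e'.symm (𝒞.tgt (b z₀)) = x
    rw [htb, e'.left_inv hxe']
  have hbc : ContinuousAt b z₀ := by
    refine ContinuousAt.comp (g := e.symm) ?_ hs.continuousAt
    rw [hz₀s]
    exact e.continuousAt_symm (e.map_source hye)
  have htbc : ContinuousAt (fun z => 𝒞.tgt (b z)) z₀ := ht.continuousAt.comp hbc
  have hac : ContinuousAt a z₀ := by
    refine ContinuousAt.comp (g := e'.symm) (f := fun z => 𝒞.tgt (b z)) ?_ htbc
    rw [htb]
    exact e'.continuousAt_symm (e'.map_source hxe')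
  have E1 : ∀ᶠ z in nhds z₀, a z ∈ U := hac.eventually_mem (by
    rw [ha0]; exact hU.isOpen.mem_nhds hx)
  have E2 : ∀ᶠ z in nhds z₀, b z ∈ V := hbc.eventually_mem (by
    rw [hb0]; exact hV.isOpen.mem_nhds hy)
  have E3 : ∀ᶠ z in nhds z₀, 𝒞.src z ∈ e.target := hs.continuousAt.eventually_mem (by
    rw [hz₀s]; exact e.open_target.mem_nhds (e.map_source hye))
  have E4 : ∀ᶠ z in nhds z₀, 𝒞.tgt (b z) ∈ e'.target := htbc.eventually_mem (by
    rw [htb]; exact e'.open_target.mem_nhds (e'.map_source hxe'))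
  have hsb : ∀ z, 𝒞.src z ∈ e.target → 𝒞.src (b z) = 𝒞.src z := fun z hz => by
    have := e.right_inv hz
    rwa [← he] at this
  have hsa : ∀ z, 𝒞.tgt (b z) ∈ e'.target → 𝒞.src (a z) = 𝒞.tgt (b z) := fun z hz => by
    have := e'.right_inv hz
    rwa [← he'] at this
  -- the set of pairs composing into the bisection `W` is a neighbourhood of `(x, y)`
  have hO : IsOpen ((fun p : {p : C × C // 𝒞.src p.1 = 𝒞.tgt p.2} => 𝒞.comp p.1.1 p.1.2 p.2) ⁻¹' W) :=
    hW.isOpen.preimage 𝒞.continuous_comp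
  obtain ⟨O, hOo, hO⟩ := isOpen_induced_iff.1 hO
  have hO0 : (x, y) ∈ O := by
    have : (⟨(x, y), h⟩ : {p : C × C // 𝒞.src p.1 = 𝒞.tgt p.2}) ∈ Subtype.val ⁻¹' O := by
      rw [hO]
      exact hzW
    exact this
  have E5 : ∀ᶠ z in nhds z₀, (a z, b z) ∈ O := (hac.prodMk hbc).eventually_mem (by
    rw [ha0, hb0]; exact hOo.mem_nhds hO0)
  have E6 : ∀ᶠ z in nhds z₀, z ∈ W := hW.isOpen.mem_nhds hzW
  refine ⟨a, b, hac, hbc, ha0, hb0, ?_⟩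
  filter_upwards [E1, E2, E3, E4, E5, E6] with z h1 h2 h3 h4 h5 h6
  refine ⟨h1, h2, hsa z h4, ?_⟩
  have hmem : 𝒞.comp (a z) (b z) (hsa z h4) ∈ W := by
    have : (⟨(a z, b z), hsa z h4⟩ : {p : C × C // 𝒞.src p.1 = 𝒞.tgt p.2}) ∈ Subtype.val ⁻¹' O := h5
    rw [hO] at this
    exact this
  refine hW.injOn_src hmem h6 ?_
  rw [𝒞.src_comp, hsb z h3]

theorem IsBisection.mulSet {U V : Set C} (hU : 𝒞.IsBisection U) (hV : 𝒞.IsBisection V) :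
    𝒞.IsBisection (𝒞.mulSet U V) := by
  refine ⟨?_, ?_, ?_⟩
  · rw [isOpen_iff_mem_nhds]
    rintro _ ⟨x, hx, y, hy, h, rfl⟩
    obtain ⟨a, b, -, -, -, -, hev⟩ := exists_local_factor hU hV hx hy h
    filter_upwards [hev] with z hz
    exact ⟨a z, hz.1, b z, hz.2.1, hz.2.2⟩
  · rintro _ ⟨x, hx, y, hy, h, rfl⟩ _ ⟨x', hx', y', hy', h', rfl⟩ he
    rw [𝒞.src_comp, 𝒞.src_comp] at he
    have hyy := hV.injOn_src hy hy' he
    have hxx : x = x' := hU.injOn_src hx hx' (by rw [h, h', hyy])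
    exact comp_congr hxx hyy h h'
  · rintro _ ⟨x, hx, y, hy, h, rfl⟩ _ ⟨x', hx', y', hy', h', rfl⟩ he
    rw [𝒞.tgt_comp, 𝒞.tgt_comp] at he
    have hxx := hU.injOn_tgt hx hx' he
    have hyy : y = y' := hV.injOn_tgt hy hy' (by rw [← h, ← h', hxx])
    exact comp_congr hxx hyy h h'

theorem conv_mem_CcOn {U V : Set C} (hU : 𝒞.IsBisection U) (hV : 𝒞.IsBisection V) {f g : C → ℂ}
    (hf : f ∈ CcOn U) (hg : g ∈ CcOn V) : 𝒞.conv f g ∈ CcOn (𝒞.mulSet U V) := by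
  have := hU.t2Space
  have := hV.t2Space
  have := (hU.mulSet hV).t2Space
  have := 𝒞.t2Space
  have hf0 := hf.2.2
  have hg0 := hg.2.2
  obtain ⟨hfc, K, hKU, hK, hfK⟩ := mem_CcOn_iff.1 hf
  obtain ⟨hgc, L, hLV, hL, hgL⟩ := mem_CcOn_iff.1 hg
  refine mem_CcOn_iff.2 ⟨?_, 𝒞.mulSet K L, ?_, ?_, ?_⟩
  · rintro _ ⟨x, hx, y, hy, h, rfl⟩
    apply ContinuousAt.continuousWithinAt
    obtain ⟨a, b, ha, hb, ha0, hb0, hev⟩ := exists_local_factor hU hV hx hy h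
    have hfa : ContinuousAt (fun z => f (a z)) (𝒞.comp x y h) := by
      refine ContinuousAt.comp (g := f) ?_ ha
      rw [ha0]
      exact hfc.continuousAt (hU.isOpen.mem_nhds hx)
    have hgb : ContinuousAt (fun z => g (b z)) (𝒞.comp x y h) := by
      refine ContinuousAt.comp (g := g) ?_ hb
      rw [hb0]
      exact hgc.continuousAt (hV.isOpen.mem_nhds hy)
    refine (hfa.mul hgb).congr ?_
    filter_upwards [hev] with z hz
    obtain ⟨h1, h2, h3, h4⟩ := hz
    conv_rhs => rw [← h4]
    exact (conv_comp hU hV hf0 hg0 h1 h2 h3).symm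
  · rintro _ ⟨x, hx, y, hy, h, rfl⟩
    exact ⟨x, hKU hx, y, hLV hy, h, rfl⟩
  · have hcl : IsClosed {p : C × C | 𝒞.src p.1 = 𝒞.tgt p.2} :=
      isClosed_eq (𝒞.isLocalHomeomorph_src.continuous.comp continuous_fst)
        (𝒞.isLocalHomeomorph_tgt.continuous.comp continuous_snd)
    have hc : IsCompact (Subtype.val ⁻¹' (K ×ˢ L) : Set {p : C × C // 𝒞.src p.1 = 𝒞.tgt p.2}) :=
      hcl.isClosedEmbedding_subtypeVal.isCompact_preimage (hK.prod hL)
    convert hc.image 𝒞.continuous_comp using 1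
    ext z
    constructor
    · rintro ⟨x, hx, y, hy, h, rfl⟩
      exact ⟨⟨(x, y), h⟩, ⟨hx, hy⟩, rfl⟩
    · rintro ⟨⟨⟨x, y⟩, h⟩, ⟨hx, hy⟩, rfl⟩
      exact ⟨x, hx, y, hy, h, rfl⟩
  · intro z hz
    by_contra hne
    exact hz (mem_mulSet_of_conv_ne_zero hfK hgL hne)

theorem conv_assoc_of_bisection {U V W : Set C} (hU : 𝒞.IsBisection U) (hV : 𝒞.IsBisection V)
    (hW : 𝒞.IsBisection W) {f g k : C → ℂ} (hf : ∀ x, x ∉ U → f x = 0)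
    (hg : ∀ x, x ∉ V → g x = 0) (hk : ∀ x, x ∉ W → k x = 0) :
    𝒞.conv (𝒞.conv f g) k = 𝒞.conv f (𝒞.conv g k) := by
  have hfg : ∀ z, z ∉ 𝒞.mulSet U V → 𝒞.conv f g z = 0 := fun z hz => by
    by_contra hne
    exact hz (mem_mulSet_of_conv_ne_zero hf hg hne)
  have hgk : ∀ z, z ∉ 𝒞.mulSet V W → 𝒞.conv g k z = 0 := fun z hz => by
    by_contra hne
    exact hz (mem_mulSet_of_conv_ne_zero hg hk hne)
  have key : ∀ x ∈ U, ∀ y ∈ V, ∀ w ∈ W, ∀ (h1 : 𝒞.src x = 𝒞.tgt y) (h2 : 𝒞.src y = 𝒞.tgt w),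
      𝒞.conv (𝒞.conv f g) k (𝒞.comp (𝒞.comp x y h1) w ((𝒞.src_comp x y h1).trans h2)) =
      𝒞.conv f (𝒞.conv g k) (𝒞.comp (𝒞.comp x y h1) w ((𝒞.src_comp x y h1).trans h2)) := by
    intro x hx y hy w hw h1 h2
    rw [conv_comp (hU.mulSet hV) hW hfg hk ⟨x, hx, y, hy, h1, rfl⟩ hw,
      conv_comp hU hV hf hg hx hy, 𝒞.assoc x y w h1 h2,
      conv_comp hU (hV.mulSet hW) hf hgk hx ⟨y, hy, w, hw, h2, rfl⟩,
      conv_comp hV hW hg hk hy hw, mul_assoc]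
  funext z
  by_cases h1 : z ∈ 𝒞.mulSet (𝒞.mulSet U V) W
  · obtain ⟨_, ⟨x, hx, y, hy, hxy, rfl⟩, w, hw, hw', rfl⟩ := h1
    exact key x hx y hy w hw hxy ((𝒞.src_comp x y hxy).symm.trans hw')
  · have e1 : 𝒞.conv (𝒞.conv f g) k z = 0 := by
      by_contra hne
      exact h1 (mem_mulSet_of_conv_ne_zero hfg hk hne)
    have e2 : 𝒞.conv f (𝒞.conv g k) z = 0 := by
      by_contra hne
      obtain ⟨x, hx, _, ⟨y, hy, w, hw, hyw, rfl⟩, hx', rfl⟩ :=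
        mem_mulSet_of_conv_ne_zero hf hgk hne
      have hxy : 𝒞.src x = 𝒞.tgt y := hx'.trans (𝒞.tgt_comp y w hyw)
      exact h1 ⟨_, ⟨x, hx, y, hy, hxy, rfl⟩, w, hw, (𝒞.src_comp x y hxy).trans hyw,
        𝒞.assoc x y w hxy hyw⟩
    rw [e1, e2]

variable (𝒞)

theorem conv_mem {f g : C → ℂ} (hf : f ∈ 𝒞.A0) (hg : g ∈ 𝒞.A0) : 𝒞.conv f g ∈ 𝒞.A0 := by
  have hsub : ∀ {f : C → ℂ}, f ∈ Submodule.span ℂ {f | ∃ U, 𝒞.IsBisection U ∧ f ∈ CcOn U} →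
      𝒞.FibreFinite f := fun h => 𝒞.fibreFinite_of_mem (by rwa [A0_eq_span])
  rw [A0_eq_span] at hf hg ⊢
  induction hf, hg using Submodule.span_induction₂ with
  | mem_mem f g hf hg =>
    obtain ⟨U, hU, hf⟩ := hf
    obtain ⟨V, hV, hg⟩ := hg
    exact Submodule.subset_span ⟨_, hU.mulSet hV, conv_mem_CcOn hU hV hf hg⟩
  | zero_left g _ => rw [zero_conv]; exact Submodule.zero_mem _
  | zero_right f _ => rw [conv_zero]; exact Submodule.zero_mem _
  | add_left f g k hf hg hk h1 h2 =>
    rw [𝒞.add_conv (hsub hf) (hsub hg) (hsub hk)]; exact Submodule.add_mem _ h1 h2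
  | add_right f g k hf hg hk h1 h2 =>
    rw [𝒞.conv_add (hsub hf) (hsub hg) (hsub hk)]; exact Submodule.add_mem _ h1 h2
  | smul_left c f g _ _ h => rw [smul_conv]; exact Submodule.smul_mem _ _ h
  | smul_right c f g _ _ h => rw [conv_smul]; exact Submodule.smul_mem _ _ h

theorem conv_assoc {f g k : C → ℂ} (hf : f ∈ 𝒞.A0) (hg : g ∈ 𝒞.A0) (hk : k ∈ 𝒞.A0) :
    𝒞.conv (𝒞.conv f g) k = 𝒞.conv f (𝒞.conv g k) := by
  have F : ∀ {f : C → ℂ}, f ∈ 𝒞.A0 → 𝒞.FibreFinite f := fun h => 𝒞.fibreFinite_of_mem h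
  have M : ∀ {f g : C → ℂ}, f ∈ 𝒞.A0 → g ∈ 𝒞.A0 → 𝒞.FibreFinite (𝒞.conv f g) :=
    fun h h' => F (𝒞.conv_mem h h')
  have hA := 𝒞.A0_eq_span
  have hf' := hf
  rw [hA] at hf'
  induction hf' using Submodule.span_induction with
  | mem f hf0 =>
    obtain ⟨U, hU, hfU⟩ := hf0
    have hg' := hg
    rw [hA] at hg'
    induction hg' using Submodule.span_induction with
    | mem g hg0 =>
      obtain ⟨V, hV, hgV⟩ := hg0
      have hk' := hk
      rw [hA] at hk'
      induction hk' using Submodule.span_induction with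
      | mem k hk0 =>
        obtain ⟨W, hW, hkW⟩ := hk0
        exact conv_assoc_of_bisection hU hV hW hfU.2.2 hgV.2.2 hkW.2.2
      | zero => simp only [conv_zero]
      | add k l hk' hl' h1 h2 =>
        have hk : k ∈ 𝒞.A0 := by rwa [hA]
        have hl : l ∈ 𝒞.A0 := by rwa [hA]
        rw [𝒞.conv_add (M hf hg) (F hk) (F hl), 𝒞.conv_add (F hg) (F hk) (F hl),
          𝒞.conv_add (F hf) (M hg hk) (M hg hl), h1 hk, h2 hl]
      | smul c k hk' h1 =>
        have hk : k ∈ 𝒞.A0 := by rwa [hA]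
        rw [conv_smul, conv_smul, conv_smul, h1 hk]
    | zero => simp only [conv_zero, zero_conv]
    | add g l hg' hl' h1 h2 =>
      have hg : g ∈ 𝒞.A0 := by rwa [hA]
      have hl : l ∈ 𝒞.A0 := by rwa [hA]
      rw [𝒞.conv_add (F hf) (F hg) (F hl), 𝒞.add_conv (M hf hg) (M hf hl) (F hk),
        𝒞.add_conv (F hg) (F hl) (F hk), 𝒞.conv_add (F hf) (M hg hk) (M hl hk), h1 hg, h2 hl]
    | smul c g hg' h1 =>
      have hg : g ∈ 𝒞.A0 := by rwa [hA]
      rw [conv_smul, smul_conv, smul_conv, conv_smul, h1 hg]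
  | zero => simp only [zero_conv]
  | add f l hf' hl' h1 h2 =>
    have hf : f ∈ 𝒞.A0 := by rwa [hA]
    have hl : l ∈ 𝒞.A0 := by rwa [hA]
    rw [𝒞.add_conv (F hf) (F hl) (F hg), 𝒞.add_conv (M hf hg) (M hl hg) (F hk),
      𝒞.add_conv (F hf) (F hl) (M hg hk), h1 hf, h2 hl]
  | smul c f hf' h1 =>
    have hf : f ∈ 𝒞.A0 := by rwa [hA]
    rw [smul_conv, smul_conv, smul_conv, h1 hf]

/-- `A₀(𝒞)` is an associative algebra for the convolution product. -/
noncomputable instance : NonUnitalRing 𝒞.A0 where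
  mul f g := ⟨𝒞.conv f g, 𝒞.conv_mem f.2 g.2⟩
  left_distrib f g h := Subtype.ext (𝒞.conv_add (𝒞.fibreFinite_of_mem f.2)
    (𝒞.fibreFinite_of_mem g.2) (𝒞.fibreFinite_of_mem h.2))
  right_distrib f g h := Subtype.ext (𝒞.add_conv (𝒞.fibreFinite_of_mem f.2)
    (𝒞.fibreFinite_of_mem g.2) (𝒞.fibreFinite_of_mem h.2))
  zero_mul f := Subtype.ext (𝒞.zero_conv f)
  mul_zero f := Subtype.ext (𝒞.conv_zero f)
  mul_assoc f g h := Subtype.ext (𝒞.conv_assoc f.2 g.2 h.2)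

theorem coe_mul (f g : 𝒞.A0) : ((f * g : 𝒞.A0) : C → ℂ) = 𝒞.conv f g := rfl

instance : IsScalarTower ℂ 𝒞.A0 𝒞.A0 := ⟨fun c f g => Subtype.ext (𝒞.smul_conv c f g)⟩

instance : SMulCommClass ℂ 𝒞.A0 𝒞.A0 := ⟨fun c f g => Subtype.ext (𝒞.conv_smul c f g).symm⟩

/-- A representation of `A₀(𝒞)` on a Hilbert space `H`: an algebra homomorphism into `B(H)` which is
contractive for the supremum norm on `C_c(U)`, for every bisection `U`, and which preserves
adjoints on the functions compactly supported in the set of identity arrows. -/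
structure IsRepresentation {H : Type w} [NormedAddCommGroup H] [InnerProductSpace ℂ H]
    [CompleteSpace H] (π : 𝒞.A0 →ₙₐ[ℂ] (H →L[ℂ] H)) : Prop where
  norm_le : ∀ U, 𝒞.IsBisection U → ∀ f : 𝒞.A0, (f : C → ℂ) ∈ CcOn U →
    ‖π f‖ ≤ ⨆ z, ‖(f : C → ℂ) z‖
  map_conj : ∀ f g : 𝒞.A0, (f : C → ℂ) ∈ CcOn (Set.range 𝒞.unit) →
    (∀ z, (g : C → ℂ) z = starRingEnd ℂ ((f : C → ℂ) z)) → π g = ContinuousLinearMap.adjoint (π f)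

/-- The set of seminorms `f ↦ ‖π f‖` on `A₀(𝒞)` arising from representations `π` on Hilbert
spaces. -/
def repSeminorms : Set (Seminorm ℂ 𝒞.A0) :=
  {p | ∃ (H : Type w) (_ : NormedAddCommGroup H) (_ : InnerProductSpace ℂ H) (_ : CompleteSpace H)
    (π : 𝒞.A0 →ₙₐ[ℂ] (H →L[ℂ] H)), 𝒞.IsRepresentation π ∧ ∀ f, p f = ‖π f‖}

theorem bddAbove_repSeminorms : BddAbove 𝒞.repSeminorms := by
  rw [Seminorm.bddAbove_iff]
  have key : ∀ f : C → ℂ, f ∈ 𝒞.A0 → ∃ M : ℝ, ∀ hf : f ∈ 𝒞.A0, ∀ p ∈ 𝒞.repSeminorms,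
      p ⟨f, hf⟩ ≤ M := by
    intro f hf
    have hA := 𝒞.A0_eq_span
    rw [hA] at hf
    induction hf using Submodule.span_induction with
    | mem f hf =>
      obtain ⟨U, hU, hfU⟩ := hf
      refine ⟨⨆ z, ‖f z‖, ?_⟩
      rintro hf p ⟨H, _, _, _, π, hπ, hp⟩
      rw [hp]
      exact hπ.norm_le U hU ⟨f, hf⟩ hfU
    | zero =>
      refine ⟨0, fun hf p _ => ?_⟩
      exact (map_zero p).le
    | add f g hf hg h1 h2 =>
      rw [← hA] at hf hg
      obtain ⟨M, hM⟩ := h1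
      obtain ⟨N, hN⟩ := h2
      refine ⟨M + N, fun _ p hp => ?_⟩
      exact (map_add_le_add p ⟨f, hf⟩ ⟨g, hg⟩).trans (add_le_add (hM hf p hp) (hN hg p hp))
    | smul c f hf h1 =>
      rw [← hA] at hf
      obtain ⟨M, hM⟩ := h1
      refine ⟨‖c‖ * M, fun _ p hp => ?_⟩
      refine (map_smul_eq_mul p c ⟨f, hf⟩).le.trans ?_
      exact mul_le_mul_of_nonneg_left (hM hf p hp) (norm_nonneg c)
  choose M hM using fun f : 𝒞.A0 => key f f.2
  refine ⟨M, ?_⟩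
  rintro _ ⟨p, hp, rfl⟩ f
  exact hM f f.2 p hp

/-- The universal seminorm on `A₀(𝒞)`: the supremum of the seminorms `f ↦ ‖π f‖` over all
representations `π` of `A₀(𝒞)`. -/
noncomputable def universalSeminorm : AlgebraSeminorm 𝒞.A0 where
  toSeminorm := sSup 𝒞.repSeminorms
  mul_le' := mul_le_sSup 𝒞.bddAbove_repSeminorms (by
    rintro p ⟨H, _, _, _, π, -, hp⟩ f g
    rw [hp, hp, hp, map_mul]
    exact norm_mul_le _ _)

/-- The operator algebra `A(𝒞)` of an étale category: the Hausdorff completion of `A₀(𝒞)` for the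
universal seminorm. -/
abbrev OperatorAlgebra : Type w := 𝒞.universalSeminorm.HausdorffCompletion

end EtaleCategory

/-- A restriction semigroup `(S, E, λ, ρ)`: `proj` is the set `E` of projections, a non-empty
commutative subsemigroup of idempotents, and `lam`, `rho` are the structure maps `λ`, `ρ`. -/
class RestrictionSemigroup (S : Type u) extends Semigroup S where
  proj : Set S
  lam : S → S
  rho : S → S
  proj_nonempty : proj.Nonempty
  proj_idem : ∀ e ∈ proj, e * e = e
  proj_comm : ∀ e ∈ proj, ∀ f ∈ proj, e * f = f * e
  proj_mul_mem : ∀ e ∈ proj, ∀ f ∈ proj, e * f ∈ proj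
  lam_mem : ∀ s, lam s ∈ proj
  rho_mem : ∀ s, rho s ∈ proj
  lam_proj : ∀ f ∈ proj, lam f = f
  rho_proj : ∀ f ∈ proj, rho f = f
  mul_lam : ∀ s, s = s * lam s
  rho_mul : ∀ s, s = rho s * s
  lam_mul_eq : ∀ s t, lam (s * t) = lam (lam s * t)
  rho_mul_eq : ∀ s t, rho (s * t) = rho (s * rho t)
  proj_mul : ∀ f ∈ proj, ∀ s, f * s = s * lam (f * s)
  mul_proj : ∀ f ∈ proj, ∀ s, s * f = rho (s * f) * s

open RestrictionSemigroup

/-- A restriction semigroup homomorphism from `S` to the symmetric inverse semigroup of partial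
bijections of a set `Y`, in which `λ(φ) = φ⁻¹φ` and `ρ(φ) = φφ⁻¹`.

Partial bijections are represented by `PartialEquiv`, and `≈` says that two of them have the same
domain and agree on it. The product of partial bijections is composition on the largest possible
domain; `f.trans g` is `f` followed by `g`. -/
structure IsRestrictionHom {S : Type u} [RestrictionSemigroup S] {Y : Type v}
    (φ : S → PartialEquiv Y Y) : Prop where
  map_mul : ∀ s t, φ (s * t) ≈ (φ t).trans (φ s)
  map_lam : ∀ s, φ (lam s) ≈ (φ s).trans (φ s).symm
  map_rho : ∀ s, φ (rho s) ≈ (φ s).symm.trans (φ s)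

namespace IsRestrictionHom

variable {S : Type u} [RestrictionSemigroup S] {Y : Type v} {φ : S → PartialEquiv Y Y}

theorem source_lam (h : IsRestrictionHom φ) (s : S) : (φ (lam s)).source = (φ s).source := by
  rw [PartialEquiv.EqOnSource.source_eq (h.map_lam s), PartialEquiv.trans_source]
  ext x
  simp only [PartialEquiv.symm_source, Set.mem_inter_iff, Set.mem_preimage, and_iff_left_iff_imp]
  exact fun hx => (φ s).map_source hx

theorem source_rho (h : IsRestrictionHom φ) (s : S) : (φ (rho s)).source = (φ s).target := by
  rw [PartialEquiv.EqOnSource.source_eq (h.map_rho s), PartialEquiv.trans_source]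
  ext x
  simp only [PartialEquiv.symm_source, Set.mem_inter_iff, Set.mem_preimage, and_iff_left_iff_imp]
  exact fun hx => (φ s).map_target hx

theorem apply_proj (h : IsRestrictionHom φ) {e : S} (he : e ∈ proj) {x : Y}
    (hx : x ∈ (φ e).source) : φ e x = x := by
  have h1 := h.map_lam e
  rw [lam_proj e he] at h1
  have h2 := PartialEquiv.EqOnSource.eqOn h1 hx
  rw [h2]
  exact (φ e).left_inv hx

theorem mem_source_mul (h : IsRestrictionHom φ) {s t : S} {x : Y} :
    x ∈ (φ (s * t)).source ↔ x ∈ (φ t).source ∧ φ t x ∈ (φ s).source := by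
  rw [PartialEquiv.EqOnSource.source_eq (h.map_mul s t), PartialEquiv.trans_source]
  rfl

theorem apply_mul (h : IsRestrictionHom φ) {s t : S} {x : Y} (hx : x ∈ (φ (s * t)).source) :
    φ (s * t) x = φ s (φ t x) :=
  PartialEquiv.EqOnSource.eqOn (h.map_mul s t) hx

theorem mem_source_mul_proj (h : IsRestrictionHom φ) {s e : S} (he : e ∈ proj) {x : Y} :
    x ∈ (φ (s * e)).source ↔ x ∈ (φ e).source ∧ x ∈ (φ s).source := by
  rw [h.mem_source_mul]
  constructor
  · rintro ⟨h1, h2⟩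
    exact ⟨h1, by rwa [h.apply_proj he h1] at h2⟩
  · rintro ⟨h1, h2⟩
    exact ⟨h1, by rwa [h.apply_proj he h1]⟩

theorem apply_mul_proj (h : IsRestrictionHom φ) {s e : S} (he : e ∈ proj) {x : Y}
    (hx : x ∈ (φ (s * e)).source) : φ (s * e) x = φ s x := by
  rw [h.apply_mul hx, h.apply_proj he ((h.mem_source_mul_proj he).1 hx).1]

end IsRestrictionHom

/-- An étale action `θ` of a restriction semigroup `S` on a topological space `X`. The domain of
`θ_s` is `D_{λ(s)}` and its image is `D_{ρ(s)}`, where `D_e` denotes the domain of `θ_e`. -/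
structure EtaleAction (S : Type u) [RestrictionSemigroup S] (X : Type v) [TopologicalSpace X] where
  toFun : S → PartialEquiv X X
  isHom : IsRestrictionHom toFun
  isOpen_proj : ∀ e ∈ (proj : Set S), IsOpen (toFun e).source
  cover : ∀ x, ∃ e ∈ (proj : Set S), x ∈ (toFun e).source
  continuousOn : ∀ s, ContinuousOn (toFun s) (toFun s).source
  continuousOn_symm : ∀ s, ContinuousOn (toFun s).symm (toFun s).target

namespace EtaleAction

variable {S : Type u} [RestrictionSemigroup S] {X : Type v} [TopologicalSpace X]

instance : CoeFun (EtaleAction S X) (fun _ => S → PartialEquiv X X) := ⟨EtaleAction.toFun⟩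

variable (θ : EtaleAction S X)

theorem isOpen_source (s : S) : IsOpen (θ s).source := by
  rw [← θ.isHom.source_lam]
  exact θ.isOpen_proj _ (lam_mem s)

theorem isOpen_target (s : S) : IsOpen (θ s).target := by
  rw [← θ.isHom.source_rho]
  exact θ.isOpen_proj _ (rho_mem s)

/-- The homeomorphism `θ_s` from `D_{λ(s)}` onto `D_{ρ(s)}`. -/
def homeo (s : S) : OpenPartialHomeomorph X X where
  toPartialEquiv := θ s
  open_source := θ.isOpen_source s
  open_target := θ.isOpen_target s
  continuousOn_toFun := θ.continuousOn s
  continuousOn_invFun := θ.continuousOn_symm s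

/-- Two pairs `(s, x)` and `(t, y)`, with `x` in the domain of `θ_s` and `y` in the domain of `θ_t`,
have the same germ if `x = y` and `s f = t f` for some projection `f` with `x ∈ D_f`. -/
def germSetoid : Setoid {p : S × X // p.2 ∈ (θ p.1).source} where
  r p q := p.1.2 = q.1.2 ∧ ∃ f ∈ (proj : Set S), p.1.2 ∈ (θ f).source ∧ p.1.1 * f = q.1.1 * f
  iseqv :=
    { refl := fun p => ⟨rfl, by
        obtain ⟨e, he, hx⟩ := θ.cover p.1.2
        exact ⟨e, he, hx, rfl⟩⟩
      symm := by
        rintro p q ⟨h, f, hf, hx, e⟩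
        exact ⟨h.symm, f, hf, h ▸ hx, e.symm⟩
      trans := by
        rintro p q r ⟨h, f, hf, hx, e⟩ ⟨h', f', hf', hx', e'⟩
        refine ⟨h.trans h', f * f', proj_mul_mem f hf f' hf', ?_, ?_⟩
        · rw [θ.isHom.mem_source_mul_proj hf']
          exact ⟨h ▸ hx', hx⟩
        · rw [← mul_assoc, e, mul_assoc, proj_comm f hf f' hf', ← mul_assoc, e', mul_assoc] }

/-- The set of germs of the action `θ`. -/
def Germ : Type (max u v) := Quotient θ.germSetoid

/-- The germ `[s, x]` of `s` at a point `x` of the domain of `θ_s`. -/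
def germ (s : S) (x : X) (hx : x ∈ (θ s).source) : θ.Germ :=
  Quotient.mk θ.germSetoid ⟨(s, x), hx⟩

variable {θ}

theorem germ_eq_iff {s t : S} {x y : X} {hx : x ∈ (θ s).source} {hy : y ∈ (θ t).source} :
    θ.germ s x hx = θ.germ t y hy ↔
      x = y ∧ ∃ f ∈ (proj : Set S), x ∈ (θ f).source ∧ s * f = t * f :=
  ⟨fun h => Quotient.exact h, fun h => Quotient.sound h⟩

theorem germ_ind {P : θ.Germ → Prop} (h : ∀ s x hx, P (θ.germ s x hx)) (z : θ.Germ) : P z :=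
  Quotient.ind (fun p => h p.1.1 p.1.2 p.2) z

theorem apply_eq_of_germ {s t f : S} {x : X} (hx : x ∈ (θ s).source) (hy : x ∈ (θ t).source)
    (hf : f ∈ (proj : Set S)) (hxf : x ∈ (θ f).source) (h : s * f = t * f) : θ s x = θ t x := by
  rw [← θ.isHom.apply_mul_proj hf ((θ.isHom.mem_source_mul_proj hf).2 ⟨hxf, hx⟩), h,
    θ.isHom.apply_mul_proj hf ((θ.isHom.mem_source_mul_proj hf).2 ⟨hxf, hy⟩)]

variable (θ)

/-- The source of the germ `[s, x]` is `x`. -/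
def germSrc : θ.Germ → X := Quotient.lift (fun p => p.1.2) fun _ _ h => h.1

/-- The range of the germ `[s, x]` is `θ_s(x)`. -/
def germTgt : θ.Germ → X := Quotient.lift (fun p => θ p.1.1 p.1.2) (by
  rintro ⟨⟨s, x⟩, hx⟩ ⟨⟨t, y⟩, hy⟩ ⟨h, f, hf, hxf, e⟩
  dsimp only at h hx hy hxf e ⊢
  subst h
  exact apply_eq_of_germ hx hy hf hxf e)

/-- The unit at `x` is the germ `[e, x]`, for any projection `e` with `x ∈ D_e`. -/
noncomputable def germUnit (x : X) : θ.Germ :=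
  θ.germ (θ.cover x).choose x (θ.cover x).choose_spec.2

theorem germUnit_eq {e : S} (he : e ∈ (proj : Set S)) {x : X} (hx : x ∈ (θ e).source) :
    θ.germUnit x = θ.germ e x hx := by
  obtain ⟨h1, h2⟩ := (θ.cover x).choose_spec
  refine germ_eq_iff.2 ⟨rfl, (θ.cover x).choose * e, proj_mul_mem _ h1 _ he, ?_, ?_⟩
  · exact (θ.isHom.mem_source_mul_proj he).2 ⟨hx, h2⟩
  · rw [← mul_assoc, proj_idem _ h1, proj_comm _ h1 _ he, ← mul_assoc, proj_idem _ he]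

/-- The composite of the germs `[s, θ_t(y)]` and `[t, y]` is `[st, y]`. -/
def germComp (z w : θ.Germ) : θ.germSrc z = θ.germTgt w → θ.Germ :=
  Quotient.hrecOn₂ (φ := fun z w => θ.germSrc z = θ.germTgt w → θ.Germ) z w
    (fun p q (h : p.1.2 = θ q.1.1 q.1.2) =>
      θ.germ (p.1.1 * q.1.1) q.1.2 (θ.isHom.mem_source_mul.2 ⟨q.2, h ▸ p.2⟩)) (by
    rintro ⟨⟨s, x⟩, hx⟩ ⟨⟨t, y⟩, hy⟩ ⟨⟨s', x'⟩, hx'⟩ ⟨⟨t', y'⟩, hy'⟩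
      ⟨h1, f, hf, hxf, e1⟩ ⟨h2, e, he, hye, e2⟩
    dsimp only at h1 h2 hx hy hx' hy' hxf hye e1 e2 ⊢
    subst h1 h2
    have hθ : θ t y = θ t' y := apply_eq_of_germ hy hy' he hye e2
    refine Function.hfunext (congrArg (fun v => x = v) hθ) ?_
    intro h h' _
    refine heq_of_eq (germ_eq_iff.2 ⟨rfl, ?_⟩)
    -- the projection implementing the equivalence is `λ(f t e)`
    have hm : f * t * e = f * t' * e := by rw [mul_assoc, e2, ← mul_assoc]
    refine ⟨lam (f * t * e), lam_mem _, ?_, ?_⟩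
    · rw [θ.isHom.source_lam, θ.isHom.mem_source_mul_proj he, θ.isHom.mem_source_mul]
      exact ⟨hye, hy, by rwa [← h]⟩
    · have key : ∀ r : S, f * (r * e) = r * e * lam (f * (r * e)) := fun r => proj_mul f hf _
      have hl : lam (f * t * e) = e * lam (f * t * e) := by
        have h3 : f * t * e * e = f * t * e := by rw [mul_assoc, proj_idem e he]
        have h4 : lam (f * t * e) = lam (f * t * e) * e := by
          have := lam_mul_eq (f * t * e) e
          rw [h3, lam_proj _ (proj_mul_mem _ (lam_mem _) _ he)] at this
          exact this
        rw [proj_comm e he _ (lam_mem _)]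
        exact h4
      have k1 : t * lam (f * t * e) = f * t * e := by
        rw [hl, ← mul_assoc, mul_assoc f t e, ← key t]
      have k2 : t' * lam (f * t * e) = f * t' * e := by
        rw [hl, ← mul_assoc, hm, mul_assoc f t' e, ← key t']
      rw [mul_assoc s t, k1, mul_assoc s' t', k2, mul_assoc f t e, mul_assoc f t' e,
        ← mul_assoc s f, e1, e2, mul_assoc s' f])

theorem germComp_germ (s t : S) (x y : X) (hx : x ∈ (θ s).source) (hy : y ∈ (θ t).source)
    (h : x = θ t y) : θ.germComp (θ.germ s x hx) (θ.germ t y hy) h =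
      θ.germ (s * t) y (θ.isHom.mem_source_mul.2 ⟨hy, h ▸ hx⟩) := rfl

/-- The set `Θ(s, U)` of germs `[s, x]` with `x ∈ U`. -/
def germSet (s : S) (U : Set X) : Set θ.Germ :=
  {z | ∃ x, ∃ hx : x ∈ (θ s).source, x ∈ U ∧ z = θ.germ s x hx}

/-- The topology of the space of germs, generated by the sets `Θ(s, U)` for `U ⊆ D_{λ(s)}` open. -/
instance : TopologicalSpace θ.Germ :=
  TopologicalSpace.generateFrom
    {W | ∃ s : S, ∃ U : Set X, IsOpen U ∧ U ⊆ (θ s).source ∧ W = θ.germSet s U}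

theorem isTopologicalBasis_germ : TopologicalSpace.IsTopologicalBasis
    {W | ∃ s : S, ∃ U : Set X, IsOpen U ∧ U ⊆ (θ s).source ∧ W = θ.germSet s U} where
  exists_subset_inter := by
    rintro _ ⟨s, U, hU, hUs, rfl⟩ _ ⟨t, V, hV, hVt, rfl⟩ z ⟨⟨x, hx, hxU, rfl⟩, ⟨y, hy, hyV, he⟩⟩
    obtain ⟨rfl, f, hf, hxf, hst⟩ := germ_eq_iff.1 he
    refine ⟨_, ⟨s, U ∩ V ∩ (θ f).source, (hU.inter hV).inter (θ.isOpen_source f),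
      fun w hw => hUs hw.1.1, rfl⟩, ⟨x, hx, ⟨⟨hxU, hyV⟩, hxf⟩, rfl⟩, ?_⟩
    rintro _ ⟨w, hw, hwU, rfl⟩
    exact ⟨⟨w, hw, hwU.1.1, rfl⟩, ⟨w, hVt hwU.1.2, hwU.1.2,
      germ_eq_iff.2 ⟨rfl, f, hf, hwU.2, hst⟩⟩⟩
  sUnion_eq := by
    refine Set.eq_univ_of_forall (germ_ind fun s x hx => ?_)
    exact ⟨_, ⟨s, (θ s).source, θ.isOpen_source s, subset_rfl, rfl⟩, ⟨x, hx, hx, rfl⟩⟩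
  eq_generateFrom := rfl

theorem isOpen_germSet (s : S) {U : Set X} (hU : IsOpen U) : IsOpen (θ.germSet s U) := by
  have h : θ.germSet s U = θ.germSet s (U ∩ (θ s).source) := by
    ext z
    constructor
    · rintro ⟨x, hx, hxU, rfl⟩
      exact ⟨x, hx, ⟨hxU, hx⟩, rfl⟩
    · rintro ⟨x, hx, hxU, rfl⟩
      exact ⟨x, hx, hxU.1, rfl⟩
  rw [h]
  exact θ.isTopologicalBasis_germ.isOpen
    ⟨s, _, hU.inter (θ.isOpen_source s), Set.inter_subset_right, rfl⟩

theorem continuous_germSrc : Continuous θ.germSrc := by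
  rw [continuous_def]
  intro U hU
  have h : θ.germSrc ⁻¹' U = ⋃ s, θ.germSet s U := by
    ext z
    induction z using germ_ind with
    | h s x hx =>
      simp only [Set.mem_preimage, Set.mem_iUnion]
      constructor
      · intro h
        exact ⟨s, x, hx, h, rfl⟩
      · rintro ⟨t, y, hy, hyU, he⟩
        obtain ⟨rfl, -⟩ := germ_eq_iff.1 he
        exact hyU
  rw [h]
  exact isOpen_iUnion fun s => θ.isOpen_germSet s hU

theorem continuous_germTgt : Continuous θ.germTgt := by
  rw [continuous_def]
  intro U hU
  have h : θ.germTgt ⁻¹' U = ⋃ s, θ.germSet s ((θ s).source ∩ θ s ⁻¹' U) := by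
    ext z
    induction z using germ_ind with
    | h s x hx =>
      simp only [Set.mem_preimage, Set.mem_iUnion]
      constructor
      · intro h
        exact ⟨s, x, hx, ⟨hx, h⟩, rfl⟩
      · rintro ⟨t, y, hy, hyU, he⟩
        rw [he]
        exact hyU.2
  rw [h]
  exact isOpen_iUnion fun s => θ.isOpen_germSet s ((θ.homeo s).isOpen_inter_preimage hU)

theorem isOpenMap_germSrc : IsOpenMap θ.germSrc := by
  rw [θ.isTopologicalBasis_germ.isOpenMap_iff]
  rintro _ ⟨s, U, hU, hUs, rfl⟩
  convert hU
  ext x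
  constructor
  · rintro ⟨_, ⟨y, hy, hyU, rfl⟩, rfl⟩
    exact hyU
  · intro hx
    exact ⟨_, ⟨x, hUs hx, hx, rfl⟩, rfl⟩

theorem isOpenMap_germTgt : IsOpenMap θ.germTgt := by
  rw [θ.isTopologicalBasis_germ.isOpenMap_iff]
  rintro _ ⟨s, U, hU, hUs, rfl⟩
  convert (θ.homeo s).isOpen_image_of_subset_source hU hUs
  ext x
  constructor
  · rintro ⟨_, ⟨y, hy, hyU, rfl⟩, rfl⟩
    exact ⟨y, hyU, rfl⟩
  · rintro ⟨y, hy, rfl⟩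
    exact ⟨_, ⟨y, hUs hy, hy, rfl⟩, rfl⟩

theorem isLocalHomeomorph_of_injOn {Y : Type v} {Z : Type w} [TopologicalSpace Y]
    [TopologicalSpace Z] {f : Z → Y} (hc : Continuous f) (ho : IsOpenMap f)
    (hi : ∀ z, ∃ U, IsOpen U ∧ z ∈ U ∧ Set.InjOn f U) : IsLocalHomeomorph f := by
  rw [isLocalHomeomorph_iff_isOpenEmbedding_restrict]
  intro z
  obtain ⟨U, hU, hz, hinj⟩ := hi z
  refine ⟨U, hU.mem_nhds hz, ?_⟩
  refine Topology.IsOpenEmbedding.of_continuous_injective_isOpenMap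
    (hc.comp continuous_subtype_val) ?_ (ho.comp hU.isOpenMap_subtype_val)
  exact fun a b h => Subtype.ext (hinj a.2 b.2 h)

theorem injOn_germSrc (s : S) : Set.InjOn θ.germSrc (θ.germSet s Set.univ) := by
  rintro _ ⟨x, hx, -, rfl⟩ _ ⟨y, hy, -, rfl⟩ h
  have h' : x = y := h
  subst h'
  rfl

theorem injOn_germTgt (s : S) : Set.InjOn θ.germTgt (θ.germSet s Set.univ) := by
  rintro _ ⟨x, hx, -, rfl⟩ _ ⟨y, hy, -, rfl⟩ h
  have h' : x = y := (θ s).injOn hx hy h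
  subst h'
  rfl

theorem exists_germSet (z : θ.Germ) : ∃ s, z ∈ θ.germSet s Set.univ := by
  induction z using germ_ind with
  | h s x hx => exact ⟨s, x, hx, trivial, rfl⟩

theorem isEmbedding_germUnit : Topology.IsEmbedding θ.germUnit := by
  have hinj : Function.Injective θ.germUnit := fun x y h => (germ_eq_iff.1 h).1
  refine (Topology.IsOpenEmbedding.of_continuous_injective_isOpenMap ?_ hinj ?_).isEmbedding
  · refine θ.isTopologicalBasis_germ.continuous_iff.2 ?_
    rintro _ ⟨s, U, hU, hUs, rfl⟩
    rw [isOpen_iff_mem_nhds]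
    rintro x ⟨y, hy, hyU, he⟩
    obtain ⟨rfl, f, hf, hxf, hef⟩ := germ_eq_iff.1 he
    obtain ⟨h1, h2⟩ := (θ.cover x).choose_spec
    filter_upwards [hU.mem_nhds hyU, (θ.isOpen_source f).mem_nhds hxf,
      (θ.isOpen_source _).mem_nhds h2] with y hyU hyf hye
    refine ⟨y, hUs hyU, hyU, ?_⟩
    rw [θ.germUnit_eq h1 hye]
    exact germ_eq_iff.2 ⟨rfl, f, hf, hyf, hef⟩
  · intro U hU
    have h : θ.germUnit '' U = ⋃ e : (proj : Set S), θ.germSet e U := by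
      ext z
      simp only [Set.mem_iUnion]
      constructor
      · rintro ⟨x, hx, rfl⟩
        exact ⟨⟨_, (θ.cover x).choose_spec.1⟩, x, (θ.cover x).choose_spec.2, hx, rfl⟩
      · rintro ⟨⟨e, he⟩, x, hx, hxU, rfl⟩
        exact ⟨x, hxU, θ.germUnit_eq he hx⟩
    rw [h]
    exact isOpen_iUnion fun e => θ.isOpen_germSet _ hU

theorem continuous_germComp : Continuous fun p : {p : θ.Germ × θ.Germ //
    θ.germSrc p.1 = θ.germTgt p.2} => θ.germComp p.1.1 p.1.2 p.2 := by
  refine θ.isTopologicalBasis_germ.continuous_iff.2 ?_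
  rintro _ ⟨r, V, hV, hVr, rfl⟩
  rw [isOpen_iff_mem_nhds]
  rintro ⟨⟨z, w⟩, hzw⟩ hmem
  obtain ⟨s, x, hx, rfl⟩ : ∃ s x hx, z = θ.germ s x hx := by
    induction z using germ_ind with
    | h s x hx => exact ⟨s, x, hx, rfl⟩
  obtain ⟨t, y, hy, rfl⟩ : ∃ t y hy, w = θ.germ t y hy := by
    induction w using germ_ind with
    | h t y hy => exact ⟨t, y, hy, rfl⟩
  obtain ⟨y', hy', hyV, he⟩ := hmem
  obtain ⟨rfl, e, hep, hye, hste⟩ := germ_eq_iff.1 he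
  have hO : IsOpen ((Prod.fst ⁻¹' θ.germSet s Set.univ) ∩
      (Prod.snd ⁻¹' θ.germSet t (V ∩ (θ e).source)) : Set (θ.Germ × θ.Germ)) :=
    ((θ.isOpen_germSet s isOpen_univ).preimage continuous_fst).inter
      ((θ.isOpen_germSet t (hV.inter (θ.isOpen_source e))).preimage continuous_snd)
  refine Filter.mem_of_superset ((hO.preimage continuous_subtype_val).mem_nhds
    ⟨⟨x, hx, trivial, rfl⟩, ⟨y, hy, ⟨hyV, hye⟩, rfl⟩⟩) ?_
  rintro ⟨⟨_, _⟩, h⟩ ⟨⟨x', hx', -, rfl⟩, ⟨y', hy', ⟨hyV', hye'⟩, rfl⟩⟩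
  exact ⟨y', hVr hyV', hyV', germ_eq_iff.2 ⟨rfl, e, hep, hye', hste⟩⟩

/-- The category of germs `𝒞(θ, S, X)` of an étale action on a locally compact Hausdorff space. -/
noncomputable def germCategory [LocallyCompactSpace X] [T2Space X] : EtaleCategory X θ.Germ where
  src := θ.germSrc
  tgt := θ.germTgt
  unit := θ.germUnit
  comp := θ.germComp
  src_unit _ := rfl
  tgt_unit x := θ.isHom.apply_proj (θ.cover x).choose_spec.1 (θ.cover x).choose_spec.2
  src_comp z w := by
    induction z using germ_ind with
    | h s x hx =>
      induction w using germ_ind with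
      | h t y hy => exact fun _ => rfl
  tgt_comp z w := by
    induction z using germ_ind with
    | h s x hx =>
      induction w using germ_ind with
      | h t y hy =>
        intro h
        have h' : x = θ t y := h
        subst h'
        exact θ.isHom.apply_mul (θ.isHom.mem_source_mul.2 ⟨hy, hx⟩)
  comp_unit z := by
    induction z using germ_ind with
    | h s x hx =>
      obtain ⟨h1, h2⟩ := (θ.cover x).choose_spec
      exact germ_eq_iff.2 ⟨rfl, _, h1, h2,
        (mul_assoc _ _ _).trans (congrArg (s * ·) (proj_idem _ h1))⟩
  unit_comp z := by
    induction z using germ_ind with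
    | h s x hx =>
      obtain ⟨h1, h2⟩ := (θ.cover (θ s x)).choose_spec
      set e := (θ.cover (θ s x)).choose with he
      refine germ_eq_iff.2 ⟨rfl, lam (e * s), lam_mem _, ?_, ?_⟩
      · rw [θ.isHom.source_lam, θ.isHom.mem_source_mul]
        exact ⟨hx, h2⟩
      · change e * s * lam (e * s) = s * lam (e * s)
        rw [← mul_lam, ← proj_mul e h1]
  assoc z w k := by
    induction z using germ_ind with
    | h s x hx =>
      induction w using germ_ind with
      | h t y hy =>
        induction k using germ_ind with
        | h r a ha =>
          intro h h'
          obtain ⟨e, he, hae⟩ := θ.cover a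
          refine germ_eq_iff.2 ⟨rfl, e, he, hae, ?_⟩
          rw [mul_assoc s t r]
  continuous_comp := θ.continuous_germComp
  t2Space := inferInstance
  locallyCompactSpace := inferInstance
  isLocalHomeomorph_src := isLocalHomeomorph_of_injOn θ.continuous_germSrc θ.isOpenMap_germSrc
    fun z => (θ.exists_germSet z).imp' (fun s => θ.germSet s Set.univ) fun s hs =>
      ⟨θ.isOpen_germSet s isOpen_univ, hs, θ.injOn_germSrc s⟩
  isLocalHomeomorph_tgt := isLocalHomeomorph_of_injOn θ.continuous_germTgt θ.isOpenMap_germTgt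
    fun z => (θ.exists_germSet z).imp' (fun s => θ.germSet s Set.univ) fun s hs =>
      ⟨θ.isOpen_germSet s isOpen_univ, hs, θ.injOn_germTgt s⟩
  isEmbedding_unit := θ.isEmbedding_germUnit

end EtaleAction

/-- Closed two-sided ideals of a C*-algebra. (That they are closed under the involution is
automatic; it is included for convenience.) -/
structure IsClosedIdeal {A : Type v} [NonUnitalCStarAlgebra A] (J : Set A) : Prop where
  zero_mem : (0 : A) ∈ J
  add_mem : ∀ a ∈ J, ∀ b ∈ J, a + b ∈ J
  smul_mem : ∀ (c : ℂ), ∀ a ∈ J, c • a ∈ J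
  mul_mem_left : ∀ (x : A), ∀ a ∈ J, x * a ∈ J
  mul_mem_right : ∀ a ∈ J, ∀ (x : A), a * x ∈ J
  star_mem : ∀ a ∈ J, star a ∈ J
  isClosed : IsClosed J

/-- An étale action `α` of a restriction semigroup `S` on a C*-algebra `A`: a restriction semigroup
homomorphism `α` from `S` to the partial bijections of `A` such that the domain `J_e` of `α_e` is a
closed ideal for every projection `e`, these ideals span a dense subspace, and every `α_s` is a
*-isomorphism from `J_{λ(s)}` onto `J_{ρ(s)}`. -/
structure CStarEtaleAction (S : Type u) [RestrictionSemigroup S] (A : Type v)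
    [NonUnitalCStarAlgebra A] where
  toFun : S → PartialEquiv A A
  isHom : IsRestrictionHom toFun
  isClosedIdeal : ∀ e ∈ (proj : Set S), IsClosedIdeal (toFun e).source
  dense_span : (Submodule.span ℂ (⋃ e ∈ (proj : Set S), (toFun e).source)).topologicalClosure = ⊤
  apply_add : ∀ s, ∀ a ∈ (toFun s).source, ∀ b ∈ (toFun s).source,
    toFun s (a + b) = toFun s a + toFun s b
  apply_smul : ∀ s, ∀ (c : ℂ), ∀ a ∈ (toFun s).source, toFun s (c • a) = c • toFun s a
  apply_mul : ∀ s, ∀ a ∈ (toFun s).source, ∀ b ∈ (toFun s).source,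
    toFun s (a * b) = toFun s a * toFun s b
  apply_star : ∀ s, ∀ a ∈ (toFun s).source, toFun s (star a) = star (toFun s a)

namespace CStarEtaleAction

variable {S : Type u} [RestrictionSemigroup S] {A : Type v} [NonUnitalCStarAlgebra A]

instance : CoeFun (CStarEtaleAction S A) (fun _ => S → PartialEquiv A A) :=
  ⟨CStarEtaleAction.toFun⟩

variable (α : CStarEtaleAction S A)

/-- The ideal `J_{ρ(s)}`. -/
def ranIdeal (s : S) : Submodule ℂ A where
  carrier := (α (rho s)).source
  zero_mem' := (α.isClosedIdeal _ (rho_mem s)).zero_mem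
  add_mem' := fun {a b} ha hb => (α.isClosedIdeal _ (rho_mem s)).add_mem a ha b hb
  smul_mem' := fun c a ha => (α.isClosedIdeal _ (rho_mem s)).smul_mem c a ha

theorem mem_ranIdeal_iff {s : S} {a : A} : a ∈ α.ranIdeal s ↔ a ∈ (α s).target := by
  rw [← α.isHom.source_rho s]
  rfl

theorem isClosedIdeal_source (s : S) : IsClosedIdeal (α s).source := by
  rw [← α.isHom.source_lam]
  exact α.isClosedIdeal _ (lam_mem s)

theorem isClosedIdeal_target (s : S) : IsClosedIdeal (α s).target := by
  rw [← α.isHom.source_rho]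
  exact α.isClosedIdeal _ (rho_mem s)

theorem symm_add {s : S} {a b : A} (ha : a ∈ (α s).target) (hb : b ∈ (α s).target) :
    (α s).symm (a + b) = (α s).symm a + (α s).symm b := by
  have ha' := (α s).map_target ha
  have hb' := (α s).map_target hb
  have h := α.apply_add s _ ha' _ hb'
  rw [(α s).right_inv ha, (α s).right_inv hb] at h
  rw [← h, (α s).left_inv ((α.isClosedIdeal_source s).add_mem _ ha' _ hb')]

theorem symm_smul {s : S} (c : ℂ) {a : A} (ha : a ∈ (α s).target) :
    (α s).symm (c • a) = c • (α s).symm a := by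
  have ha' := (α s).map_target ha
  have h := α.apply_smul s c _ ha'
  rw [(α s).right_inv ha] at h
  rw [← h, (α s).left_inv ((α.isClosedIdeal_source s).smul_mem c _ ha')]

theorem symm_mul_mem {s : S} {a : A} (ha : a ∈ (α s).target) (b : A) :
    (α s).symm a * b ∈ (α s).source :=
  (α.isClosedIdeal_source s).mul_mem_right _ ((α s).map_target ha) b

theorem mul_mem_ranIdeal {s t : S} {a b : A} (ha : a ∈ α.ranIdeal s) (hb : b ∈ α.ranIdeal t) :
    α s ((α s).symm a * b) ∈ α.ranIdeal (s * t) := by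
  have ha' := α.mem_ranIdeal_iff.1 ha
  have h1 : (α s).symm a * b ∈ (α (s * rho t)).source :=
    (α.isHom.mem_source_mul_proj (rho_mem t)).2
      ⟨(α.isClosedIdeal _ (rho_mem t)).mul_mem_left _ _ hb, α.symm_mul_mem ha' b⟩
  have h2 := (α (s * rho t)).map_source h1
  rw [α.isHom.apply_mul_proj (rho_mem t) h1, ← α.mem_ranIdeal_iff] at h2
  change _ ∈ (α (rho (s * t))).source
  rw [rho_mul_eq]
  exact h2

/-- The product of `a δ_s` and `b δ_t`, as an element `α_s(α_s⁻¹(a) b)` of `J_{ρ(st)}`. -/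
noncomputable def mulCoeff (s t : S) :
    α.ranIdeal s →ₗ[ℂ] α.ranIdeal t →ₗ[ℂ] α.ranIdeal (s * t) :=
  LinearMap.mk₂ ℂ (fun a b => ⟨α s ((α s).symm (a : A) * b), α.mul_mem_ranIdeal a.2 b.2⟩)
    (fun a a' b => Subtype.ext (by
      have ha := α.mem_ranIdeal_iff.1 a.2
      have ha' := α.mem_ranIdeal_iff.1 a'.2
      simp only [Submodule.coe_add]
      rw [α.symm_add ha ha', add_mul,
        α.apply_add s _ (α.symm_mul_mem ha _) _ (α.symm_mul_mem ha' _)]))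
    (fun c a b => Subtype.ext (by
      have ha := α.mem_ranIdeal_iff.1 a.2
      simp only [Submodule.coe_smul]
      rw [α.symm_smul c ha, smul_mul_assoc, α.apply_smul s c _ (α.symm_mul_mem ha _)]))
    (fun a b b' => Subtype.ext (by
      have ha := α.mem_ranIdeal_iff.1 a.2
      simp only [Submodule.coe_add]
      rw [mul_add, α.apply_add s _ (α.symm_mul_mem ha _) _ (α.symm_mul_mem ha _)]))
    (fun c a b => Subtype.ext (by
      have ha := α.mem_ranIdeal_iff.1 a.2
      simp only [Submodule.coe_smul]
      rw [mul_smul_comm, α.apply_smul s c _ (α.symm_mul_mem ha _)]))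

/-- The vector space `L_α` of finite formal sums `∑ a_s δ_s` with `a_s ∈ J_{ρ(s)}`. -/
def FormalSums : Type (max u v) := DirectSum S fun s => α.ranIdeal s

noncomputable instance : AddCommGroup α.FormalSums :=
  inferInstanceAs (AddCommGroup (DirectSum S fun s => α.ranIdeal s))

noncomputable instance : Module ℂ α.FormalSums :=
  inferInstanceAs (Module ℂ (DirectSum S fun s => α.ranIdeal s))

open Classical in
/-- The formal sum `a δ_s`. -/
noncomputable def single (s : S) : α.ranIdeal s →ₗ[ℂ] α.FormalSums :=
  DirectSum.lof ℂ S (fun s => α.ranIdeal s) s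

open Classical in
/-- The linear map on formal sums which is `F s` on the summand `J_{ρ(s)} δ_s`. -/
noncomputable def lift {M : Type w} [AddCommGroup M] [Module ℂ M]
    (F : ∀ s, α.ranIdeal s →ₗ[ℂ] M) : α.FormalSums →ₗ[ℂ] M :=
  DirectSum.toModule ℂ S M F

theorem lift_single {M : Type w} [AddCommGroup M] [Module ℂ M]
    (F : ∀ s, α.ranIdeal s →ₗ[ℂ] M) (s : S) (a : α.ranIdeal s) :
    α.lift F (α.single s a) = F s a := by
  classical
  exact DirectSum.toModule_lof ℂ (M := fun s => α.ranIdeal s) s a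

theorem formalSums_ind {P : α.FormalSums → Prop} (x : α.FormalSums) (zero : P 0)
    (single : ∀ s a, P (α.single s a)) (add : ∀ x y, P x → P y → P (x + y)) : P x := by
  classical
  exact DirectSum.induction_on x zero single add

/-- The multiplication of `L_α`: the bilinear map given by
`(a δ_s)(b δ_t) = α_s(α_s⁻¹(a) b) δ_{st}`. -/
noncomputable def mulHom : α.FormalSums →ₗ[ℂ] α.FormalSums →ₗ[ℂ] α.FormalSums :=
  α.lift fun s => (α.lift fun t => ((α.mulCoeff s t).compr₂ (α.single (s * t))).flip).flip

noncomputable instance : Mul α.FormalSums := ⟨fun x y => α.mulHom x y⟩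

theorem single_mul_single (s t : S) (a : α.ranIdeal s) (b : α.ranIdeal t) :
    α.single s a * α.single t b = α.single (s * t) (α.mulCoeff s t a b) := by
  change α.mulHom (α.single s a) (α.single t b) = _
  rw [mulHom, lift_single, LinearMap.flip_apply, lift_single]
  rfl

theorem single_congr {s t : S} (h : s = t) {a : α.ranIdeal s} {b : α.ranIdeal t}
    (hab : (a : A) = b) : α.single s a = α.single t b := by
  subst h
  rw [Subtype.ext hab]

theorem eq_zero_of_mul_eq_zero {J : Set A} (hJ : IsClosedIdeal J) {d : A} (hd : d ∈ J)
    (h : ∀ k ∈ J, d * k = 0) : d = 0 :=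
  CStarRing.mul_star_self_eq_zero_iff d |>.1 (h _ (hJ.star_mem d hd))

theorem apply_symm_mul {s : S} {b : A} (hb : b ∈ (α s).target) (x c : A) :
    α s ((α s).symm (x * b) * c) = x * α s ((α s).symm b * c) := by
  have hI := α.isClosedIdeal_target s
  have hxb := hI.mul_mem_left x b hb
  have h1 := (α s).map_source (α.symm_mul_mem hxb c)
  have h2 := (α s).map_source (α.symm_mul_mem hb c)
  rw [← sub_eq_zero]
  refine eq_zero_of_mul_eq_zero hI ?_ ?_
  · have h3 := hI.add_mem _ h1 _ (hI.smul_mem (-1) _ (hI.mul_mem_left x _ h2))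
    rwa [neg_one_smul, ← sub_eq_add_neg] at h3
  · intro k hk
    have hk' := (α s).map_target hk
    have hck := (α.isClosedIdeal_source s).mul_mem_left c _ hk'
    have key : ∀ y ∈ (α s).target, α s ((α s).symm y * c) * k = y * α s (c * (α s).symm k) := by
      intro y hy
      have h4 := α.apply_mul s _ (α.symm_mul_mem hy c) _ hk'
      rw [(α s).right_inv hk] at h4
      rw [← h4, mul_assoc, α.apply_mul s _ ((α s).map_target hy) _ hck, (α s).right_inv hy]
    rw [sub_mul, key _ hxb, mul_assoc x b, mul_assoc x _ k, key _ hb, sub_self]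

theorem single_mul_assoc (r s t : S) (a : α.ranIdeal r) (b : α.ranIdeal s) (c : α.ranIdeal t) :
    α.single r a * α.single s b * α.single t c = α.single r a * (α.single s b * α.single t c) := by
  rw [single_mul_single, single_mul_single, single_mul_single, single_mul_single]
  refine α.single_congr (mul_assoc r s t) ?_
  have ha := α.mem_ranIdeal_iff.1 a.2
  have hb := α.mem_ranIdeal_iff.1 b.2
  change α (r * s) ((α (r * s)).symm (α r ((α r).symm (a : A) * b)) * c) =
    α r ((α r).symm (a : A) * α s ((α s).symm (b : A) * c))
  rw [← α.apply_symm_mul hb]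
  set d := (α r).symm (a : A) * b with hd
  have hdr : d ∈ (α r).source := α.symm_mul_mem ha _
  have hds : d ∈ (α s).target := (α.isClosedIdeal_target s).mul_mem_left _ _ hb
  have hd' : (α s).symm d ∈ (α (r * s)).source :=
    α.isHom.mem_source_mul.2 ⟨(α s).map_target hds, by rwa [(α s).right_inv hds]⟩
  have h1 : α (r * s) ((α s).symm d) = α r d := by
    rw [α.isHom.apply_mul hd', (α s).right_inv hds]
  rw [← h1, (α (r * s)).left_inv hd', α.isHom.apply_mul
    ((α.isClosedIdeal_source (r * s)).mul_mem_right _ hd' _)]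

/-- `L_α` is an associative algebra. -/
noncomputable instance : NonUnitalRing α.FormalSums where
  left_distrib x y z := map_add (α.mulHom x) y z
  right_distrib x y z := LinearMap.map_add₂ α.mulHom x y z
  zero_mul x := LinearMap.map_zero₂ α.mulHom x
  mul_zero x := map_zero (α.mulHom x)
  mul_assoc x y z := by
    have hl : ∀ x y z : α.FormalSums, (x + y) * z = x * z + y * z :=
      LinearMap.map_add₂ α.mulHom
    have hr : ∀ x y z : α.FormalSums, x * (y + z) = x * y + x * z :=
      fun x y z => map_add (α.mulHom x) y z
    have h0 : ∀ x : α.FormalSums, 0 * x = 0 := LinearMap.map_zero₂ α.mulHom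
    have h0' : ∀ x : α.FormalSums, x * 0 = 0 := fun x => map_zero (α.mulHom x)
    refine α.formalSums_ind (P := fun x => x * y * z = x * (y * z)) x
      (by simp only [h0]) (fun r a => ?_)
      (fun x x' h h' => by simp only [hl, h, h'])
    refine α.formalSums_ind (P := fun y => α.single r a * y * z = α.single r a * (y * z)) y
      (by simp only [h0, h0']) (fun s b => ?_)
      (fun y y' h h' => by simp only [hl, hr, h, h'])
    refine α.formalSums_ind (P := fun z =>
      α.single r a * α.single s b * z = α.single r a * (α.single s b * z)) z
      (by simp only [h0']) (fun t c => ?_)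
      (fun z z' h h' => by simp only [hr, h, h'])
    exact α.single_mul_assoc r s t a b c

instance : IsScalarTower ℂ α.FormalSums α.FormalSums :=
  ⟨fun c x y => LinearMap.map_smul₂ α.mulHom c x y⟩

instance : SMulCommClass ℂ α.FormalSums α.FormalSums :=
  ⟨fun c x y => (map_smul (α.mulHom x) c y).symm⟩

end CStarEtaleAction

/-- A representation of a restriction semigroup on a Hilbert space: a semigroup homomorphism into
the contractions which sends projections to orthogonal projections. -/
structure IsSemigroupRepresentation {S : Type u} [RestrictionSemigroup S] {H : Type w}
    [NormedAddCommGroup H] [InnerProductSpace ℂ H] [CompleteSpace H] (σ : S → H →L[ℂ] H) :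
    Prop where
  map_mul : ∀ s t, σ (s * t) = σ s * σ t
  norm_le : ∀ s, ‖σ s‖ ≤ 1
  adjoint_proj : ∀ e ∈ (proj : Set S), ContinuousLinearMap.adjoint (σ e) = σ e
  sq_proj : ∀ e ∈ (proj : Set S), σ e * σ e = σ e

namespace CStarEtaleAction

variable {S : Type u} [RestrictionSemigroup S] {A : Type v} [NonUnitalCStarAlgebra A]
variable (α : CStarEtaleAction S A)

/-- A covariant pair `(π, σ)` for `α` on a Hilbert space `H`. -/
structure IsCovariantPair {H : Type w} [NormedAddCommGroup H] [InnerProductSpace ℂ H]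
    [CompleteSpace H] (π : A →⋆ₙₐ[ℂ] (H →L[ℂ] H)) (σ : S → H →L[ℂ] H) : Prop where
  isRep : IsSemigroupRepresentation σ
  covariant : ∀ s, ∀ a ∈ (α s).source, π (α s a) * σ s = σ s * π a
  range_proj : ∀ e ∈ (proj : Set S),
    closure (Submodule.span ℂ {h : H | ∃ a ∈ (α e).source, ∃ k : H, π a k = h} : Set H) =
      Set.range (σ e)

/-- The linear map `π × σ` on `L_α` with `(π × σ)(a δ_s) = π(a) σ_s`. -/
noncomputable def integrated {H : Type w} [NormedAddCommGroup H] [InnerProductSpace ℂ H]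
    [CompleteSpace H] (π : A →⋆ₙₐ[ℂ] (H →L[ℂ] H)) (σ : S → H →L[ℂ] H) :
    α.FormalSums →ₗ[ℂ] (H →L[ℂ] H) :=
  α.lift fun s =>
    { toFun := fun a => π a * σ s
      map_add' := fun a b => by rw [Submodule.coe_add, map_add, add_mul]
      map_smul' := fun c a => by
        rw [Submodule.coe_smul, map_smul, smul_mul_assoc, RingHom.id_apply] }

section

variable {H : Type w} [NormedAddCommGroup H] [InnerProductSpace ℂ H] [CompleteSpace H]
variable {α} {π : A →⋆ₙₐ[ℂ] (H →L[ℂ] H)} {σ : S → H →L[ℂ] H}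

theorem integrated_single (s : S) (a : α.ranIdeal s) :
    α.integrated π σ (α.single s a) = π a * σ s := α.lift_single _ s a

theorem IsCovariantPair.integrated_mul (h : α.IsCovariantPair π σ) (x y : α.FormalSums) :
    α.integrated π σ (x * y) = α.integrated π σ x * α.integrated π σ y := by
  refine α.formalSums_ind (P := fun x =>
    α.integrated π σ (x * y) = α.integrated π σ x * α.integrated π σ y) x
    (by simp only [zero_mul, map_zero]) (fun s a => ?_)
    (fun x x' h h' => by simp only [add_mul, map_add, h, h'])
  refine α.formalSums_ind (P := fun y =>
    α.integrated π σ (α.single s a * y) =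
      α.integrated π σ (α.single s a) * α.integrated π σ y) y
    (by simp only [mul_zero, map_zero]) (fun t b => ?_)
    (fun y y' h h' => by simp only [mul_add, map_add, h, h'])
  have ha := α.mem_ranIdeal_iff.1 a.2
  rw [single_mul_single, integrated_single, integrated_single, integrated_single]
  change π (α s ((α s).symm (a : A) * b)) * σ (s * t) = _
  rw [h.isRep.map_mul, ← mul_assoc, h.covariant s _ (α.symm_mul_mem ha _), map_mul, ← mul_assoc,
    ← h.covariant s _ ((α s).map_target ha), (α s).right_inv ha]
  simp only [mul_assoc]

end

/-- The set of seminorms on `L_α` arising from covariant pairs on Hilbert spaces. -/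
def covSeminorms : Set (Seminorm ℂ α.FormalSums) :=
  {p | ∃ (H : Type (max u v)) (_ : NormedAddCommGroup H) (_ : InnerProductSpace ℂ H)
    (_ : CompleteSpace H) (π : A →⋆ₙₐ[ℂ] (H →L[ℂ] H)) (σ : S → H →L[ℂ] H),
      α.IsCovariantPair π σ ∧ ∀ x, p x = ‖α.integrated π σ x‖}

theorem bddAbove_covSeminorms : BddAbove α.covSeminorms := by
  rw [Seminorm.bddAbove_iff]
  have key : ∀ x : α.FormalSums, ∃ M : ℝ, ∀ p ∈ α.covSeminorms, p x ≤ M := by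
    intro x
    refine α.formalSums_ind (P := fun x => ∃ M : ℝ, ∀ p ∈ α.covSeminorms, p x ≤ M) x
      ⟨0, fun p _ => (map_zero p).le⟩ (fun s a => ⟨‖(a : A)‖, ?_⟩) ?_
    · rintro p ⟨H, _, _, _, π, σ, hπσ, hp⟩
      rw [hp, integrated_single]
      calc ‖π a * σ s‖ ≤ ‖π a‖ * ‖σ s‖ := norm_mul_le _ _
        _ ≤ ‖(a : A)‖ * 1 := mul_le_mul (NonUnitalStarAlgHom.norm_apply_le π _)
            (hπσ.isRep.norm_le s) (norm_nonneg _) (norm_nonneg _)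
        _ = ‖(a : A)‖ := mul_one _
    · rintro x y ⟨M, hM⟩ ⟨N, hN⟩
      exact ⟨M + N, fun p hp => (map_add_le_add p x y).trans (add_le_add (hM p hp) (hN p hp))⟩
  choose M hM using key
  refine ⟨M, ?_⟩
  rintro _ ⟨p, hp, rfl⟩ x
  exact hM x p hp

/-- The seminorm on `L_α` defining the semicrossed product: the supremum of `x ↦ ‖(π × σ)(x)‖` over
all covariant pairs `(π, σ)`. -/
noncomputable def universalSeminorm : AlgebraSeminorm α.FormalSums where
  toSeminorm := sSup α.covSeminorms
  mul_le' := mul_le_sSup α.bddAbove_covSeminorms (by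
    rintro p ⟨H, _, _, _, π, σ, hπσ, hp⟩ x y
    rw [hp, hp, hp, hπσ.integrated_mul]
    exact norm_mul_le _ _)

/-- The semicrossed product algebra `A ⋊_α S`. -/
abbrev SemicrossedProduct : Type (max u v) := α.universalSeminorm.HausdorffCompletion

end CStarEtaleAction

/-- For `U ⊆ X` open, the ideal `C₀(U)` of `C₀(X)`: the functions which vanish outside `U`. -/
def C0On {X : Type v} [TopologicalSpace X] (U : Set X) : Set C₀(X, ℂ) :=
  {f | ∀ x, x ∉ U → f x = 0}

theorem isClosedIdeal_C0On {X : Type v} [TopologicalSpace X] (U : Set X) :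
    IsClosedIdeal (C0On U) where
  zero_mem _ _ := rfl
  add_mem f hf g hg x hx := by
    rw [ZeroAtInftyContinuousMap.add_apply, hf x hx, hg x hx, add_zero]
  smul_mem c f hf x hx := by
    rw [ZeroAtInftyContinuousMap.smul_apply, hf x hx, smul_zero]
  mul_mem_left g f hf x hx := by
    rw [ZeroAtInftyContinuousMap.mul_apply, hf x hx, mul_zero]
  mul_mem_right f hf g x hx := by
    rw [ZeroAtInftyContinuousMap.mul_apply, hf x hx, zero_mul]
  star_mem f hf x hx := by
    rw [ZeroAtInftyContinuousMap.star_apply, hf x hx, star_zero]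
  isClosed := by
    have h : C0On U = ⋂ x ∈ Uᶜ, {f : C₀(X, ℂ) | f x = 0} := by
      ext f
      simp only [Set.mem_iInter]
      rfl
    rw [h]
    refine isClosed_biInter fun x _ => isClosed_eq ?_ continuous_const
    have h1 : Continuous fun f : C₀(X, ℂ) => f.toBCF x :=
      (BoundedContinuousFunction.lipschitz_eval_const x).continuous.comp
        ZeroAtInftyContinuousMap.isometry_toBCF.continuous
    exact h1

theorem isCompact_norm_ge {X : Type v} [TopologicalSpace X] (f : C₀(X, ℂ)) {ε : ℝ} (hε : 0 < ε) :
    IsCompact {x | ε ≤ ‖f x‖} := by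
  obtain ⟨K, hK, hKf⟩ := Filter.mem_cocompact.1 (f.zero_at_infty' (Metric.ball_mem_nhds 0 hε))
  refine hK.of_isClosed_subset
    (isClosed_le continuous_const (continuous_norm.comp (map_continuous f))) fun x hx => ?_
  by_contra hxK
  have h1 : f x ∈ Metric.ball (0 : ℂ) ε := hKf hxK
  rw [mem_ball_zero_iff] at h1
  exact absurd h1 (not_lt.2 hx)

open Classical in
/-- For a homeomorphism `e` between open subsets `U` and `V` of `X` and `f ∈ C₀(U)`, the function
`f ∘ e⁻¹ ∈ C₀(V)`, extended by zero outside `V`. (The value for `f ∉ C₀(U)` is irrelevant.) -/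
noncomputable def pushC0 {X : Type v} [TopologicalSpace X] [T2Space X]
    (e : OpenPartialHomeomorph X X) (f : C₀(X, ℂ)) : C₀(X, ℂ) :=
  if h : f ∈ C0On e.source then
    { toFun := fun y => if y ∈ e.target then f (e.symm y) else 0
      continuous_toFun := by
        rw [continuous_iff_continuousAt]
        intro y
        by_cases hy : y ∈ e.target
        · refine ((map_continuous f).continuousAt.comp (e.continuousAt_symm hy)).congr ?_
          filter_upwards [e.open_target.mem_nhds hy] with z hz
          exact (if_pos hz).symm
        · rw [ContinuousAt, if_neg hy, Metric.tendsto_nhds]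
          intro ε hε
          have hK : IsCompact (e '' {x | ε ≤ ‖f x‖}) :=
            (isCompact_norm_ge f hε).image_of_continuousOn (e.continuousOn.mono fun x hx => by
              by_contra hxs
              have hx' : ε ≤ ‖f x‖ := hx
              rw [h x hxs, norm_zero] at hx'
              exact absurd hε (not_lt.2 hx'))
          have hyK : y ∉ e '' {x | ε ≤ ‖f x‖} := by
            rintro ⟨x, hx, rfl⟩
            refine hy (e.map_source ?_)
            by_contra hxs
            have hx' : ε ≤ ‖f x‖ := hx
            rw [h x hxs, norm_zero] at hx'
            exact absurd hε (not_lt.2 hx')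
          filter_upwards [hK.isClosed.isOpen_compl.mem_nhds hyK] with z hz
          by_cases hzt : z ∈ e.target
          · rw [if_pos hzt, dist_zero_right]
            by_contra hlt
            exact hz ⟨e.symm z, not_lt.1 hlt, e.right_inv hzt⟩
          · rwa [if_neg hzt, dist_self]
      zero_at_infty' := by
        rw [Metric.tendsto_nhds]
        intro ε hε
        have hK : IsCompact (e '' {x | ε ≤ ‖f x‖}) :=
          (isCompact_norm_ge f hε).image_of_continuousOn (e.continuousOn.mono fun x hx => by
            by_contra hxs
            have hx' : ε ≤ ‖f x‖ := hx
            rw [h x hxs, norm_zero] at hx'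
            exact absurd hε (not_lt.2 hx'))
        filter_upwards [hK.compl_mem_cocompact] with z hz
        by_cases hzt : z ∈ e.target
        · rw [if_pos hzt, dist_zero_right]
          by_contra hlt
          exact hz ⟨e.symm z, not_lt.1 hlt, e.right_inv hzt⟩
        · rwa [if_neg hzt, dist_self] }
  else 0

section

variable {X : Type v} [TopologicalSpace X] [T2Space X] (e : OpenPartialHomeomorph X X)

theorem pushC0_apply {f : C₀(X, ℂ)} (hf : f ∈ C0On e.source) {x : X} (hx : x ∈ e.source) :
    pushC0 e f (e x) = f x := by
  rw [pushC0, dif_pos hf]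
  exact (if_pos (e.map_source hx)).trans (congrArg f (e.left_inv hx))

theorem pushC0_mem (f : C₀(X, ℂ)) : pushC0 e f ∈ C0On e.target := by
  intro y hy
  by_cases hf : f ∈ C0On e.source
  · rw [pushC0, dif_pos hf]
    exact if_neg hy
  · rw [pushC0, dif_neg hf]
    rfl

/-- An element of `C₀(X)` equals `f ∘ e⁻¹` as soon as it does so on the image of `e` and vanishes
elsewhere. -/
theorem pushC0_eq {f g : C₀(X, ℂ)} (hf : f ∈ C0On e.source) (hg : g ∈ C0On e.target)
    (h : ∀ x ∈ e.source, g (e x) = f x) : pushC0 e f = g := by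
  ext y
  by_cases hy : y ∈ e.target
  · obtain ⟨x, hx, rfl⟩ : ∃ x ∈ e.source, e x = y := ⟨e.symm y, e.map_target hy, e.right_inv hy⟩
    rw [pushC0_apply e hf hx, h x hx]
  · rw [pushC0_mem e f y hy, hg y hy]

/-- The bijection `f ↦ f ∘ e⁻¹` from `C₀(U)` onto `C₀(V)`. -/
noncomputable def pushEquiv : PartialEquiv C₀(X, ℂ) C₀(X, ℂ) where
  toFun := pushC0 e
  invFun := pushC0 e.symm
  source := C0On e.source
  target := C0On e.target
  map_source' f _ := pushC0_mem e f
  map_target' f _ := pushC0_mem e.symm f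
  left_inv' f hf := pushC0_eq e.symm (pushC0_mem e f) hf fun x hx => by
    have h := pushC0_apply e hf (e.map_target hx)
    rw [e.right_inv hx] at h
    exact h.symm
  right_inv' f hf := pushC0_eq e (pushC0_mem e.symm f) hf fun x hx => by
    have h := pushC0_apply e.symm hf (e.map_source hx)
    rw [e.left_inv hx] at h
    exact h.symm

end

/-- If open sets cover `X` then the ideals `C₀(U)`, for `U` in the cover, span a dense subspace. -/
theorem dense_span_C0On {X : Type v} [TopologicalSpace X] [T2Space X] [LocallyCompactSpace X]
    {ι : Type w} {U : ι → Set X} (hU : ∀ i, IsOpen (U i)) (hc : ∀ x, ∃ i, x ∈ U i) :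
    (Submodule.span ℂ (⋃ i, C0On (U i))).topologicalClosure = ⊤ := by
  rw [eq_top_iff]
  intro f _
  rw [← SetLike.mem_coe, Submodule.topologicalClosure_coe, Metric.mem_closure_iff]
  intro ε hε
  obtain ⟨η, -, hη1, hη2, hη3⟩ := exists_continuous_sum_one_of_isOpen_isCompact (n := 1)
    (s := fun _ => (Set.univ : Set X)) (fun _ => isOpen_univ) (isCompact_norm_ge f (half_pos hε))
    (fun x _ => Set.mem_iUnion.2 ⟨0, trivial⟩)
  have hK : IsCompact (tsupport (η 0)) := hη3 0
  obtain ⟨t, ht⟩ := hK.elim_finite_subcover U hU fun x _ => Set.mem_iUnion.2 (hc x)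
  obtain ⟨ξ, hξ0, hξ1, -, -⟩ := exists_continuous_sum_one_of_isOpen_isCompact (n := t.card)
    (s := fun i => U (t.equivFin.symm i)) (fun i => hU _) hK (by
      intro z hz
      obtain ⟨i, hi, hzi⟩ := Set.mem_iUnion₂.1 (ht hz)
      exact Set.mem_iUnion.2 ⟨t.equivFin ⟨i, hi⟩, by simpa using hzi⟩)
  let g : Fin t.card → C₀(X, ℂ) := fun i =>
    { toFun := fun x => (η 0 x : ℂ) * ((ξ i x : ℂ) * f x)
      continuous_toFun := by
        have := map_continuous f
        fun_prop
      zero_at_infty' := by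
        have h : HasCompactSupport fun x => (η 0 x : ℂ) * ((ξ i x : ℂ) * f x) :=
          HasCompactSupport.mul_right ((hη3 0).comp_left Complex.ofReal_zero)
        exact h.is_zero_at_infty }
  have hg : ∀ i x, g i x = (η 0 x : ℂ) * ((ξ i x : ℂ) * f x) := fun _ _ => rfl
  refine ⟨∑ i, g i, ?_, ?_⟩
  · refine Submodule.sum_mem _ fun i _ => Submodule.subset_span
      (Set.mem_iUnion.2 ⟨t.equivFin.symm i, fun x hx => ?_⟩)
    have h0 : ξ i x = 0 := image_eq_zero_of_notMem_tsupport fun h => hx (hξ0 i h)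
    rw [hg, h0, Complex.ofReal_zero, zero_mul, mul_zero]
  · refine lt_of_le_of_lt ?_ (half_lt_self hε)
    rw [← ZeroAtInftyContinuousMap.dist_toBCF_eq_dist,
      BoundedContinuousFunction.dist_le (half_pos hε).le]
    intro x
    have hsum : (∑ i, g i) x = (η 0 x : ℂ) * f x := by
      have h1 : (∑ i, g i) x = ∑ i, g i x := by
        have : ∀ s : Finset (Fin t.card), (∑ i ∈ s, g i) x = ∑ i ∈ s, g i x := fun s => by
          classical
          induction s using Finset.induction_on with
          | empty => rfl
          | insert a s ha ih =>
            rw [Finset.sum_insert ha, Finset.sum_insert ha, ZeroAtInftyContinuousMap.add_apply, ih]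
        exact this _
      rw [h1]
      simp only [hg]
      rw [← Finset.mul_sum, ← Finset.sum_mul]
      by_cases hx : x ∈ tsupport (η 0)
      · have h2 := hξ1 hx
        simp only [Finset.sum_apply, Pi.one_apply] at h2
        rw [← Complex.ofReal_sum, h2, Complex.ofReal_one, one_mul]
      · rw [image_eq_zero_of_notMem_tsupport hx, Complex.ofReal_zero, zero_mul, zero_mul]
    change dist (f x) ((∑ i, g i) x) ≤ ε / 2
    rw [hsum, dist_eq_norm]
    by_cases hx : ε / 2 ≤ ‖f x‖
    · have h3 := hη1 hx
      simp only [Finset.univ_unique, Finset.sum_singleton, Pi.one_apply] at h3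
      have h4 : η 0 x = 1 := h3
      rw [h4, Complex.ofReal_one, one_mul, sub_self, norm_zero]
      exact (half_pos hε).le
    · have h5 : f x - (η 0 x : ℂ) * f x = ((1 - η 0 x : ℝ) : ℂ) * f x := by
        push_cast
        ring
      obtain ⟨h6, h7⟩ := hη2 0 x
      rw [h5, norm_mul, Complex.norm_real, Real.norm_of_nonneg (sub_nonneg.2 h7)]
      have h8 : (1 - η 0 x) * ‖f x‖ ≤ 1 * ‖f x‖ :=
        mul_le_mul_of_nonneg_right (by linarith) (norm_nonneg _)
      linarith [not_le.1 hx]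

namespace EtaleAction

variable {S : Type u} [RestrictionSemigroup S] {X : Type v} [TopologicalSpace X]
variable (θ : EtaleAction S X)

theorem mem_C0On_lam [T2Space X] (s : S) :
    (pushEquiv (θ.homeo (lam s))).source = (pushEquiv (θ.homeo s)).source :=
  congrArg C0On (θ.isHom.source_lam s)

theorem isHom_pushEquiv [T2Space X] : IsRestrictionHom fun s => pushEquiv (θ.homeo s) where
  map_mul s t := by
    have hsrc : ∀ f : C₀(X, ℂ), f ∈ C0On (θ (s * t)).source ↔
        f ∈ C0On (θ t).source ∧ pushC0 (θ.homeo t) f ∈ C0On (θ s).source := by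
      intro f
      constructor
      · intro hf
        have hft : f ∈ C0On (θ t).source := fun x hx => hf x fun h =>
          hx (θ.isHom.mem_source_mul.1 h).1
        refine ⟨hft, fun y hy => ?_⟩
        by_cases hyt : y ∈ (θ t).target
        · have hxs := (θ t).map_target hyt
          have h1 := pushC0_apply (θ.homeo t) hft hxs
          have h2 : (θ.homeo t) ((θ t).symm y) = y := (θ t).right_inv hyt
          rw [h2] at h1
          rw [h1]
          refine hf _ fun h => hy ?_
          have h3 := (θ.isHom.mem_source_mul.1 h).2
          rwa [(θ t).right_inv hyt] at h3
        · exact pushC0_mem (θ.homeo t) f y hyt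
      · rintro ⟨hft, hfs⟩ x hx
        by_cases hxt : x ∈ (θ t).source
        · rw [← pushC0_apply (θ.homeo t) hft hxt]
          exact hfs _ fun h => hx (θ.isHom.mem_source_mul.2 ⟨hxt, h⟩)
        · exact hft x hxt
    refine ⟨?_, ?_⟩
    · rw [PartialEquiv.trans_source]
      ext f
      exact hsrc f
    · intro f hf
      obtain ⟨hft, hfs⟩ := (hsrc f).1 hf
      refine pushC0_eq (θ.homeo (s * t)) hf ?_ ?_
      · intro y hy
        change pushC0 (θ.homeo s) (pushC0 (θ.homeo t) f) y = 0
        by_cases hys : y ∈ (θ s).target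
        · have hzs := (θ s).map_target hys
          have h1 := pushC0_apply (θ.homeo s) hfs hzs
          have h2 : (θ.homeo s) ((θ s).symm y) = y := (θ s).right_inv hys
          rw [h2] at h1
          rw [h1]
          refine pushC0_mem (θ.homeo t) f _ fun hzt => hy ?_
          have hx := (θ t).map_target hzt
          have hmem : (θ t).symm ((θ s).symm y) ∈ (θ (s * t)).source :=
            θ.isHom.mem_source_mul.2 ⟨hx, by rwa [(θ t).right_inv hzt]⟩
          have h3 := (θ (s * t)).map_source hmem
          rwa [θ.isHom.apply_mul hmem, (θ t).right_inv hzt, (θ s).right_inv hys] at h3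
        · exact pushC0_mem (θ.homeo s) _ y hys
      · intro x hx
        obtain ⟨hxt, hxs⟩ := θ.isHom.mem_source_mul.1 hx
        have h1 : θ.homeo (s * t) x = θ.homeo s (θ.homeo t x) := θ.isHom.apply_mul hx
        rw [h1]
        exact (pushC0_apply (θ.homeo s) hfs hxs).trans (pushC0_apply (θ.homeo t) hft hxt)
  map_lam s := by
    refine ⟨?_, ?_⟩
    · rw [PartialEquiv.trans_source]
      ext f
      constructor
      · intro hf
        rw [θ.mem_C0On_lam] at hf
        exact ⟨hf, (pushEquiv (θ.homeo s)).map_source hf⟩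
      · intro hf
        rw [θ.mem_C0On_lam]
        exact hf.1
    · intro f hf
      have hf' := hf
      rw [θ.mem_C0On_lam] at hf'
      refine Eq.trans ?_ ((pushEquiv (θ.homeo s)).left_inv hf').symm
      refine pushC0_eq (θ.homeo (lam s)) hf ?_ fun x hx =>
        congrArg f (θ.isHom.apply_proj (lam_mem s) hx)
      have h := θ.isHom.source_rho (lam s)
      rw [rho_proj _ (lam_mem s)] at h
      change f ∈ C0On (θ (lam s)).target
      rw [← h]
      exact hf
  map_rho s := by
    have hsrc : (pushEquiv (θ.homeo (rho s))).source = (pushEquiv (θ.homeo s)).target :=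
      congrArg C0On (θ.isHom.source_rho s)
    refine ⟨?_, ?_⟩
    · rw [PartialEquiv.trans_source]
      ext f
      constructor
      · intro hf
        rw [hsrc] at hf
        exact ⟨hf, (pushEquiv (θ.homeo s)).map_target hf⟩
      · intro hf
        rw [hsrc]
        exact hf.1
    · intro f hf
      have hf' := hf
      rw [hsrc] at hf'
      refine Eq.trans ?_ ((pushEquiv (θ.homeo s)).right_inv hf').symm
      refine pushC0_eq (θ.homeo (rho s)) hf ?_ fun x hx =>
        congrArg f (θ.isHom.apply_proj (rho_mem s) hx)
      have h := θ.isHom.source_rho (rho s)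
      rw [rho_proj _ (rho_mem s)] at h
      change f ∈ C0On (θ (rho s)).target
      rw [← h]
      exact hf

/-- The étale action `α` of `S` on `C₀(X)` induced by an étale action `θ` of `S` on `X`: `α_s` maps
`C₀(D_{λ(s)})` onto `C₀(D_{ρ(s)})` by `α_s(f) = f ∘ θ_s⁻¹`. -/
noncomputable def inducedAction [LocallyCompactSpace X] [T2Space X] :
    CStarEtaleAction S C₀(X, ℂ) where
  toFun s := pushEquiv (θ.homeo s)
  isHom := θ.isHom_pushEquiv
  isClosedIdeal e _ := isClosedIdeal_C0On (θ e).source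
  dense_span := by
    have h := dense_span_C0On (U := fun e : (proj : Set S) => (θ e).source)
      (fun e => θ.isOpen_source e) fun x => by
        obtain ⟨e, he, hx⟩ := θ.cover x
        exact ⟨⟨e, he⟩, hx⟩
    rw [Set.iUnion_subtype] at h
    exact h
  apply_add s f hf g hg := by
    refine pushC0_eq _ ((isClosedIdeal_C0On _).add_mem _ hf _ hg)
      ((isClosedIdeal_C0On _).add_mem _ (pushC0_mem _ f) _ (pushC0_mem _ g)) fun x hx => ?_
    change pushC0 _ f _ + pushC0 _ g _ = f x + g x
    rw [pushC0_apply _ hf hx, pushC0_apply _ hg hx]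
  apply_smul s c f hf := by
    refine pushC0_eq _ ((isClosedIdeal_C0On _).smul_mem c _ hf)
      ((isClosedIdeal_C0On _).smul_mem c _ (pushC0_mem _ f)) fun x hx => ?_
    change c • pushC0 _ f _ = c • f x
    rw [pushC0_apply _ hf hx]
  apply_mul s f hf g hg := by
    refine pushC0_eq _ ((isClosedIdeal_C0On _).mul_mem_left f _ hg)
      ((isClosedIdeal_C0On _).mul_mem_left _ _ (pushC0_mem _ g)) fun x hx => ?_
    change pushC0 _ f _ * pushC0 _ g _ = f x * g x
    rw [pushC0_apply _ hf hx, pushC0_apply _ hg hx]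
  apply_star s f hf := by
    refine pushC0_eq _ ((isClosedIdeal_C0On _).star_mem _ hf)
      ((isClosedIdeal_C0On _).star_mem _ (pushC0_mem _ f)) fun x hx => ?_
    change star (pushC0 _ f _) = star (f x)
    rw [pushC0_apply _ hf hx]

end EtaleAction

/-! ### Isometric isomorphisms between Hausdorff completions. -/

namespace AlgebraSeminorm

/-! Let M be the subspace of L_α spanned by the elements α_s(b)δ_s with b compactly supported in
D_{λ(s)} (`compactFormalSums`), and let Ψ (`toA0`) send α_s(b)δ_s to the function b ∘ 𝐝 on the germs
of s. M is a subalgebra, dense in the semicrossed product because ‖aδ_s‖₀ ≤ ‖a‖. Ψ is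
multiplicative, and it is onto A₀(𝒞) because a partition of unity cuts a function on a bisection
into pieces living on the germs of single elements of S (`exists_sum_germFun`). In general Ψ is not
injective. The content of the theorem is that nevertheless ‖x‖₀ = ‖Ψ(x)‖₀ on M; the completions are
then identified by `exists_completion_isometryEquiv`. Both suprema run over Hilbert spaces in the
same universe, and each inequality comes from converting a representation of one kind into one of
the other kind on the same space, with π × σ = ω ∘ Ψ on M.

From a covariant pair (π, σ) to ω. By covariance (π × σ)(α_s(b)δ_s) = σ_s π(b), and σ_f π(a) = π(a)
for a ∈ C₀(D_f), so σ_s π(a) = σ_t π(a) whenever sf = tf. If Ψ(∑ α_{s_i}(b_i)δ_{s_i}) = 0, group the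
s_i by their germs at a point x: in each group the coefficients add up to 0 at x, hence to at most ε
near x, and near x each s_i may be replaced by a representative of its group. A partition of unity
glues this into a sum of n terms of norm at most ε, with n independent of ε, so π × σ vanishes on
ker Ψ (`integrated_eq_zero`) and descends to A₀(𝒞). It is contractive on a bisection
(`norm_sum_le_of_isBisection`) since σ_s π(ξ²g) = π(α_s(ξ)) σ_s π(ξg) exhibits the operator as a row
of norm at most 1, times a diagonal contraction, times a column of norm at most ‖g‖. The row is
bounded because 𝐫 is injective on the bisection.

From ω to a covariant pair. The restriction of ω to C_c(X) extends to π on C₀(X). The operator σ_s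
is the pointwise limit of ω(u ∘ 𝐝 on the germs of s), as u runs through Urysohn functions for larger
and larger compact subsets of D_{λ(s)} (`exists_operator`). The net is eventually constant on
vectors π(b)k with b compactly supported in D_{λ(s)}, and it is 0 on their orthogonal complement.
Most of the operator identities needed are checked on these two pieces (`operator_ext`). -/

/-- The canonical map into the Hausdorff completion, as a linear map. -/
noncomputable def HausdorffCompletion.coeₗ {A : Type u} [NonUnitalRing A] [Module ℂ A]
    [IsScalarTower ℂ A A] [SMulCommClass ℂ A A] (p : AlgebraSeminorm A) :
    A →ₗ[ℂ] p.HausdorffCompletion where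
  toFun := HausdorffCompletion.coe p
  map_add' := HausdorffCompletion.coe_add p
  map_smul' := HausdorffCompletion.coe_smul p

/-- If two algebras contain images of a common vector space which are dense, on which the seminorms
agree, and on which the products correspond, then their Hausdorff completions are isometrically
isomorphic. -/
theorem exists_completion_isometryEquiv {A : Type u} [NonUnitalRing A] [Module ℂ A]
    [IsScalarTower ℂ A A] [SMulCommClass ℂ A A] {B : Type v} [NonUnitalRing B] [Module ℂ B]
    [IsScalarTower ℂ B B] [SMulCommClass ℂ B B] (p : AlgebraSeminorm A) (q : AlgebraSeminorm B)
    {M : Type w} [AddCommGroup M] [Module ℂ M] (i : M →ₗ[ℂ] A) (k : M →ₗ[ℂ] B)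
    (hi : Function.Surjective i)
    (hk : DenseRange fun m => HausdorffCompletion.coe q (k m))
    (hn : ∀ m, q.toSeminorm (k m) = p.toSeminorm (i m))
    (hm : ∀ m m', ∃ m'', i m'' = i m * i m' ∧ k m'' = k m * k m') :
    ∃ Φ : p.HausdorffCompletion ≃ₗᵢ[ℂ] q.HausdorffCompletion, ∀ a b, Φ (a * b) = Φ a * Φ b := by
  have h1 : DenseRange (HausdorffCompletion.coeₗ p ∘ₗ i) := by
    have h := HausdorffCompletion.denseRange_coe p
    rwa [DenseRange, ← hi.range_comp] at h
  have h2 : ∀ m, ‖(HausdorffCompletion.coeₗ q ∘ₗ k) (LinearEquiv.refl ℂ M m)‖ =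
      ‖(HausdorffCompletion.coeₗ p ∘ₗ i) m‖ := fun m =>
    (HausdorffCompletion.norm_coe q _).trans ((hn m).trans (HausdorffCompletion.norm_coe p _).symm)
  obtain ⟨Φ, key⟩ : ∃ Φ : p.HausdorffCompletion ≃ₗᵢ[ℂ] q.HausdorffCompletion,
      ∀ m, Φ (HausdorffCompletion.coe p (i m)) = HausdorffCompletion.coe q (k m) :=
    ⟨_, LinearEquiv.extendOfIsometry_eq (LinearEquiv.refl ℂ M) _ _ h1 hk h2⟩
  refine ⟨Φ, fun a b => ?_⟩
  induction a, b using HausdorffCompletion.induction₂ with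
  | hP => exact isClosed_eq (by fun_prop) (by fun_prop)
  | h a b =>
    obtain ⟨m, rfl⟩ := hi a
    obtain ⟨m', rfl⟩ := hi b
    obtain ⟨m'', e1, e2⟩ := hm m m'
    rw [← HausdorffCompletion.coe_mul, ← e1, key, key, key, e2, HausdorffCompletion.coe_mul]

end AlgebraSeminorm

/-! ### Compactly supported functions, cut-offs and partitions of unity. -/

section CompactlySupported

variable {X : Type v} [TopologicalSpace X]

/-- The functions in `C₀(X)` which vanish outside some compact subset of `U`. -/
def ccSubmodule (U : Set X) : Submodule ℂ C₀(X, ℂ) where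
  carrier := {f | ∃ K ⊆ U, IsCompact K ∧ ∀ x, x ∉ K → f x = 0}
  zero_mem' := ⟨∅, Set.empty_subset U, isCompact_empty, fun _ _ => rfl⟩
  add_mem' := by
    rintro f g ⟨K, hKU, hK, hf⟩ ⟨L, hLU, hL, hg⟩
    refine ⟨K ∪ L, Set.union_subset hKU hLU, hK.union hL, fun x hx => ?_⟩
    rw [ZeroAtInftyContinuousMap.add_apply, hf x fun h => hx (Or.inl h),
      hg x fun h => hx (Or.inr h), add_zero]
  smul_mem' := by
    rintro c f ⟨K, hKU, hK, hf⟩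
    refine ⟨K, hKU, hK, fun x hx => ?_⟩
    rw [ZeroAtInftyContinuousMap.smul_apply, hf x hx, smul_zero]

variable {U V : Set X} {f g : C₀(X, ℂ)}

theorem ccSubmodule_mono (h : U ⊆ V) : ccSubmodule U ≤ ccSubmodule V :=
  fun _ ⟨K, hKU, hK⟩ => ⟨K, hKU.trans h, hK⟩

theorem mem_C0On_of_mem_ccSubmodule (hf : f ∈ ccSubmodule U) : f ∈ C0On U := by
  obtain ⟨K, hKU, -, hK⟩ := hf
  exact fun x hx => hK x fun h => hx (hKU h)

theorem mul_mem_ccSubmodule_left (g : C₀(X, ℂ)) (hf : f ∈ ccSubmodule U) :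
    g * f ∈ ccSubmodule U := by
  obtain ⟨K, hKU, hK, hf⟩ := hf
  exact ⟨K, hKU, hK, fun x hx => by rw [ZeroAtInftyContinuousMap.mul_apply, hf x hx, mul_zero]⟩

theorem mul_mem_ccSubmodule_right (hf : f ∈ ccSubmodule U) (g : C₀(X, ℂ)) :
    f * g ∈ ccSubmodule U := by
  rw [mul_comm]
  exact mul_mem_ccSubmodule_left g hf

theorem star_mem_ccSubmodule (hf : f ∈ ccSubmodule U) : star f ∈ ccSubmodule U := by
  obtain ⟨K, hKU, hK, hf⟩ := hf
  exact ⟨K, hKU, hK, fun x hx => by rw [ZeroAtInftyContinuousMap.star_apply, hf x hx, star_zero]⟩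

theorem ZeroAtInftyContinuousMap.norm_apply_le (f : C₀(X, ℂ)) (x : X) : ‖f x‖ ≤ ‖f‖ := by
  rw [← ZeroAtInftyContinuousMap.norm_toBCF_eq_norm]
  exact f.toBCF.norm_coe_le_norm x

theorem ZeroAtInftyContinuousMap.norm_le_of_forall {M : ℝ} (hM : 0 ≤ M)
    (h : ∀ x, ‖f x‖ ≤ M) : ‖f‖ ≤ M := by
  rw [← ZeroAtInftyContinuousMap.norm_toBCF_eq_norm]
  exact (BoundedContinuousFunction.norm_le hM).2 h

theorem ZeroAtInftyContinuousMap.sum_apply {ι : Type*} (s : Finset ι) (f : ι → C₀(X, ℂ)) (x : X) :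
    (∑ i ∈ s, f i) x = ∑ i ∈ s, f i x := by
  classical
  induction s using Finset.induction_on with
  | empty => rfl
  | insert a s ha ih =>
    rw [Finset.sum_insert ha, Finset.sum_insert ha, ZeroAtInftyContinuousMap.add_apply, ih]

variable [T2Space X] [LocallyCompactSpace X]

/-- Partitions of unity by squares, over a compact set covered by open sets. -/
theorem exists_sq_partition {ι : Type*} {U : ι → Set X} (hU : ∀ i, IsOpen (U i)) {K : Set X}
    (hK : IsCompact K) (hKU : K ⊆ ⋃ i, U i) :
    ∃ (n : ℕ) (j : Fin n → ι) (ξ : Fin n → C₀(X, ℂ)), (∀ k, ξ k ∈ ccSubmodule (U (j k))) ∧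
      (∀ x, ∑ k, ‖ξ k x‖ ^ 2 ≤ 1) ∧ ∀ x ∈ K, ∑ k, ξ k x * ξ k x = 1 := by
  obtain ⟨t, ht⟩ := hK.elim_finite_subcover U hU hKU
  obtain ⟨η, hηU, hηc⟩ := PartitionOfUnity.exists_isSubordinate_of_locallyFinite_t2space hK
    (fun k : Fin t.card => U (t.equivFin.symm k)) (fun k => hU _) (locallyFinite_of_finite _) (by
      intro z hz
      obtain ⟨i, hi, hzi⟩ := Set.mem_iUnion₂.1 (ht hz)
      exact Set.mem_iUnion.2 ⟨t.equivFin ⟨i, hi⟩, by simpa using hzi⟩)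
  have hsum : ∀ x, ∑ᶠ k, η k x = ∑ k, η k x := fun x => finsum_eq_sum_of_fintype _
  have h0 : ∀ k x, x ∉ tsupport (η k) → ((√(η k x) : ℝ) : ℂ) = 0 := fun k x hx => by
    rw [image_eq_zero_of_notMem_tsupport hx, Real.sqrt_zero, Complex.ofReal_zero]
  refine ⟨t.card, fun k => t.equivFin.symm k, fun k =>
    { toFun := fun x => ((√(η k x) : ℝ) : ℂ)
      continuous_toFun := by
        have := (η k).continuous
        fun_prop
      zero_at_infty' := (HasCompactSupport.intro (hηc k) (h0 k)).is_zero_at_infty }, ?_, ?_, ?_⟩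
  · exact fun k => ⟨tsupport (η k), hηU k, hηc k, h0 k⟩
  · intro x
    calc ∑ k, ‖((√(η k x) : ℝ) : ℂ)‖ ^ 2 = ∑ k, η k x := by
          refine Finset.sum_congr rfl fun k _ => ?_
          rw [Complex.norm_real, Real.norm_eq_abs, sq_abs, Real.sq_sqrt (η.nonneg k x)]
      _ ≤ 1 := by
          rw [← hsum]
          exact η.sum_le_one x
  · intro x hx
    calc ∑ k, ((√(η k x) : ℝ) : ℂ) * ((√(η k x) : ℝ) : ℂ) = ((∑ k, η k x : ℝ) : ℂ) := by
          rw [Complex.ofReal_sum]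
          refine Finset.sum_congr rfl fun k _ => ?_
          rw [← Complex.ofReal_mul, Real.mul_self_sqrt (η.nonneg k x)]
      _ = 1 := by rw [← hsum, η.sum_eq_one hx, Complex.ofReal_one]

/-- Urysohn's lemma. -/
theorem exists_mem_ccSubmodule_eq_one (hU : IsOpen U) {K : Set X} (hK : IsCompact K)
    (hKU : K ⊆ U) : ∃ u ∈ ccSubmodule U, (∀ x ∈ K, u x = 1) ∧ (∀ x, ‖u x‖ ≤ 1) ∧
      ∀ x, ‖1 - u x‖ ≤ 1 := by
  -- Vanishing outside U would not give a compact support inside U; the function is made to vanish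
  -- outside the interior of an intermediate compact set K'.
  obtain ⟨K', hK'1, hK'2, hK'3⟩ := exists_compact_between hK hU hKU
  obtain ⟨v, hv1, hv0, hvc, hv⟩ := exists_continuous_one_zero_of_isCompact hK
    isOpen_interior.isClosed_compl (Set.disjoint_compl_right_iff_subset.2 hK'2)
  refine ⟨{ toFun := fun x => (v x : ℂ)
            continuous_toFun := by fun_prop
            zero_at_infty' := (hvc.comp_left Complex.ofReal_zero).is_zero_at_infty },
    ⟨K', hK'3, hK'1, fun x hx => ?_⟩, fun x hx => ?_, fun x => ?_, fun x => ?_⟩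
  · change ((v x : ℝ) : ℂ) = 0
    rw [hv0 fun h => hx (interior_subset h), Pi.zero_apply, Complex.ofReal_zero]
  · change ((v x : ℝ) : ℂ) = 1
    rw [hv1 hx, Pi.one_apply, Complex.ofReal_one]
  · change ‖((v x : ℝ) : ℂ)‖ ≤ 1
    rw [Complex.norm_real, Real.norm_of_nonneg (hv x).1]
    exact (hv x).2
  · change ‖1 - ((v x : ℝ) : ℂ)‖ ≤ 1
    rw [← Complex.ofReal_one, ← Complex.ofReal_sub, Complex.norm_real,
      Real.norm_of_nonneg (sub_nonneg.2 (hv x).2)]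
    linarith [(hv x).1]

/-- A compactly supported function has a compactly supported local unit. -/
theorem exists_mul_eq_self (hU : IsOpen U) (hf : f ∈ ccSubmodule U) :
    ∃ u ∈ ccSubmodule U, u * f = f := by
  obtain ⟨K, hKU, hK, hfK⟩ := hf
  obtain ⟨u, hu, hu1, -⟩ := exists_mem_ccSubmodule_eq_one hU hK hKU
  refine ⟨u, hu, ?_⟩
  ext x
  rw [ZeroAtInftyContinuousMap.mul_apply]
  by_cases hx : x ∈ K
  · rw [hu1 x hx, one_mul]
  · rw [hfK x hx, mul_zero]

/-- The set where |f| ≥ ε/2 is compact and contained in U; multiplying f by a cut-off equal to 1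
there changes f by at most ε/2. -/
theorem C0On_subset_closure (hU : IsOpen U) : C0On U ⊆ closure (ccSubmodule U : Set C₀(X, ℂ)) := by
  intro f hf
  rw [Metric.mem_closure_iff]
  intro ε hε
  have hKU : {x | ε / 2 ≤ ‖f x‖} ⊆ U := fun x hx => by
    by_contra hxU
    have hx' : ε / 2 ≤ ‖f x‖ := hx
    rw [hf x hxU, norm_zero] at hx'
    linarith
  obtain ⟨u, hu, hu1, -, hu2⟩ :=
    exists_mem_ccSubmodule_eq_one hU (isCompact_norm_ge f (half_pos hε)) hKU
  refine ⟨u * f, mul_mem_ccSubmodule_right hu f, ?_⟩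
  rw [dist_eq_norm]
  refine lt_of_le_of_lt (ZeroAtInftyContinuousMap.norm_le_of_forall (half_pos hε).le fun x => ?_)
    (half_lt_self hε)
  have h1 : (f - u * f) x = (1 - u x) * f x := by
    rw [ZeroAtInftyContinuousMap.sub_apply, ZeroAtInftyContinuousMap.mul_apply]
    ring
  rw [h1]
  by_cases hx : ε / 2 ≤ ‖f x‖
  · rw [hu1 x hx, sub_self, zero_mul, norm_zero]
    exact (half_pos hε).le
  · rw [norm_mul]
    calc ‖1 - u x‖ * ‖f x‖ ≤ 1 * ‖f x‖ := mul_le_mul_of_nonneg_right (hu2 x) (norm_nonneg _)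
      _ ≤ ε / 2 := by linarith

theorem denseRange_ccSubmodule_univ :
    DenseRange (ccSubmodule (Set.univ : Set X)).subtype := by
  intro f
  have h := C0On_subset_closure (X := X) isOpen_univ (show f ∈ C0On Set.univ from
    fun x hx => absurd trivial hx)
  rwa [Submodule.coe_subtype, Subtype.range_coe]

end CompactlySupported

/-! ### Rows and columns of operators in a representation of C₀(X). -/

section RowColumn

variable {X : Type v} [TopologicalSpace X]
variable {H : Type w} [NormedAddCommGroup H] [InnerProductSpace ℂ H] [CompleteSpace H]
variable (π : C₀(X, ℂ) →⋆ₙₐ[ℂ] (H →L[ℂ] H))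

/-- The norm of a column of operators in a representation of `C₀(X)`. -/
theorem sum_sq_norm_le {ι : Type*} [Fintype ι] (a : ι → C₀(X, ℂ)) {M : ℝ} (hM : 0 ≤ M)
    (ha : ∀ x, ∑ i, ‖a i x‖ ^ 2 ≤ M) (v : H) : ∑ i, ‖π (a i) v‖ ^ 2 ≤ M * ‖v‖ ^ 2 := by
  -- The squared length of the column applied to v is ⟨v, π(b)v⟩, and ‖b‖ is the supremum of ∑
  -- |a_i|².
  set b := ∑ i, star (a i) * a i with hb
  have hbn : ‖b‖ ≤ M := by
    refine ZeroAtInftyContinuousMap.norm_le_of_forall hM fun x => ?_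
    rw [hb, ZeroAtInftyContinuousMap.sum_apply]
    refine (norm_sum_le _ _).trans (le_trans (le_of_eq ?_) (ha x))
    refine Finset.sum_congr rfl fun i _ => ?_
    rw [ZeroAtInftyContinuousMap.mul_apply, ZeroAtInftyContinuousMap.star_apply, norm_mul,
      norm_star, sq]
  have h1 : ((∑ i, ‖π (a i) v‖ ^ 2 : ℝ) : ℂ) = inner ℂ v (π b v) := by
    rw [hb, map_sum, _root_.sum_apply, inner_sum, Complex.ofReal_sum]
    refine Finset.sum_congr rfl fun i _ => ?_
    rw [map_mul, map_star, ContinuousLinearMap.star_eq_adjoint, mul_apply_eq_comp,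
      ContinuousLinearMap.adjoint_inner_right, inner_self_eq_norm_sq_to_K]
    push_cast
    rfl
  have h2 : ‖((∑ i, ‖π (a i) v‖ ^ 2 : ℝ) : ℂ)‖ = ∑ i, ‖π (a i) v‖ ^ 2 := by
    rw [Complex.norm_real, Real.norm_of_nonneg (Finset.sum_nonneg fun i _ => sq_nonneg _)]
  rw [← h2, h1]
  calc ‖inner ℂ v (π b v)‖ ≤ ‖v‖ * ‖π b v‖ := norm_inner_le_norm _ _
    _ ≤ ‖v‖ * (‖b‖ * ‖v‖) := mul_le_mul_of_nonneg_left (((π b).le_opNorm v).trans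
        (mul_le_mul_of_nonneg_right (NonUnitalStarAlgHom.norm_apply_le π b) (norm_nonneg _)))
        (norm_nonneg _)
    _ ≤ ‖v‖ * (M * ‖v‖) := by gcongr
    _ = M * ‖v‖ ^ 2 := by ring

/-- The norm of a row of operators in a representation of `C₀(X)`. -/
theorem norm_sum_apply_le {ι : Type*} [Fintype ι] (a : ι → C₀(X, ℂ))
    (ha : ∀ x, ∑ i, ‖a i x‖ ^ 2 ≤ 1) (k : ι → H) :
    ‖∑ i, π (a i) (k i)‖ ^ 2 ≤ ∑ i, ‖k i‖ ^ 2 := by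
  set v := ∑ i, π (a i) (k i) with hv
  have h0 : 0 ≤ ∑ i, ‖k i‖ ^ 2 := Finset.sum_nonneg fun i _ => sq_nonneg _
  -- Duality: the adjoint of the row is the column of the π(a_i*), so pairing v with itself and
  -- applying Cauchy–Schwarz reduces to the column estimate.
  have h1 : ‖v‖ ^ 2 ≤ ∑ i, ‖π (star (a i)) v‖ * ‖k i‖ := by
    have h2 : ((‖v‖ ^ 2 : ℝ) : ℂ) = ∑ i, inner ℂ (π (star (a i)) v) (k i) := by
      have h3 : ((‖v‖ ^ 2 : ℝ) : ℂ) = inner ℂ v v := by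
        rw [inner_self_eq_norm_sq_to_K]
        push_cast
        rfl
      rw [h3]
      nth_rw 2 [hv]
      rw [inner_sum]
      refine Finset.sum_congr rfl fun i _ => ?_
      rw [map_star, ContinuousLinearMap.star_eq_adjoint, ContinuousLinearMap.adjoint_inner_left]
    have h4 : ‖v‖ ^ 2 = ‖((‖v‖ ^ 2 : ℝ) : ℂ)‖ := by
      rw [Complex.norm_real, Real.norm_of_nonneg (sq_nonneg _)]
    rw [h4, h2]
    exact (norm_sum_le _ _).trans (Finset.sum_le_sum fun i _ => norm_inner_le_norm _ _)
  have h5 := Finset.sum_mul_sq_le_sq_mul_sq Finset.univ (fun i => ‖π (star (a i)) v‖)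
    fun i => ‖k i‖
  have h6 := sum_sq_norm_le π (fun i => star (a i)) zero_le_one (fun x => by
    simpa only [ZeroAtInftyContinuousMap.star_apply, norm_star] using ha x) v
  have h7 : (‖v‖ ^ 2) ^ 2 ≤ ‖v‖ ^ 2 * ∑ i, ‖k i‖ ^ 2 := by
    calc (‖v‖ ^ 2) ^ 2 ≤ (∑ i, ‖π (star (a i)) v‖ * ‖k i‖) ^ 2 :=
          pow_le_pow_left₀ (sq_nonneg _) h1 2
      _ ≤ _ := h5
      _ ≤ ‖v‖ ^ 2 * ∑ i, ‖k i‖ ^ 2 := by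
          refine mul_le_mul_of_nonneg_right ?_ h0
          linarith
  -- The factor ‖v‖² can only be cancelled when it is non-zero.
  rcases (sq_nonneg ‖v‖).eq_or_lt with h8 | h8
  · rw [← h8]
    exact h0
  · rw [sq (‖v‖ ^ 2)] at h7
    exact le_of_mul_le_mul_left h7 h8

end RowColumn

/-! ### Functions on a bisection as functions on its sources. -/

namespace EtaleCategory

variable {X : Type v} {C : Type w} [TopologicalSpace X] [TopologicalSpace C]
variable (𝒞 : EtaleCategory X C)

/-- The function on arrows which vanishes outside `U` and is `b ∘ 𝐝` on `U`. -/
noncomputable def pull (U : Set C) (b : X → ℂ) : C → ℂ :=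
  U.indicator fun z => b (𝒞.src z)

variable {𝒞} {U V : Set C}

theorem pull_of_mem (b : X → ℂ) {z : C} (hz : z ∈ U) : 𝒞.pull U b z = b (𝒞.src z) :=
  Set.indicator_of_mem hz _

theorem pull_of_notMem (b : X → ℂ) {z : C} (hz : z ∉ U) : 𝒞.pull U b z = 0 :=
  Set.indicator_of_notMem hz _

theorem pull_congr {b c : X → ℂ} (h : ∀ z ∈ U, b (𝒞.src z) = c (𝒞.src z)) :
    𝒞.pull U b = 𝒞.pull U c :=
  Set.indicator_congr h

theorem pull_add (b c : X → ℂ) : 𝒞.pull U (b + c) = 𝒞.pull U b + 𝒞.pull U c :=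
  Set.indicator_add U _ _

theorem pull_smul (r : ℂ) (b : X → ℂ) : 𝒞.pull U (r • b) = r • 𝒞.pull U b :=
  Set.indicator_const_smul U r _

theorem pull_sum {ι : Type*} (s : Finset ι) (b : ι → C₀(X, ℂ)) :
    𝒞.pull U (∑ i ∈ s, b i : C₀(X, ℂ)) = ∑ i ∈ s, 𝒞.pull U (b i) := by
  classical
  induction s using Finset.induction_on with
  | empty => exact Set.indicator_zero _ _
  | insert a s ha ih =>
    rw [Finset.sum_insert ha, Finset.sum_insert ha, ← ih]
    exact pull_add (b a) (∑ i ∈ s, b i : C₀(X, ℂ))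

theorem IsBisection.isOpenEmbedding_src (hU : 𝒞.IsBisection U) :
    Topology.IsOpenEmbedding fun z : U => 𝒞.src z :=
  Topology.IsOpenEmbedding.of_continuous_injective_isOpenMap
    (𝒞.isLocalHomeomorph_src.continuous.comp continuous_subtype_val)
    (fun a b h => Subtype.ext (hU.injOn_src a.2 b.2 h))
    (𝒞.isLocalHomeomorph_src.isOpenMap.comp hU.isOpen.isOpenMap_subtype_val)

/-- The source map is a homeomorphism of U onto an open set of objects, so it carries compact
supports inside that set back to compact supports in U. -/
theorem IsBisection.pull_mem_CcOn (hU : 𝒞.IsBisection U) {b : C₀(X, ℂ)}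
    (hb : b ∈ ccSubmodule (𝒞.src '' U)) : 𝒞.pull U b ∈ CcOn U := by
  have := hU.t2Space
  obtain ⟨K, hKU, hK, hb⟩ := hb
  have hc := hU.isOpenEmbedding_src
  refine ⟨?_, HasCompactSupport.intro (K := (fun z : U => 𝒞.src z) ⁻¹' K) ?_ ?_, ?_⟩
  · have h : (fun z : U => 𝒞.pull U b z) = fun z : U => b (𝒞.src z) :=
      funext fun z => pull_of_mem _ z.2
    rw [h]
    exact (map_continuous b).comp hc.continuous
  · refine (hc.isInducing.isCompact_preimage_iff fun x hx => ?_).2 hK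
    obtain ⟨z, hz, rfl⟩ := hKU hx
    exact ⟨⟨z, hz⟩, rfl⟩
  · intro z hz
    rw [pull_of_mem _ z.2]
    exact hb _ hz
  · exact fun z hz => pull_of_notMem _ hz

theorem IsBisection.pull_mem_A0 (hU : 𝒞.IsBisection U) {b : C₀(X, ℂ)}
    (hb : b ∈ ccSubmodule (𝒞.src '' U)) : 𝒞.pull U b ∈ 𝒞.A0 :=
  Submodule.subset_span ⟨U, hU.isOpen, hU.t2Space, hU.pull_mem_CcOn hb⟩

/-- An arrow has at most one factorization through two bisections, so the convolution sum has a
single term; the source of a composite is that of its right factor. The condition on d is imposed at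
composable pairs only, since its other values do not matter. -/
theorem conv_pull (hU : 𝒞.IsBisection U) (hV : 𝒞.IsBisection V) {b c d : X → ℂ}
    (h : ∀ z ∈ U, ∀ w ∈ V, 𝒞.src z = 𝒞.tgt w → d (𝒞.src w) = b (𝒞.tgt w) * c (𝒞.src w)) :
    𝒞.conv (𝒞.pull U b) (𝒞.pull V c) = 𝒞.pull (𝒞.mulSet U V) d := by
  have hb : ∀ z, z ∉ U → 𝒞.pull U b z = 0 := fun z hz => pull_of_notMem b hz
  have hc : ∀ z, z ∉ V → 𝒞.pull V c z = 0 := fun z hz => pull_of_notMem c hz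
  funext z
  by_cases hz : z ∈ 𝒞.mulSet U V
  · rw [pull_of_mem d hz]
    obtain ⟨x, hx, y, hy, hxy, rfl⟩ := hz
    rw [conv_comp hU hV hb hc hx hy, pull_of_mem b hx, pull_of_mem c hy, 𝒞.src_comp,
      h x hx y hy hxy, hxy]
  · rw [pull_of_notMem d hz]
    by_contra hne
    exact hz (mem_mulSet_of_conv_ne_zero hb hc hne)

theorem mulSet_range_unit_left (U : Set C) : 𝒞.mulSet (Set.range 𝒞.unit) U = U := by
  ext z
  constructor
  · rintro ⟨_, ⟨x, rfl⟩, y, hy, h, rfl⟩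
    have h' : x = 𝒞.tgt y := by rw [← h, 𝒞.src_unit]
    subst h'
    rwa [𝒞.unit_comp]
  · intro hz
    exact ⟨_, ⟨𝒞.tgt z, rfl⟩, z, hz, 𝒞.src_unit _, 𝒞.unit_comp z⟩

theorem mulSet_range_unit_right (U : Set C) : 𝒞.mulSet U (Set.range 𝒞.unit) = U := by
  ext z
  constructor
  · rintro ⟨y, hy, _, ⟨x, rfl⟩, h, rfl⟩
    have h' : x = 𝒞.src y := by rw [h, 𝒞.tgt_unit]
    subst h'
    rwa [𝒞.comp_unit]
  · intro hz
    exact ⟨z, hz, _, ⟨𝒞.src z, rfl⟩, (𝒞.tgt_unit _).symm, 𝒞.comp_unit z⟩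

/-- Every function in `C_c(U)`, for a bisection `U`, arises from a function on objects. -/
theorem IsBisection.exists_eq_pull (hU : 𝒞.IsBisection U) {f : C → ℂ} (hf : f ∈ CcOn U) :
    ∃ g ∈ ccSubmodule (𝒞.src '' U), f = 𝒞.pull U g ∧ ‖g‖ ≤ ⨆ z, ‖f z‖ := by
  have := 𝒞.t2Space
  have he := hU.isOpenEmbedding_src
  set e : U → X := fun z => 𝒞.src z with hedef
  obtain ⟨hf1, hf2, hf3⟩ := hf
  -- This is f transported along the homeomorphism of U with its image under the source map,
  -- extended by 0. It is continuous on the open image, and the support is a closed subset of that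
  -- image.
  set g₀ : X → ℂ := Function.extend e (fun z : U => f z) 0 with hg₀
  have hge : ∀ z : U, g₀ (e z) = f z := fun z => he.injective.extend_apply _ _ z
  have hgc : HasCompactSupport g₀ := hf2.extend_zero he.continuous
  have hsub := hf2.tsupport_extend_zero_subset he.continuous
  have hcont : Continuous g₀ := by
    refine continuous_of_tsupport fun x hx => ?_
    obtain ⟨z, -, rfl⟩ := hsub hx
    rw [← he.continuousAt_iff, hg₀, Function.extend_comp he.injective]
    exact hf1.continuousAt
  -- An unbounded real family has supremum 0 by convention, so boundedness is needed for the
  -- supremum to dominate the values.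
  have hbdd : BddAbove (Set.range fun z => ‖f z‖) := by
    obtain ⟨M, hM⟩ := hf1.bounded_above_of_compact_support hf2
    refine ⟨max M 0, ?_⟩
    rintro _ ⟨z, rfl⟩
    by_cases hz : z ∈ U
    · exact (hM ⟨z, hz⟩).trans (le_max_left _ _)
    · change ‖f z‖ ≤ _
      rw [hf3 z hz, norm_zero]
      exact le_max_right _ _
  refine ⟨⟨⟨g₀, hcont⟩, hgc.is_zero_at_infty⟩, ⟨tsupport g₀, fun x hx => ?_, hgc,
    fun x hx => image_eq_zero_of_notMem_tsupport hx⟩, ?_, ?_⟩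
  · obtain ⟨z, -, rfl⟩ := hsub hx
    exact ⟨z, z.2, rfl⟩
  · funext z
    by_cases hz : z ∈ U
    · rw [pull_of_mem _ hz]
      exact (hge ⟨z, hz⟩).symm
    · rw [pull_of_notMem _ hz, hf3 z hz]
  · refine ZeroAtInftyContinuousMap.norm_le_of_forall
      (Real.iSup_nonneg fun _ => norm_nonneg _) fun x => ?_
    change ‖g₀ x‖ ≤ _
    by_cases hx : ∃ z, e z = x
    · obtain ⟨z, rfl⟩ := hx
      rw [hge]
      exact le_ciSup hbdd (z : C)
    · rw [hg₀, Function.extend_apply' _ _ _ hx, Pi.zero_apply, norm_zero]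
      exact Real.iSup_nonneg fun _ => norm_nonneg _

end EtaleCategory

/-! ### Functions supported on the germs of one element. -/

namespace EtaleAction

variable {S : Type u} [RestrictionSemigroup S] {X : Type v} [TopologicalSpace X]
variable [LocallyCompactSpace X] [T2Space X] (θ : EtaleAction S X)

theorem isBisection_germSet (s : S) : θ.germCategory.IsBisection (θ.germSet s Set.univ) :=
  ⟨θ.isOpen_germSet s isOpen_univ, θ.injOn_germSrc s, θ.injOn_germTgt s⟩

theorem image_src_germSet (s : S) :
    θ.germCategory.src '' θ.germSet s Set.univ = (θ s).source := by
  ext x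
  constructor
  · rintro ⟨_, ⟨y, hy, -, rfl⟩, rfl⟩
    exact hy
  · exact fun hx => ⟨_, ⟨x, hx, trivial, rfl⟩, rfl⟩

theorem mulSet_germSet (s t : S) :
    θ.germCategory.mulSet (θ.germSet s Set.univ) (θ.germSet t Set.univ) =
      θ.germSet (s * t) Set.univ := by
  ext z
  constructor
  · rintro ⟨_, ⟨x, hx, -, rfl⟩, _, ⟨y, hy, -, rfl⟩, h, rfl⟩
    exact ⟨y, _, trivial, θ.germComp_germ s t x y hx hy h⟩
  · rintro ⟨y, hy, -, rfl⟩
    obtain ⟨h1, h2⟩ := θ.isHom.mem_source_mul.1 hy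
    exact ⟨_, ⟨θ t y, h2, trivial, rfl⟩, _, ⟨y, h1, trivial, rfl⟩, rfl,
      θ.germComp_germ s t _ y h2 h1 rfl⟩

/-- In this form the unit space is visibly open, and functions on it can be decomposed using
projections alone. -/
theorem range_unit : Set.range θ.germCategory.unit =
    ⋃ e : (proj : Set S), θ.germSet e Set.univ := by
  ext z
  simp only [Set.mem_iUnion]
  constructor
  · rintro ⟨x, rfl⟩
    exact ⟨⟨_, (θ.cover x).choose_spec.1⟩, x, (θ.cover x).choose_spec.2, trivial, rfl⟩
  · rintro ⟨⟨e, he⟩, x, hx, -, rfl⟩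
    exact ⟨x, θ.germUnit_eq he hx⟩

theorem germSet_subset_range_unit {e : S} (he : e ∈ (proj : Set S)) :
    θ.germSet e Set.univ ⊆ Set.range θ.germCategory.unit := by
  rw [θ.range_unit]
  exact Set.subset_iUnion (fun e : (proj : Set S) => θ.germSet (e : S) Set.univ) ⟨e, he⟩

theorem isBisection_range_unit : θ.germCategory.IsBisection (Set.range θ.germCategory.unit) := by
  refine ⟨?_, ?_, ?_⟩
  · rw [θ.range_unit]
    exact isOpen_iUnion fun e => θ.isOpen_germSet _ isOpen_univ
  · rintro _ ⟨x, rfl⟩ _ ⟨y, rfl⟩ h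
    rw [θ.germCategory.src_unit, θ.germCategory.src_unit] at h
    rw [h]
  · rintro _ ⟨x, rfl⟩ _ ⟨y, rfl⟩ h
    rw [θ.germCategory.tgt_unit, θ.germCategory.tgt_unit] at h
    rw [h]

theorem image_src_range_unit : θ.germCategory.src '' Set.range θ.germCategory.unit = Set.univ :=
  Set.eq_univ_of_forall fun x => ⟨_, ⟨x, rfl⟩, θ.germCategory.src_unit x⟩

/-- The function on germs which is `b ∘ 𝐝` on the germs of `s`, and `0` elsewhere. -/
noncomputable def germFun (s : S) (b : X → ℂ) : θ.Germ → ℂ :=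
  θ.germCategory.pull (θ.germSet s Set.univ) b

theorem germFun_mem_A0 {s : S} {b : C₀(X, ℂ)} (hb : b ∈ ccSubmodule (θ s).source) :
    θ.germFun s b ∈ θ.germCategory.A0 :=
  (θ.isBisection_germSet s).pull_mem_A0 (by rwa [image_src_germSet])

theorem germFun_germ (s : S) (b : X → ℂ) {x : X} (hx : x ∈ (θ s).source) :
    θ.germFun s b (θ.germ s x hx) = b x :=
  EtaleCategory.pull_of_mem b ⟨x, hx, trivial, rfl⟩

theorem conv_germFun {s t : S} {b c d : X → ℂ}
    (h : ∀ x ∈ (θ t).source, θ t x ∈ (θ s).source → d x = b (θ t x) * c x) :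
    θ.germCategory.conv (θ.germFun s b) (θ.germFun t c) = θ.germFun (s * t) d := by
  rw [germFun, germFun, EtaleCategory.conv_pull (θ.isBisection_germSet s)
    (θ.isBisection_germSet t) (d := d), mulSet_germSet, germFun]
  rintro _ ⟨x, hx, -, rfl⟩ _ ⟨y, hy, -, rfl⟩ hxy
  have hxy' : x = θ t y := hxy
  subst hxy'
  exact h y hy hx

/-- Functions in `C_c(U)`, for a bisection `U`, are finite sums of functions supported on the germs
of single elements of `S`. -/
theorem exists_sum_germFun {U : Set θ.Germ} (hU : θ.germCategory.IsBisection U) {f : θ.Germ → ℂ}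
    (hf : f ∈ CcOn U) {I : Set S} (hI : U ⊆ ⋃ s ∈ I, θ.germSet s Set.univ) :
    ∃ (g : C₀(X, ℂ)) (n : ℕ) (s : Fin n → S) (ξ : Fin n → C₀(X, ℂ)), ‖g‖ ≤ ⨆ z, ‖f z‖ ∧
      (∀ k, s k ∈ I) ∧
      (∀ k, ξ k ∈ ccSubmodule (θ.germCategory.src '' (U ∩ θ.germSet (s k) Set.univ))) ∧
      (∀ x, ∑ k, ‖ξ k x‖ ^ 2 ≤ 1) ∧ f = ∑ k, θ.germFun (s k) (ξ k * (ξ k * g) : C₀(X, ℂ)) := by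
  obtain ⟨g, ⟨K, hKU, hK, hgK⟩, rfl, hgn⟩ := hU.exists_eq_pull hf
  -- The pieces are written ξ(ξg), with ∑ ξ² = 1 on the support of g, so that later one factor ξ can
  -- go into a row of operators and the factor ξg into a column.
  obtain ⟨n, j, ξ, hξ, hξ1, hξK⟩ := exists_sq_partition
    (U := fun s : I => θ.germCategory.src '' (U ∩ θ.germSet (s : S) Set.univ))
    (fun s => θ.isOpenMap_germSrc _ (hU.isOpen.inter (θ.isOpen_germSet _ isOpen_univ))) hK (by
      intro x hx
      obtain ⟨z, hz, rfl⟩ := hKU hx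
      obtain ⟨s, hs, hzs⟩ := Set.mem_iUnion₂.1 (hI hz)
      exact Set.mem_iUnion.2 ⟨⟨s, hs⟩, z, ⟨hz, hzs⟩, rfl⟩)
  refine ⟨g, n, fun k => j k, ξ, hgn, fun k => (j k).2, hξ, hξ1, ?_⟩
  have key : ∀ k, θ.germFun (j k) (ξ k * (ξ k * g) : C₀(X, ℂ)) =
      θ.germCategory.pull U (ξ k * (ξ k * g) : C₀(X, ℂ)) := by
    intro k
    -- Over the support of ξ_k the two bisections coincide: they share an arrow with the given
    -- source, and the source map is injective on each of them.
    have h0 : ∀ z, ξ k (θ.germCategory.src z) ≠ 0 →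
        (z ∈ θ.germSet (j k : S) Set.univ ↔ z ∈ U) := by
      intro z hz
      have h1 : θ.germCategory.src z ∈
          θ.germCategory.src '' (U ∩ θ.germSet (j k : S) Set.univ) := by
        by_contra h
        exact hz (mem_C0On_of_mem_ccSubmodule (hξ k) _ h)
      obtain ⟨w, ⟨hwU, hws⟩, hwz⟩ := h1
      constructor
      · intro h
        rwa [← θ.injOn_germSrc _ hws h hwz]
      · intro h
        rwa [← hU.injOn_src hwU h hwz]
    classical
    funext z
    by_cases hz : ξ k (θ.germCategory.src z) = 0
    · have h2 : (ξ k * (ξ k * g) : C₀(X, ℂ)) (θ.germCategory.src z) = 0 := by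
        rw [ZeroAtInftyContinuousMap.mul_apply, hz, zero_mul]
      rw [germFun, EtaleCategory.pull, EtaleCategory.pull, Set.indicator_apply,
        Set.indicator_apply, h2, ite_self, ite_self]
    · rw [germFun, EtaleCategory.pull, EtaleCategory.pull, Set.indicator_apply,
        Set.indicator_apply, if_congr (h0 z hz) rfl rfl]
  rw [Finset.sum_congr rfl fun k _ => key k, ← EtaleCategory.pull_sum]
  refine EtaleCategory.pull_congr fun z _ => ?_
  rw [ZeroAtInftyContinuousMap.sum_apply]
  have h3 : ∀ k, (ξ k * (ξ k * g)) (θ.germCategory.src z) =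
      ξ k (θ.germCategory.src z) * ξ k (θ.germCategory.src z) * g (θ.germCategory.src z) :=
    fun k => (mul_assoc _ _ _).symm
  rw [Finset.sum_congr rfl fun k _ => h3 k, ← Finset.sum_mul]
  by_cases hz : θ.germCategory.src z ∈ K
  · rw [hξK _ hz, one_mul]
  · rw [hgK _ hz, mul_zero]

end EtaleAction

/-! ### Transport of compact supports along partial homeomorphisms. -/

section Push

variable {X : Type v} [TopologicalSpace X] [T2Space X] (e : OpenPartialHomeomorph X X)

theorem pushC0_symm_apply {f : C₀(X, ℂ)} (hf : f ∈ C0On e.target) {x : X} (hx : x ∈ e.source) :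
    pushC0 e.symm f x = f (e x) := by
  have h := pushC0_apply e.symm hf (e.map_source hx)
  rwa [show e.symm (e x) = x from e.left_inv hx] at h

theorem pushC0_mem_ccSubmodule {W : Set X} (hW : W ⊆ e.source) {b : C₀(X, ℂ)}
    (hb : b ∈ ccSubmodule W) : pushC0 e b ∈ ccSubmodule (e '' W) := by
  have hb0 : b ∈ C0On e.source := mem_C0On_of_mem_ccSubmodule (ccSubmodule_mono hW hb)
  obtain ⟨K, hKW, hK, hb⟩ := hb
  refine ⟨e '' K, Set.image_mono hKW, hK.image_of_continuousOn
    (e.continuousOn.mono (hKW.trans hW)), fun y hy => ?_⟩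
  by_cases hyt : y ∈ e.target
  · have h := pushC0_apply e hb0 (e.map_target hyt)
    rw [e.right_inv hyt] at h
    rw [h]
    exact hb _ fun hx => hy ⟨_, hx, e.right_inv hyt⟩
  · exact pushC0_mem e b y hyt

theorem mul_mem_ccSubmodule_inter {U V : Set X} {b c : C₀(X, ℂ)} (hb : b ∈ ccSubmodule U)
    (hc : c ∈ ccSubmodule V) : b * c ∈ ccSubmodule (U ∩ V) := by
  obtain ⟨K, hKU, hK, hb⟩ := hb
  obtain ⟨L, hLV, hL, hc⟩ := hc
  refine ⟨K ∩ L, Set.inter_subset_inter hKU hLV, hK.inter hL, fun x hx => ?_⟩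
  rw [ZeroAtInftyContinuousMap.mul_apply]
  by_cases h : x ∈ K
  · rw [hc x fun h' => hx ⟨h, h'⟩, mul_zero]
  · rw [hb x h, zero_mul]

end Push

/-! ### The map from compactly supported formal sums onto A₀(𝒞). -/

namespace EtaleAction

variable {S : Type u} [RestrictionSemigroup S] {X : Type v} [TopologicalSpace X]
variable [LocallyCompactSpace X] [T2Space X] (θ : EtaleAction S X)

/-- The element `α_s(b) δ_s` of `L_α`. -/
noncomputable def delta (s : S) (b : C₀(X, ℂ)) : θ.inducedAction.FormalSums :=
  θ.inducedAction.single s ⟨θ.inducedAction s b,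
    (θ.inducedAction.mem_ranIdeal_iff).2 (pushC0_mem (θ.homeo s) b)⟩

/-- The map from `L_α` to functions on germs which sends `α_s(b) δ_s` to `b ∘ 𝐝` on the germs
of `s`. -/
noncomputable def toGermFun : θ.inducedAction.FormalSums →ₗ[ℂ] (θ.Germ → ℂ) :=
  θ.inducedAction.lift fun s =>
    { toFun := fun a => θ.germFun s ((θ.inducedAction s).symm a : C₀(X, ℂ))
      map_add' := fun a b => by
        rw [Submodule.coe_add, θ.inducedAction.symm_add (θ.inducedAction.mem_ranIdeal_iff.1 a.2)
          (θ.inducedAction.mem_ranIdeal_iff.1 b.2)]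
        exact EtaleCategory.pull_add _ _
      map_smul' := fun c a => by
        rw [Submodule.coe_smul,
          θ.inducedAction.symm_smul c (θ.inducedAction.mem_ranIdeal_iff.1 a.2)]
        exact EtaleCategory.pull_smul c _ }

theorem toGermFun_delta {s : S} {b : C₀(X, ℂ)} (hb : b ∈ C0On (θ s).source) :
    θ.toGermFun (θ.delta s b) = θ.germFun s b := by
  rw [toGermFun, delta, CStarEtaleAction.lift_single]
  change θ.germFun s ((θ.inducedAction s).symm (θ.inducedAction s b) : C₀(X, ℂ)) = _
  rw [(θ.inducedAction s).left_inv hb]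

/-- The function `x ↦ b(θ_t(x)) c(x)`. -/
noncomputable def twist (t : S) (b c : C₀(X, ℂ)) : C₀(X, ℂ) :=
  pushC0 (θ.homeo t).symm (b * pushC0 (θ.homeo t) c)

variable {θ}

theorem twist_apply {t : S} (b : C₀(X, ℂ)) {c : C₀(X, ℂ)} (hc : c ∈ C0On (θ t).source) {x : X}
    (hx : x ∈ (θ t).source) : θ.twist t b c x = b (θ t x) * c x := by
  rw [twist, pushC0_symm_apply (θ.homeo t)
    ((isClosedIdeal_C0On _).mul_mem_left b _ (pushC0_mem _ c)) hx,
    ZeroAtInftyContinuousMap.mul_apply, pushC0_apply (θ.homeo t) hc hx]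
  rfl

/-- The function lives on the preimage under θ_t of D_{λ(s)} ∩ D_{ρ(t)}, which is the domain of
θ_{st}; the two compact supports are intersected on the range side and pulled back. -/
theorem twist_mem {s t : S} {b c : C₀(X, ℂ)} (hb : b ∈ ccSubmodule (θ s).source)
    (hc : c ∈ ccSubmodule (θ t).source) : θ.twist t b c ∈ ccSubmodule (θ (s * t)).source := by
  have h1 := mul_mem_ccSubmodule_inter hb
    (pushC0_mem_ccSubmodule (θ.homeo t) (W := (θ t).source) subset_rfl hc)
  have h2 : (θ s).source ∩ (θ.homeo t) '' (θ t).source ⊆ (θ.homeo t).symm.source := by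
    rintro _ ⟨-, x, hx, rfl⟩
    exact (θ t).map_source hx
  refine ccSubmodule_mono ?_ (pushC0_mem_ccSubmodule (θ.homeo t).symm h2 h1)
  rintro _ ⟨_, ⟨hy, x, hx, rfl⟩, rfl⟩
  have h3 : (θ.homeo t).symm ((θ.homeo t) x) = x := (θ t).left_inv hx
  rw [h3]
  exact θ.isHom.mem_source_mul.2 ⟨hx, hy⟩

/-- The product has coefficient α_s(b α_t(c)), and b α_t(c) is α_t of the twisted function. The same
twist governs convolution of functions on germs (`conv_germFun_twist`), which is why the map to
A₀(𝒞) is multiplicative. -/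
theorem delta_mul_delta {s t : S} {b c : C₀(X, ℂ)} (hb : b ∈ ccSubmodule (θ s).source)
    (hc : c ∈ ccSubmodule (θ t).source) :
    θ.delta s b * θ.delta t c = θ.delta (s * t) (θ.twist t b c) := by
  rw [delta, delta, delta, CStarEtaleAction.single_mul_single]
  refine CStarEtaleAction.single_congr _ rfl ?_
  change θ.inducedAction s ((θ.inducedAction s).symm (θ.inducedAction s b) *
    θ.inducedAction t c) = θ.inducedAction (s * t) (θ.twist t b c)
  have h := mem_C0On_of_mem_ccSubmodule (twist_mem hb hc)
  rw [(θ.inducedAction s).left_inv (mem_C0On_of_mem_ccSubmodule hb),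
    θ.inducedAction.isHom.apply_mul h]
  congr 1
  exact ((θ.inducedAction t).right_inv
    ((isClosedIdeal_C0On _).mul_mem_left b _ (pushC0_mem (θ.homeo t) c))).symm

theorem conv_germFun_twist {s t : S} {b c : C₀(X, ℂ)} (hc : c ∈ C0On (θ t).source) :
    θ.germCategory.conv (θ.germFun s b) (θ.germFun t c) = θ.germFun (s * t) (θ.twist t b c) :=
  θ.conv_germFun fun _ hx _ => twist_apply b hc hx

variable (θ)

/-- The span of the formal sums `a δ_s` with `a` compactly supported in `D_{ρ(s)}`. -/
noncomputable def compactFormalSums : Submodule ℂ θ.inducedAction.FormalSums :=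
  Submodule.span ℂ {x | ∃ s, ∃ b ∈ ccSubmodule (θ s).source, x = θ.delta s b}

variable {θ}

theorem delta_mem {s : S} {b : C₀(X, ℂ)} (hb : b ∈ ccSubmodule (θ s).source) :
    θ.delta s b ∈ θ.compactFormalSums :=
  Submodule.subset_span ⟨s, b, hb, rfl⟩

theorem delta_smul {s : S} (c : ℂ) {b : C₀(X, ℂ)} (hb : b ∈ C0On (θ s).source) :
    θ.delta s (c • b) = c • θ.delta s b := by
  rw [delta, delta, ← map_smul]
  congr 1
  exact Subtype.ext (θ.inducedAction.apply_smul s c b hb)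

/-- The scalars are absorbed into the functions. The s_i may repeat, which is harmless for every
later use. -/
theorem exists_eq_sum_delta {x : θ.inducedAction.FormalSums} (hx : x ∈ θ.compactFormalSums) :
    ∃ (n : ℕ) (s : Fin n → S) (b : Fin n → C₀(X, ℂ)),
      (∀ i, b i ∈ ccSubmodule (θ (s i)).source) ∧ x = ∑ i, θ.delta (s i) (b i) := by
  obtain ⟨n, c, y, rfl⟩ := Submodule.mem_span_set'.1 hx
  choose s b hb hy using fun i => (y i).2
  refine ⟨n, s, fun i => c i • b i, fun i => Submodule.smul_mem _ _ (hb i), ?_⟩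
  refine Finset.sum_congr rfl fun i _ => ?_
  rw [hy, delta_smul (c i) (mem_C0On_of_mem_ccSubmodule (hb i))]

theorem toGermFun_mem {x : θ.inducedAction.FormalSums} (hx : x ∈ θ.compactFormalSums) :
    θ.toGermFun x ∈ θ.germCategory.A0 := by
  obtain ⟨n, s, b, hb, rfl⟩ := exists_eq_sum_delta hx
  rw [map_sum]
  refine Submodule.sum_mem _ fun i _ => ?_
  rw [toGermFun_delta _ (mem_C0On_of_mem_ccSubmodule (hb i))]
  exact θ.germFun_mem_A0 (hb i)

variable (θ)

/-- The restriction of `toGermFun` to a map onto `A₀(𝒞)`. -/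
noncomputable def toA0 : θ.compactFormalSums →ₗ[ℂ] θ.germCategory.A0 :=
  (θ.toGermFun ∘ₗ θ.compactFormalSums.subtype).codRestrict _ fun x => toGermFun_mem x.2

variable {θ}

theorem coe_toA0 (x : θ.compactFormalSums) : (θ.toA0 x : θ.Germ → ℂ) = θ.toGermFun x := rfl

theorem mul_mem_compactFormalSums {x y : θ.inducedAction.FormalSums}
    (hx : x ∈ θ.compactFormalSums) (hy : y ∈ θ.compactFormalSums) :
    x * y ∈ θ.compactFormalSums := by
  obtain ⟨n, s, b, hb, rfl⟩ := exists_eq_sum_delta hx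
  obtain ⟨m, t, c, hc, rfl⟩ := exists_eq_sum_delta hy
  rw [Finset.sum_mul_sum]
  refine Submodule.sum_mem _ fun i _ => Submodule.sum_mem _ fun j _ => ?_
  rw [delta_mul_delta (hb i) (hc j)]
  exact delta_mem (twist_mem (hb i) (hc j))

theorem toA0_mul (x y : θ.compactFormalSums) :
    θ.toA0 ⟨x * y, mul_mem_compactFormalSums x.2 y.2⟩ = θ.toA0 x * θ.toA0 y := by
  have key : ∀ {s t b c} (hb : b ∈ ccSubmodule (θ s).source)
      (hc : c ∈ ccSubmodule (θ t).source), θ.toA0 ⟨θ.delta s b * θ.delta t c,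
        mul_mem_compactFormalSums (delta_mem hb) (delta_mem hc)⟩ =
      θ.toA0 ⟨θ.delta s b, delta_mem hb⟩ * θ.toA0 ⟨θ.delta t c, delta_mem hc⟩ := by
    intro s t b c hb hc
    refine Subtype.ext ?_
    rw [EtaleCategory.coe_mul, coe_toA0, coe_toA0, coe_toA0]
    change θ.toGermFun (θ.delta s b * θ.delta t c) =
      θ.germCategory.conv (θ.toGermFun (θ.delta s b)) (θ.toGermFun (θ.delta t c))
    rw [delta_mul_delta hb hc, toGermFun_delta _ (mem_C0On_of_mem_ccSubmodule (twist_mem hb hc)),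
      toGermFun_delta _ (mem_C0On_of_mem_ccSubmodule hb),
      toGermFun_delta _ (mem_C0On_of_mem_ccSubmodule hc),
      conv_germFun_twist (mem_C0On_of_mem_ccSubmodule hc)]
  obtain ⟨n, s, b, hb, hx⟩ := exists_eq_sum_delta x.2
  obtain ⟨m, t, c, hc, hy⟩ := exists_eq_sum_delta y.2
  have hx' : x = ∑ i, ⟨θ.delta (s i) (b i), delta_mem (hb i)⟩ := Subtype.ext (by
    rw [hx, AddSubmonoidClass.coe_finsetSum])
  have hy' : y = ∑ i, ⟨θ.delta (t i) (c i), delta_mem (hc i)⟩ := Subtype.ext (by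
    rw [hy, AddSubmonoidClass.coe_finsetSum])
  have hxy : (⟨x * y, mul_mem_compactFormalSums x.2 y.2⟩ : θ.compactFormalSums) =
      ∑ i, ∑ j, ⟨θ.delta (s i) (b i) * θ.delta (t j) (c j),
        mul_mem_compactFormalSums (delta_mem (hb i)) (delta_mem (hc j))⟩ := by
    refine Subtype.ext ?_
    simp only [AddSubmonoidClass.coe_finsetSum]
    rw [hx, hy, Finset.sum_mul_sum]
  rw [hxy, hx', hy', map_sum, map_sum, map_sum, Finset.sum_mul_sum]
  refine Finset.sum_congr rfl fun i _ => ?_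
  rw [map_sum]
  exact Finset.sum_congr rfl fun j _ => key (hb i) (hc j)

/-- Surjectivity reduces to this case because A₀(𝒞) is spanned by functions on bisections; no
restriction on the elements of S is needed, so they range over all of S. -/
theorem exists_toA0_of_mem_CcOn {U : Set θ.Germ} (hU : θ.germCategory.IsBisection U)
    {f : θ.Germ → ℂ} (hf : f ∈ CcOn U) : ∃ x, (θ.toA0 x : θ.Germ → ℂ) = f := by
  obtain ⟨g, n, s, ξ, -, -, hξ, -, rfl⟩ := θ.exists_sum_germFun hU hf (I := Set.univ)
    fun z _ => by simpa using θ.exists_germSet z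
  have hb : ∀ k, ξ k * (ξ k * g) ∈ ccSubmodule (θ (s k)).source := fun k => by
    refine mul_mem_ccSubmodule_right (ccSubmodule_mono ?_ (hξ k)) _
    rw [← image_src_germSet]
    exact Set.image_mono Set.inter_subset_right
  refine ⟨∑ k, ⟨_, delta_mem (hb k)⟩, ?_⟩
  rw [coe_toA0, AddSubmonoidClass.coe_finsetSum, map_sum]
  exact Finset.sum_congr rfl fun k _ =>
    toGermFun_delta _ (mem_C0On_of_mem_ccSubmodule (hb k))

theorem surjective_toA0 : Function.Surjective θ.toA0 := by
  rw [← LinearMap.range_eq_top, eq_top_iff]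
  rintro ⟨f, hf⟩ -
  suffices h : θ.germCategory.A0 ≤ (LinearMap.range θ.toA0).map θ.germCategory.A0.subtype by
    obtain ⟨x, hx, hxf⟩ := h hf
    have h' : x = ⟨f, hf⟩ := Subtype.ext hxf
    rwa [← h']
  nth_rw 1 [EtaleCategory.A0_eq_span]
  refine Submodule.span_le.2 ?_
  rintro f ⟨U, hU, hf⟩
  obtain ⟨x, rfl⟩ := exists_toA0_of_mem_CcOn hU hf
  exact ⟨θ.toA0 x, ⟨x, rfl⟩, rfl⟩

end EtaleAction

/-! ### Estimates for the integrated form of a covariant pair. -/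

namespace CStarEtaleAction.IsCovariantPair

variable {S : Type u} [RestrictionSemigroup S] {X : Type v} [TopologicalSpace X]
variable [LocallyCompactSpace X] [T2Space X] {θ : EtaleAction S X}
variable {H : Type w} [NormedAddCommGroup H] [InnerProductSpace ℂ H] [CompleteSpace H]
variable {π : C₀(X, ℂ) →⋆ₙₐ[ℂ] (H →L[ℂ] H)} {σ : S → H →L[ℂ] H}

/-- By the range condition π(a)H lies in the range of σ_e, on which the idempotent σ_e acts as the
identity. -/
theorem proj_mul_apply (h : θ.inducedAction.IsCovariantPair π σ) {e : S}
    (he : e ∈ (proj : Set S)) {a : C₀(X, ℂ)} (ha : a ∈ C0On (θ e).source) :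
    σ e * π a = π a := by
  ext k
  have h1 : π a k ∈ Set.range (σ e) := by
    rw [← h.range_proj e he]
    exact subset_closure (Submodule.subset_span ⟨a, ha, k, rfl⟩)
  obtain ⟨v, hv⟩ := h1
  rw [mul_apply_eq_comp, ← hv, ← mul_apply_eq_comp, h.isRep.sq_proj e he]

theorem apply_mul_proj (h : θ.inducedAction.IsCovariantPair π σ) {e : S}
    (he : e ∈ (proj : Set S)) {a : C₀(X, ℂ)} (ha : a ∈ C0On (θ e).source) :
    π a * σ e = π a := by
  have h1 := h.proj_mul_apply he ((isClosedIdeal_C0On _).star_mem a ha)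
  have h2 := congrArg star h1
  rwa [star_mul, map_star, star_star, ContinuousLinearMap.star_eq_adjoint,
    h.isRep.adjoint_proj e he] at h2

/-- Insert σ_f in front of π(a): σ_s π(a) = σ_{sf} π(a). Thus σ_s π(a) depends only on the germs of
s over the support of a. -/
theorem mul_apply_congr (h : θ.inducedAction.IsCovariantPair π σ) {s t f : S}
    (hf : f ∈ (proj : Set S)) (hst : s * f = t * f) {a : C₀(X, ℂ)}
    (ha : a ∈ C0On (θ f).source) : σ s * π a = σ t * π a := by
  rw [← h.proj_mul_apply hf ha, ← mul_assoc, ← mul_assoc, ← h.isRep.map_mul, ← h.isRep.map_mul,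
    hst]

/-- With the coefficient moved by covariance to the right of σ_s, it is indexed by sources of germs,
as in the function b ∘ 𝐝, and relations sf = tf can be applied. -/
theorem integrated_delta (h : θ.inducedAction.IsCovariantPair π σ) {s : S} {b : C₀(X, ℂ)}
    (hb : b ∈ C0On (θ s).source) :
    θ.inducedAction.integrated π σ (θ.delta s b) = σ s * π b := by
  rw [EtaleAction.delta, CStarEtaleAction.integrated_single]
  exact h.covariant s b hb

/-- Near each point, finitely many elements of `S` can be replaced by representatives of their
germs at the point. -/
theorem exists_representatives {n : ℕ} {s : Fin n → S} {b : Fin n → C₀(X, ℂ)}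
    (hb : ∀ i, b i ∈ C0On (θ (s i)).source) (h0 : ∑ i, θ.germFun (s i) (b i) = 0) {ε : ℝ}
    (hε : 0 < ε) (x : X) : ∃ (V : Set X) (r : Fin n → Fin n), IsOpen V ∧ x ∈ V ∧
      (∀ i, ∃ f ∈ (proj : Set S), V ⊆ (θ f).source ∧ s i * f = s (r i) * f) ∧
      ∀ y ∈ V, ∀ j, ‖∑ i with r i = j, b i y‖ ≤ ε := by
  classical
  -- Indices are classified by their germ at x. An index whose element is not defined at x gets a
  -- label of its own, so that it forms a class by itself.
  let γ : Fin n → θ.Germ ⊕ Fin n := fun i =>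
    if hx : x ∈ (θ (s i)).source then Sum.inl (θ.germ (s i) x hx) else Sum.inr i
  have hγ1 : ∀ i (hx : x ∈ (θ (s i)).source), γ i = Sum.inl (θ.germ (s i) x hx) :=
    fun i hx => dif_pos hx
  have hγ2 : ∀ i, x ∉ (θ (s i)).source → γ i = Sum.inr i := fun i hx => dif_neg hx
  -- A chosen representative of the class of i. The index i itself witnesses that `Fin n` is
  -- non-empty, so n = 0 needs no separate treatment.
  let r : Fin n → Fin n := fun i => @Function.invFun _ _ ⟨i⟩ γ (γ i)
  have hr : ∀ i, γ (r i) = γ i := fun i => @Function.invFun_eq _ _ ⟨i⟩ γ _ ⟨i, rfl⟩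
  have hrr : ∀ i j, r i = r j ↔ γ i = γ j := fun i j =>
    ⟨fun h => by rw [← hr i, h, hr], fun h => by simp only [r, h]⟩
  have hf : ∀ i, ∃ f ∈ (proj : Set S), x ∈ (θ f).source ∧ s i * f = s (r i) * f := by
    intro i
    by_cases hx : x ∈ (θ (s i)).source
    · by_cases hx' : x ∈ (θ (s (r i))).source
      · have h1 := hr i
        rw [hγ1 _ hx, hγ1 _ hx'] at h1
        obtain ⟨-, f, hf, hxf, he⟩ := EtaleAction.germ_eq_iff.1 (Sum.inl_injective h1)
        exact ⟨f, hf, hxf, he.symm⟩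
      · have h1 := hr i
        rw [hγ1 _ hx, hγ2 _ hx'] at h1
        exact absurd h1 (by simp)
    · have h1 : r i = i := by
        by_cases hx' : x ∈ (θ (s (r i))).source
        · have h1 := hr i
          rw [hγ2 _ hx, hγ1 _ hx'] at h1
          exact absurd h1 (by simp)
        · have h1 := hr i
          rw [hγ2 _ hx, hγ2 _ hx'] at h1
          exact Sum.inr_injective h1
      obtain ⟨f, hf, hxf⟩ := θ.cover x
      exact ⟨f, hf, hxf, by rw [h1]⟩
  -- The sum over a class of germs is the value of the zero function ∑ b_i ∘ 𝐝 at that germ. The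
  -- members of a class undefined at x have b_i(x) = 0.
  have hsum : ∀ j, ∑ i with r i = j, b i x = 0 := by
    intro j
    by_cases hj : ∃ i₀, r i₀ = j
    · obtain ⟨i₀, rfl⟩ := hj
      rw [Finset.sum_filter, Finset.sum_congr rfl fun i _ => if_congr (hrr i i₀) rfl rfl]
      by_cases hx : x ∈ (θ (s i₀)).source
      · have h1 := congrFun h0 (θ.germ (s i₀) x hx)
        rw [Finset.sum_apply] at h1
        refine Eq.trans (Finset.sum_congr rfl fun i _ => ?_) h1
        by_cases hxi : x ∈ (θ (s i)).source
        · rw [hγ1 _ hx, hγ1 _ hxi]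
          by_cases he : θ.germ (s i) x hxi = θ.germ (s i₀) x hx
          · rw [if_pos (congrArg _ he), ← he, EtaleAction.germFun_germ]
          · rw [if_neg fun h => he (Sum.inl_injective h)]
            refine (EtaleCategory.pull_of_notMem _ ?_).symm
            rintro ⟨y, hy, -, hyx⟩
            obtain ⟨rfl, -⟩ := EtaleAction.germ_eq_iff.1 hyx
            exact he hyx.symm
        · rw [hb i x hxi, ite_self]
          refine (EtaleCategory.pull_of_notMem _ ?_).symm
          rintro ⟨y, hy, -, hyx⟩
          obtain ⟨rfl, -⟩ := EtaleAction.germ_eq_iff.1 hyx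
          exact hxi hy
      · refine Finset.sum_eq_zero fun i _ => ?_
        by_cases hxi : x ∈ (θ (s i)).source
        · rw [hγ2 _ hx, hγ1 _ hxi, if_neg (by simp)]
        · rw [hb i x hxi, ite_self]
    · refine Finset.sum_eq_zero fun i hi => ?_
      exact absurd ⟨i, (Finset.mem_filter.1 hi).2⟩ hj
  choose f hf hxf hfs using hf
  have hcont : ∀ j, Continuous fun y => ‖∑ i with r i = j, b i y‖ := fun j =>
    (continuous_finsetSum _ fun i _ => map_continuous (b i)).norm
  -- Finitely many open conditions hold at x: the projections f_i that identify the germs are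
  -- defined, and the class sums, which are continuous and vanish at x, are smaller than ε.
  refine ⟨(⋂ i, (θ (f i)).source) ∩ ⋂ j, {y | ‖∑ i with r i = j, b i y‖ < ε}, r,
    (isOpen_iInter_of_finite fun i => θ.isOpen_source _).inter
      (isOpen_iInter_of_finite fun j => isOpen_lt (hcont j) continuous_const),
    ⟨Set.mem_iInter.2 hxf, Set.mem_iInter.2 fun j => ?_⟩, fun i => ⟨f i, hf i, ?_, hfs i⟩, ?_⟩
  · change ‖∑ i with r i = j, b i x‖ < ε
    rwa [hsum, norm_zero]
  · exact fun y hy => Set.mem_iInter.1 hy.1 i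
  · exact fun y hy j => le_of_lt (Set.mem_iInter.1 hy.2 j)

/-- Local replacement by germ representatives, glued by a partition of unity, rewrites the operator
with the same n elements of S but with coefficients of norm at most ε. The number of pieces of the
partition, which depends on ε, does not enter the bound. -/
theorem norm_sum_le (h : θ.inducedAction.IsCovariantPair π σ) {n : ℕ} {s : Fin n → S}
    {b : Fin n → C₀(X, ℂ)} (hb : ∀ i, b i ∈ ccSubmodule (θ (s i)).source)
    (h0 : ∑ i, θ.germFun (s i) (b i) = 0) {ε : ℝ} (hε : 0 < ε) :
    ‖∑ i, σ (s i) * π (b i)‖ ≤ n * ε := by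
  have hb0 := fun i => mem_C0On_of_mem_ccSubmodule (hb i)
  choose V r hV hxV hf hr using exists_representatives hb0 h0 hε
  choose K hKU hK hbK using hb
  obtain ⟨m, j, ξ, hξ, hξ1, hξK⟩ := exists_sq_partition hV (isCompact_iUnion hK)
    fun x _ => Set.mem_iUnion.2 ⟨x, hxV x⟩
  have e1 : ∀ i, b i = ∑ k, ξ k * ξ k * b i := by
    intro i
    ext x
    rw [ZeroAtInftyContinuousMap.sum_apply]
    change b i x = ∑ k, ξ k x * ξ k x * b i x
    rw [← Finset.sum_mul]
    by_cases hx : x ∈ ⋃ i, K i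
    · rw [hξK x hx, one_mul]
    · rw [hbK i x fun h => hx (Set.mem_iUnion.2 ⟨i, h⟩), mul_zero]
  -- The coefficient collected at s_l: on the k-th patch, those b_i whose element has s_l as its
  -- chosen representative.
  let c : Fin n → C₀(X, ℂ) := fun l => ∑ k, ∑ i with r (j k) i = l, ξ k * ξ k * b i
  have e2 : ∀ i k, σ (s i) * π (ξ k * ξ k * b i) = σ (s (r (j k) i)) * π (ξ k * ξ k * b i) := by
    intro i k
    obtain ⟨f, hf, hVf, hs⟩ := hf (j k) i
    refine h.mul_apply_congr hf hs ?_
    refine mem_C0On_of_mem_ccSubmodule (ccSubmodule_mono hVf ?_)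
    exact mul_mem_ccSubmodule_right (mul_mem_ccSubmodule_left _ (hξ k)) _
  have e3 : ∑ i, σ (s i) * π (b i) = ∑ l, σ (s l) * π (c l) := by
    calc ∑ i, σ (s i) * π (b i) = ∑ i, ∑ k, σ (s i) * π (ξ k * ξ k * b i) := by
          refine Finset.sum_congr rfl fun i _ => ?_
          conv_lhs => rw [e1 i]
          rw [map_sum, Finset.mul_sum]
      _ = ∑ k, ∑ i, σ (s (r (j k) i)) * π (ξ k * ξ k * b i) := by
          rw [Finset.sum_comm]
          exact Finset.sum_congr rfl fun k _ => Finset.sum_congr rfl fun i _ => e2 i k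
      _ = ∑ k, ∑ l, ∑ i with r (j k) i = l, σ (s l) * π (ξ k * ξ k * b i) := by
          refine Finset.sum_congr rfl fun k _ => ?_
          rw [← Finset.sum_fiberwise_of_maps_to (g := r (j k)) (t := Finset.univ)
            fun _ _ => Finset.mem_univ _]
          refine Finset.sum_congr rfl fun l _ => Finset.sum_congr rfl fun i hi => ?_
          rw [(Finset.mem_filter.1 hi).2]
      _ = ∑ l, σ (s l) * π (c l) := by
          rw [Finset.sum_comm]
          refine Finset.sum_congr rfl fun l _ => ?_
          rw [map_sum, Finset.mul_sum]
          refine Finset.sum_congr rfl fun k _ => ?_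
          rw [map_sum, Finset.mul_sum]
  -- At each point c_l is a combination, with weights ξ_k² whose moduli add up to at most 1, of
  -- class sums that are at most ε on the k-th patch.
  have e4 : ∀ l, ‖c l‖ ≤ ε := by
    intro l
    refine ZeroAtInftyContinuousMap.norm_le_of_forall hε.le fun x => ?_
    have h1 : c l x = ∑ k, ξ k x * ξ k x * ∑ i with r (j k) i = l, b i x := by
      rw [ZeroAtInftyContinuousMap.sum_apply]
      refine Finset.sum_congr rfl fun k _ => ?_
      rw [ZeroAtInftyContinuousMap.sum_apply, Finset.mul_sum]
      rfl
    rw [h1]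
    calc _ ≤ ∑ k, ‖ξ k x * ξ k x * ∑ i with r (j k) i = l, b i x‖ := _root_.norm_sum_le _ _
      _ ≤ ∑ k, ‖ξ k x‖ ^ 2 * ε := by
          refine Finset.sum_le_sum fun k _ => ?_
          rw [norm_mul, norm_mul, ← sq]
          by_cases hx : x ∈ V (j k)
          · exact mul_le_mul_of_nonneg_left (hr (j k) x hx l) (sq_nonneg _)
          · rw [mem_C0On_of_mem_ccSubmodule (hξ k) x hx, norm_zero]
            simp
      _ ≤ 1 * ε := by
          rw [← Finset.sum_mul]
          exact mul_le_mul_of_nonneg_right (hξ1 x) hε.le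
      _ = ε := one_mul ε
  rw [e3]
  calc ‖∑ l, σ (s l) * π (c l)‖ ≤ ∑ l : Fin n, ‖σ (s l) * π (c l)‖ := _root_.norm_sum_le _ _
    _ ≤ ∑ l : Fin n, ε := by
        refine Finset.sum_le_sum fun l _ => (norm_mul_le _ _).trans ?_
        calc ‖σ (s l)‖ * ‖π (c l)‖ ≤ 1 * ‖c l‖ := mul_le_mul (h.isRep.norm_le _)
              (NonUnitalStarAlgHom.norm_apply_le π _) (norm_nonneg _) zero_le_one
          _ ≤ ε := by rw [one_mul]; exact e4 l
    _ = n * ε := by simp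

/-- The integrated form of a covariant pair factors through functions on germs. -/
theorem integrated_eq_zero (h : θ.inducedAction.IsCovariantPair π σ)
    {x : θ.inducedAction.FormalSums} (hx : x ∈ θ.compactFormalSums) (h0 : θ.toGermFun x = 0) :
    θ.inducedAction.integrated π σ x = 0 := by
  obtain ⟨n, s, b, hb, rfl⟩ := EtaleAction.exists_eq_sum_delta hx
  have hb0 := fun i => mem_C0On_of_mem_ccSubmodule (hb i)
  rw [map_sum, Finset.sum_congr rfl fun i _ => h.integrated_delta (hb0 i)]
  rw [map_sum, Finset.sum_congr rfl fun i _ => θ.toGermFun_delta (hb0 i)] at h0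
  rw [← norm_le_zero_iff]
  refine le_of_forall_pos_le_add fun ε hε => ?_
  -- Dividing ε by n + 1 rather than by n covers the empty sum.
  have hn : (0 : ℝ) < n + 1 := by positivity
  refine (h.norm_sum_le hb h0 (div_pos hε hn)).trans ?_
  rw [zero_add, mul_div_assoc', div_le_iff₀ hn]
  nlinarith

/-- The estimate which makes the representation of `A₀(𝒞)` contractive on bisections. -/
theorem norm_sum_le_of_isBisection (h : θ.inducedAction.IsCovariantPair π σ) {U : Set θ.Germ}
    (hU : θ.germCategory.IsBisection U) {n : ℕ} {s : Fin n → S} {ξ : Fin n → C₀(X, ℂ)}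
    (hξ : ∀ k, ξ k ∈ ccSubmodule (θ.germCategory.src '' (U ∩ θ.germSet (s k) Set.univ)))
    (hξ1 : ∀ x, ∑ k, ‖ξ k x‖ ^ 2 ≤ 1) (g : C₀(X, ℂ)) :
    ‖∑ k, σ (s k) * π (ξ k * (ξ k * g))‖ ≤ ‖g‖ := by
  classical
  have hξ0 : ∀ k, ξ k ∈ C0On (θ (s k)).source := fun k => by
    refine mem_C0On_of_mem_ccSubmodule (ccSubmodule_mono ?_ (hξ k))
    rw [← EtaleAction.image_src_germSet]
    exact Set.image_mono Set.inter_subset_right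
  have hgerm : ∀ k x (hx : x ∈ (θ (s k)).source), ξ k x ≠ 0 → θ.germ (s k) x hx ∈ U := by
    intro k x hx hne
    by_contra hU'
    refine hne (mem_C0On_of_mem_ccSubmodule (hξ k) x ?_)
    rintro ⟨z, ⟨hzU, y, hy, -, rfl⟩, rfl⟩
    exact hU' hzU
  -- A non-zero term at y comes from a germ in U with range y. The range map is injective on U, so
  -- all these germs are equal and have one source x₀, and the sum is bounded by ∑ |ξ_k(x₀)|².
  have hrow : ∀ y, ∑ k, ‖θ.inducedAction (s k) (ξ k) y‖ ^ 2 ≤ 1 := by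
    intro y
    by_cases hy : ∃ k, ∃ x ∈ (θ (s k)).source, θ (s k) x = y ∧ ξ k x ≠ 0
    · obtain ⟨k₀, x₀, hx₀, hxy₀, hne₀⟩ := hy
      refine le_trans (Finset.sum_le_sum fun k _ => ?_) (hξ1 x₀)
      by_cases hk : θ.inducedAction (s k) (ξ k) y = 0
      · rw [hk, norm_zero]
        simp only [ne_eq, OfNat.ofNat_ne_zero, not_false_eq_true, zero_pow]
        exact sq_nonneg _
      · have hyt : y ∈ (θ (s k)).target := by
          by_contra hyt
          exact hk (pushC0_mem (θ.homeo (s k)) (ξ k) y hyt)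
        have hxs := (θ (s k)).map_target hyt
        have hxy := (θ (s k)).right_inv hyt
        have h1 : θ.inducedAction (s k) (ξ k) y = ξ k ((θ (s k)).symm y) := by
          have := pushC0_apply (θ.homeo (s k)) (hξ0 k) hxs
          rwa [show θ.homeo (s k) ((θ (s k)).symm y) = y from hxy] at this
        rw [h1] at hk ⊢
        have h2 := hU.injOn_tgt (hgerm k _ hxs hk) (hgerm k₀ x₀ hx₀ hne₀) (hxy.trans hxy₀.symm)
        rw [(EtaleAction.germ_eq_iff.1 h2).1]
    · refine le_trans (le_of_eq (Finset.sum_eq_zero fun k _ => ?_)) zero_le_one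
      have hk : θ.inducedAction (s k) (ξ k) y = 0 := by
        by_cases hyt : y ∈ (θ (s k)).target
        · have hxs := (θ (s k)).map_target hyt
          have hxy := (θ (s k)).right_inv hyt
          have := pushC0_apply (θ.homeo (s k)) (hξ0 k) hxs
          rw [show θ.homeo (s k) ((θ (s k)).symm y) = y from hxy] at this
          refine this.trans ?_
          by_contra hne
          exact hy ⟨k, _, hxs, hxy, hne⟩
        · exact pushC0_mem (θ.homeo (s k)) (ξ k) y hyt
      rw [hk, norm_zero]
      simp
  refine ContinuousLinearMap.opNorm_le_bound _ (norm_nonneg _) fun v => ?_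
  -- One factor ξ_k crosses σ by covariance and forms the row; the factor ξ_k g stays on the right
  -- and forms the column.
  have e1 : (∑ k, σ (s k) * π (ξ k * (ξ k * g))) v =
      ∑ k, π (θ.inducedAction (s k) (ξ k)) (σ (s k) (π (ξ k * g) v)) := by
    rw [_root_.sum_apply]
    refine Finset.sum_congr rfl fun k _ => ?_
    rw [map_mul, ← mul_assoc, ← h.covariant (s k) (ξ k) (hξ0 k)]
    rfl
  rw [e1]
  refine le_of_sq_le_sq ?_ (by positivity)
  calc _ ≤ ∑ k, ‖σ (s k) (π (ξ k * g) v)‖ ^ 2 := norm_sum_apply_le π _ hrow _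
    _ ≤ ∑ k, ‖π (ξ k * g) v‖ ^ 2 := by
        refine Finset.sum_le_sum fun k _ => pow_le_pow_left₀ (norm_nonneg _) ?_ 2
        exact ((σ (s k)).le_of_opNorm_le (h.isRep.norm_le _) _).trans_eq (one_mul _)
    _ ≤ ‖g‖ ^ 2 * ‖v‖ ^ 2 := by
        refine sum_sq_norm_le π _ (sq_nonneg _) (fun x => ?_) v
        calc ∑ k, ‖(ξ k * g) x‖ ^ 2 = (∑ k, ‖ξ k x‖ ^ 2) * ‖g x‖ ^ 2 := by
              rw [Finset.sum_mul]
              refine Finset.sum_congr rfl fun k _ => ?_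
              rw [ZeroAtInftyContinuousMap.mul_apply, norm_mul, mul_pow]
          _ ≤ 1 * ‖g‖ ^ 2 := mul_le_mul (hξ1 x)
              (pow_le_pow_left₀ (norm_nonneg _) (g.norm_apply_le x) 2) (sq_nonneg _) zero_le_one
          _ = ‖g‖ ^ 2 := one_mul _
    _ = (‖g‖ * ‖v‖) ^ 2 := (mul_pow _ _ _).symm

end CStarEtaleAction.IsCovariantPair

/-! ### The universal seminorms as least upper bounds. -/

theorem EtaleCategory.norm_le_universalSeminorm {X : Type v} {C : Type w} [TopologicalSpace X]
    [TopologicalSpace C] (𝒞 : EtaleCategory X C) {H : Type w} [NormedAddCommGroup H]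
    [InnerProductSpace ℂ H] [CompleteSpace H] {ω : 𝒞.A0 →ₙₐ[ℂ] (H →L[ℂ] H)}
    (hω : 𝒞.IsRepresentation ω) (f : 𝒞.A0) : ‖ω f‖ ≤ 𝒞.universalSeminorm.toSeminorm f :=
  (le_csSup 𝒞.bddAbove_repSeminorms (show
    (normSeminorm ℂ (H →L[ℂ] H)).comp (ω : 𝒞.A0 →ₗ[ℂ] (H →L[ℂ] H)) ∈ 𝒞.repSeminorms from
    ⟨H, _, _, _, ω, hω, fun _ => rfl⟩) :) f

theorem EtaleCategory.universalSeminorm_le {X : Type v} {C : Type w} [TopologicalSpace X]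
    [TopologicalSpace C] (𝒞 : EtaleCategory X C) {f : 𝒞.A0} {M : ℝ} (hM : 0 ≤ M)
    (h : ∀ (H : Type w) [NormedAddCommGroup H] [InnerProductSpace ℂ H] [CompleteSpace H]
      (ω : 𝒞.A0 →ₙₐ[ℂ] (H →L[ℂ] H)), 𝒞.IsRepresentation ω → ‖ω f‖ ≤ M) :
    𝒞.universalSeminorm.toSeminorm f ≤ M := by
  change sSup 𝒞.repSeminorms f ≤ M
  rw [Seminorm.sSup_apply 𝒞.bddAbove_repSeminorms]
  -- With 0 ≤ M the bound does not require the family of representations to be non-empty.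
  refine Real.iSup_le ?_ hM
  rintro ⟨p, H, _, _, _, ω, hω, hp⟩
  exact (hp f).trans_le (h H ω hω)

namespace CStarEtaleAction

variable {S : Type u} [RestrictionSemigroup S] {A : Type v} [NonUnitalCStarAlgebra A]
variable (α : CStarEtaleAction S A)

theorem norm_le_universalSeminorm {H : Type (max u v)} [NormedAddCommGroup H]
    [InnerProductSpace ℂ H] [CompleteSpace H] {π : A →⋆ₙₐ[ℂ] (H →L[ℂ] H)} {σ : S → H →L[ℂ] H}
    (h : α.IsCovariantPair π σ) (x : α.FormalSums) :
    ‖α.integrated π σ x‖ ≤ α.universalSeminorm.toSeminorm x :=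
  (le_csSup α.bddAbove_covSeminorms (show
    (normSeminorm ℂ (H →L[ℂ] H)).comp (α.integrated π σ) ∈ α.covSeminorms from
    ⟨H, _, _, _, π, σ, h, fun _ => rfl⟩) :) x

theorem universalSeminorm_le {x : α.FormalSums} {M : ℝ} (hM : 0 ≤ M)
    (h : ∀ (H : Type (max u v)) [NormedAddCommGroup H] [InnerProductSpace ℂ H] [CompleteSpace H]
      (π : A →⋆ₙₐ[ℂ] (H →L[ℂ] H)) (σ : S → H →L[ℂ] H), α.IsCovariantPair π σ →
        ‖α.integrated π σ x‖ ≤ M) :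
    α.universalSeminorm.toSeminorm x ≤ M := by
  change sSup α.covSeminorms x ≤ M
  rw [Seminorm.sSup_apply α.bddAbove_covSeminorms]
  refine Real.iSup_le ?_ hM
  rintro ⟨p, H, _, _, _, π, σ, hπσ, hp⟩
  exact (hp x).trans_le (h H π σ hπσ)

theorem universalSeminorm_single_le (s : S) (a : α.ranIdeal s) :
    α.universalSeminorm.toSeminorm (α.single s a) ≤ ‖(a : A)‖ := by
  refine α.universalSeminorm_le (norm_nonneg _) fun H _ _ _ π σ h => ?_
  rw [integrated_single]
  calc ‖π a * σ s‖ ≤ ‖π a‖ * ‖σ s‖ := norm_mul_le _ _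
    _ ≤ ‖(a : A)‖ * 1 := mul_le_mul (NonUnitalStarAlgHom.norm_apply_le π _)
        (h.isRep.norm_le s) (norm_nonneg _) (norm_nonneg _)
    _ = ‖(a : A)‖ := mul_one _

end CStarEtaleAction

/-! ### Density of the compactly supported formal sums. -/

namespace EtaleAction

variable {S : Type u} [RestrictionSemigroup S] {X : Type v} [TopologicalSpace X]
variable [LocallyCompactSpace X] [T2Space X] {θ : EtaleAction S X}

/-- The universal seminorm of aδ_s is at most ‖a‖, so approximating a ∈ C₀(D_{ρ(s)}) in norm by
functions compactly supported in D_{ρ(s)} suffices. -/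
theorem denseRange_compactFormalSums : DenseRange fun x : θ.compactFormalSums =>
    AlgebraSeminorm.HausdorffCompletion.coe θ.inducedAction.universalSeminorm
      (x : θ.inducedAction.FormalSums) := by
  let q := θ.inducedAction.universalSeminorm
  let L : θ.compactFormalSums →ₗ[ℂ] q.HausdorffCompletion :=
    AlgebraSeminorm.HausdorffCompletion.coeₗ q ∘ₗ θ.compactFormalSums.subtype
  have key : ∀ x, AlgebraSeminorm.HausdorffCompletion.coe q x ∈
      (LinearMap.range L).topologicalClosure := by
    intro x
    refine θ.inducedAction.formalSums_ind (P := fun x =>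
      AlgebraSeminorm.HausdorffCompletion.coe q x ∈ (LinearMap.range L).topologicalClosure) x
      ?_ (fun s a => ?_) (fun x y hx hy => ?_)
    · rw [AlgebraSeminorm.HausdorffCompletion.coe_zero]
      exact Submodule.zero_mem _
    · rw [← SetLike.mem_coe, Submodule.topologicalClosure_coe, Metric.mem_closure_iff]
      intro ε hε
      have ha := θ.inducedAction.mem_ranIdeal_iff.1 a.2
      obtain ⟨c, hc, hac⟩ := Metric.mem_closure_iff.1
        (C0On_subset_closure (θ.isOpen_target s) ha) ε hε
      have hc0 : c ∈ C0On (θ s).target := mem_C0On_of_mem_ccSubmodule hc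
      have hc' : c ∈ θ.inducedAction.ranIdeal s := θ.inducedAction.mem_ranIdeal_iff.2 hc0
      have hd : θ.inducedAction.single s ⟨c, hc'⟩ ∈ θ.compactFormalSums := by
        have h1 : pushC0 (θ.homeo s).symm c ∈ ccSubmodule (θ s).source := by
          refine ccSubmodule_mono ?_ (pushC0_mem_ccSubmodule (θ.homeo s).symm subset_rfl hc)
          rintro _ ⟨y, hy, rfl⟩
          exact (θ s).map_target hy
        have h2 : θ.delta s (pushC0 (θ.homeo s).symm c) = θ.inducedAction.single s ⟨c, hc'⟩ :=
          congrArg _ (Subtype.ext ((θ.inducedAction s).right_inv hc0))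
        rw [← h2]
        exact delta_mem h1
      refine ⟨_, ⟨⟨_, hd⟩, rfl⟩, ?_⟩
      rw [dist_eq_norm] at hac ⊢
      change ‖AlgebraSeminorm.HausdorffCompletion.coeₗ q (θ.inducedAction.single s a) -
        AlgebraSeminorm.HausdorffCompletion.coeₗ q (θ.inducedAction.single s ⟨c, hc'⟩)‖ < ε
      rw [← map_sub, ← map_sub]
      refine lt_of_le_of_lt ?_ hac
      exact (AlgebraSeminorm.HausdorffCompletion.norm_coe q _).trans_le
        (θ.inducedAction.universalSeminorm_single_le s _)
    · rw [AlgebraSeminorm.HausdorffCompletion.coe_add]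
      exact Submodule.add_mem _ hx hy
  intro y
  have h := (AlgebraSeminorm.HausdorffCompletion.denseRange_coe q) y
  refine closure_minimal ?_ isClosed_closure h
  rintro _ ⟨x, rfl⟩
  have := key x
  rwa [← SetLike.mem_coe, Submodule.topologicalClosure_coe] at this

end EtaleAction

/-! ### The representation of A₀(𝒞) attached to a covariant pair. -/

namespace CStarEtaleAction.IsCovariantPair

variable {S : Type u} [RestrictionSemigroup S] {X : Type v} [TopologicalSpace X]
variable [LocallyCompactSpace X] [T2Space X] {θ : EtaleAction S X}
variable {H : Type (max u v)} [NormedAddCommGroup H] [InnerProductSpace ℂ H] [CompleteSpace H]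
variable {π : C₀(X, ℂ) →⋆ₙₐ[ℂ] (H →L[ℂ] H)} {σ : S → H →L[ℂ] H}

theorem integrated_congr (h : θ.inducedAction.IsCovariantPair π σ) {x y : θ.compactFormalSums}
    (hxy : θ.toA0 x = θ.toA0 y) :
    θ.inducedAction.integrated π σ x = θ.inducedAction.integrated π σ y := by
  rw [← sub_eq_zero, ← map_sub]
  refine h.integrated_eq_zero (x - y).2 ?_
  rw [map_sub, sub_eq_zero]
  exact congrArg Subtype.val hxy

/-- The representation of `A₀(𝒞)` which corresponds to a covariant pair. -/
noncomputable def toRep (h : θ.inducedAction.IsCovariantPair π σ) :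
    θ.germCategory.A0 →ₙₐ[ℂ] (H →L[ℂ] H) :=
  have hs := EtaleAction.surjective_toA0 (θ := θ)
  -- The value does not depend on the preimage, because the integrated form vanishes on the kernel
  -- of `toA0`.
  have key : ∀ x, θ.inducedAction.integrated π σ (Function.surjInv hs (θ.toA0 x) : θ.compactFormalSums) =
      θ.inducedAction.integrated π σ x :=
    fun x => h.integrated_congr (Function.surjInv_eq hs _)
  { toFun := fun f => θ.inducedAction.integrated π σ (Function.surjInv hs f : θ.compactFormalSums)
    map_smul' := fun c f => by
      obtain ⟨x, rfl⟩ := hs f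
      rw [← map_smul, key, key, Submodule.coe_smul, map_smul]
      rfl
    map_zero' := by rw [← map_zero θ.toA0, key, Submodule.coe_zero, map_zero]
    map_add' := fun f g => by
      obtain ⟨x, rfl⟩ := hs f
      obtain ⟨y, rfl⟩ := hs g
      rw [← map_add, key, key, key, Submodule.coe_add, map_add]
    map_mul' := fun f g => by
      obtain ⟨x, rfl⟩ := hs f
      obtain ⟨y, rfl⟩ := hs g
      rw [← EtaleAction.toA0_mul, key, key, key, h.integrated_mul] }

theorem toRep_toA0 (h : θ.inducedAction.IsCovariantPair π σ) (x : θ.compactFormalSums) :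
    h.toRep (θ.toA0 x) = θ.inducedAction.integrated π σ x :=
  h.integrated_congr (Function.surjInv_eq EtaleAction.surjective_toA0 _)

/-- Any decomposition of f computes the operator, so one may choose the decomposition adapted to a
bisection or to the unit space. -/
theorem toRep_eq_sum (h : θ.inducedAction.IsCovariantPair π σ) {f : θ.germCategory.A0} {n : ℕ}
    {s : Fin n → S} {b : Fin n → C₀(X, ℂ)} (hb : ∀ k, b k ∈ ccSubmodule (θ (s k)).source)
    (hf : (f : θ.Germ → ℂ) = ∑ k, θ.germFun (s k) (b k)) :
    h.toRep f = ∑ k, σ (s k) * π (b k) := by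
  have hx : f = θ.toA0 ⟨∑ k, θ.delta (s k) (b k),
      Submodule.sum_mem _ fun k _ => EtaleAction.delta_mem (hb k)⟩ := by
    refine Subtype.ext ?_
    rw [EtaleAction.coe_toA0, hf, map_sum]
    exact Finset.sum_congr rfl fun k _ =>
      (θ.toGermFun_delta (mem_C0On_of_mem_ccSubmodule (hb k))).symm
  rw [hx, toRep_toA0, map_sum]
  exact Finset.sum_congr rfl fun k _ => h.integrated_delta (mem_C0On_of_mem_ccSubmodule (hb k))

theorem isRepresentation_toRep (h : θ.inducedAction.IsCovariantPair π σ) :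
    θ.germCategory.IsRepresentation h.toRep where
  norm_le U hU f hf := by
    obtain ⟨g, n, s, ξ, hg, -, hξ, hξ1, hfs⟩ := θ.exists_sum_germFun hU hf (I := Set.univ)
      fun z _ => by simpa using θ.exists_germSet z
    have hb : ∀ k, ξ k * (ξ k * g) ∈ ccSubmodule (θ (s k)).source := fun k => by
      refine mul_mem_ccSubmodule_right (ccSubmodule_mono ?_ (hξ k)) _
      rw [← EtaleAction.image_src_germSet]
      exact Set.image_mono Set.inter_subset_right
    rw [h.toRep_eq_sum hb hfs]
    exact (h.norm_sum_le_of_isBisection hU hξ hξ1 g).trans hg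
  map_conj f f' hf hf' := by
    -- On the unit space the pieces can be indexed by projections e, for which σ_e π(b) = π(b);
    -- adjoints are then preserved because π is a *-homomorphism.
    obtain ⟨g, n, s, ξ, -, hs, hξ, -, hfs⟩ := θ.exists_sum_germFun θ.isBisection_range_unit hf
      (I := proj) (by
        rw [θ.range_unit]
        exact Set.iUnion_subset fun e => Set.subset_biUnion_of_mem
          (u := fun e : S => θ.germSet e Set.univ) e.2)
    have hb : ∀ k, ξ k * (ξ k * g) ∈ ccSubmodule (θ (s k)).source := fun k => by
      refine mul_mem_ccSubmodule_right (ccSubmodule_mono ?_ (hξ k)) _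
      rw [← EtaleAction.image_src_germSet]
      exact Set.image_mono Set.inter_subset_right
    have hfs' : (f' : θ.Germ → ℂ) =
        ∑ k, θ.germFun (s k) (star (ξ k * (ξ k * g)) : C₀(X, ℂ)) := by
      classical
      funext z
      rw [hf', hfs, Finset.sum_apply, Finset.sum_apply, map_sum]
      refine Finset.sum_congr rfl fun k _ => ?_
      rw [EtaleAction.germFun, EtaleAction.germFun, EtaleCategory.pull, EtaleCategory.pull,
        Set.indicator_apply, Set.indicator_apply, apply_ite (starRingEnd ℂ), map_zero]
      rfl
    have hb' := fun k => star_mem_ccSubmodule (hb k)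
    rw [h.toRep_eq_sum hb hfs, h.toRep_eq_sum hb' hfs', ← ContinuousLinearMap.star_eq_adjoint,
      star_sum]
    refine Finset.sum_congr rfl fun k _ => ?_
    rw [h.proj_mul_apply (hs k) (mem_C0On_of_mem_ccSubmodule (hb k)),
      h.proj_mul_apply (hs k) (mem_C0On_of_mem_ccSubmodule (hb' k)), map_star]

end CStarEtaleAction.IsCovariantPair

theorem EtaleAction.universalSeminorm_le_toA0 {S : Type u} [RestrictionSemigroup S] {X : Type v}
    [TopologicalSpace X] [LocallyCompactSpace X] [T2Space X] {θ : EtaleAction S X}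
    (x : θ.compactFormalSums) :
    θ.inducedAction.universalSeminorm.toSeminorm x ≤
      θ.germCategory.universalSeminorm.toSeminorm (θ.toA0 x) := by
  refine θ.inducedAction.universalSeminorm_le (apply_nonneg _ _) fun H _ _ _ π σ h => ?_
  rw [← h.toRep_toA0]
  exact θ.germCategory.norm_le_universalSeminorm h.isRepresentation_toRep _

/-! ### Limits and extensions of operators. -/

/-- A uniformly bounded net of operators which converges pointwise on a subspace and on its
orthogonal complement converges pointwise to a bounded operator. -/
theorem exists_pointwise_limit {H : Type w} [NormedAddCommGroup H] [InnerProductSpace ℂ H]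
    [CompleteSpace H] {ι : Type*} [SemilatticeSup ι] [Nonempty ι] (T : ι → H →L[ℂ] H)
    (hT : ∀ i, ‖T i‖ ≤ 1) (N : Submodule ℂ H)
    (hN : ∀ h ∈ N, ∃ l, Filter.Tendsto (fun i => T i h) Filter.atTop (nhds l))
    (hN' : ∀ h ∈ Nᗮ, ∃ l, Filter.Tendsto (fun i => T i h) Filter.atTop (nhds l)) :
    ∃ R : H →L[ℂ] H, ‖R‖ ≤ 1 ∧
      ∀ h, Filter.Tendsto (fun i => T i h) Filter.atTop (nhds (R h)) := by
  have hT' : ∀ i h, ‖T i h‖ ≤ ‖h‖ := fun i h =>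
    ((T i).le_of_opNorm_le (hT i) h).trans_eq (one_mul _)
  -- Since the T_i are uniformly contractive, pointwise convergence passes to the closure by an ε/3
  -- argument; the closure of N and the orthogonal complement of N together span H.
  have hcl : ∀ h ∈ closure (N : Set H),
      ∃ l, Filter.Tendsto (fun i => T i h) Filter.atTop (nhds l) := by
    intro h hh
    refine cauchySeq_tendsto_of_complete (Metric.cauchySeq_iff'.2 fun ε hε => ?_)
    obtain ⟨k, hk, hhk⟩ := Metric.mem_closure_iff.1 hh (ε / 3) (by positivity)
    obtain ⟨l, hl⟩ := hN k hk
    obtain ⟨m, hm⟩ := Metric.cauchySeq_iff'.1 hl.cauchySeq (ε / 3) (by positivity)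
    have h1 : ∀ i, dist (T i h) (T i k) < ε / 3 := fun i => by
      rw [dist_eq_norm, ← map_sub]
      exact (hT' i _).trans_lt (by rwa [← dist_eq_norm])
    refine ⟨m, fun i hi => ?_⟩
    calc dist (T i h) (T m h) ≤ dist (T i h) (T i k) + dist (T i k) (T m k) +
          dist (T m k) (T m h) := dist_triangle4 _ _ _ _
      _ < ε := by
          have h2 := h1 i
          have h3 := hm i hi
          have h4 := h1 m
          rw [dist_comm] at h4
          linarith
  have hall : ∀ h, ∃ l, Filter.Tendsto (fun i => T i h) Filter.atTop (nhds l) := by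
    intro h
    have hc : CompleteSpace N.topologicalClosure :=
      N.isClosed_topologicalClosure.completeSpace_coe
    have htop : h ∈ N.topologicalClosure ⊔ N.topologicalClosureᗮ := by
      rw [Submodule.sup_orthogonal_of_hasOrthogonalProjection]
      trivial
    obtain ⟨a, ha, b, hb, rfl⟩ := Submodule.mem_sup.1 htop
    rw [Submodule.orthogonal_closure] at hb
    obtain ⟨l, hl⟩ := hcl a ha
    obtain ⟨l', hl'⟩ := hN' b hb
    refine ⟨l + l', ?_⟩
    simp only [map_add]
    exact hl.add hl'
  choose R hR using hall
  let R' : H →ₗ[ℂ] H :=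
    { toFun := R
      map_add' := fun a b => by
        refine tendsto_nhds_unique (hR (a + b)) ?_
        simp only [map_add]
        exact (hR a).add (hR b)
      map_smul' := fun c a => by
        refine tendsto_nhds_unique (hR (c • a)) ?_
        simp only [map_smul]
        exact (hR a).const_smul c }
  have hbd : ∀ h, ‖R' h‖ ≤ 1 * ‖h‖ := fun h => by
    rw [one_mul]
    exact le_of_tendsto (hR h).norm (Filter.Eventually.of_forall fun i => hT' i h)
  exact ⟨R'.mkContinuous 1 hbd, R'.mkContinuous_norm_le zero_le_one hbd, hR⟩

/-- A contractive linear map on a dense subspace extends to a bounded operator. -/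
theorem exists_extension_of_denseRange {E : Type v} [NormedAddCommGroup E] [NormedSpace ℂ E]
    {F : Type w} [NormedAddCommGroup F] [NormedSpace ℂ F] [CompleteSpace F] (p : Submodule ℂ E)
    (hd : DenseRange (Subtype.val : p → E)) (f : p →ₗ[ℂ] F) (hf : ∀ b, ‖f b‖ ≤ ‖(b : E)‖) :
    ∃ P : E →L[ℂ] F, ∀ b : p, P b = f b := by
  have hn : ∃ C, ∀ b, ‖f b‖ ≤ C * ‖p.subtype b‖ := ⟨1, fun b => (hf b).trans_eq (one_mul _).symm⟩
  exact ⟨f.extendOfNorm p.subtype, LinearMap.extendOfNorm_eq (f := f) (e := p.subtype) hd hn⟩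

/-! ### From a representation of A₀(𝒞) to the operators π and σ_s. -/

namespace EtaleAction

variable {S : Type u} [RestrictionSemigroup S] {X : Type v} [TopologicalSpace X]
variable [LocallyCompactSpace X] [T2Space X] (θ : EtaleAction S X)

/-- The elements `germFun s b` of `A₀(𝒞)`. -/
noncomputable def germA0 (s : S) : ccSubmodule (θ s).source →ₗ[ℂ] θ.germCategory.A0 where
  toFun b := ⟨θ.germFun s (b : C₀(X, ℂ)), θ.germFun_mem_A0 b.2⟩
  map_add' _ _ := Subtype.ext (EtaleCategory.pull_add _ _)
  map_smul' c _ := Subtype.ext (EtaleCategory.pull_smul c _)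

/-- The inclusion of `C_c(X)` in `A₀(𝒞)`. -/
noncomputable def unitA0 : ccSubmodule (Set.univ : Set X) →ₗ[ℂ] θ.germCategory.A0 where
  toFun b := ⟨θ.germCategory.pull (Set.range θ.germCategory.unit) (b : C₀(X, ℂ)),
    θ.isBisection_range_unit.pull_mem_A0 (by
      rw [image_src_range_unit]
      exact b.2)⟩
  map_add' _ _ := Subtype.ext (EtaleCategory.pull_add _ _)
  map_smul' c _ := Subtype.ext (EtaleCategory.pull_smul c _)

variable {θ}

theorem mem_ccSubmodule_univ {U : Set X} {b : C₀(X, ℂ)} (hb : b ∈ ccSubmodule U) :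
    b ∈ ccSubmodule (Set.univ : Set X) := ccSubmodule_mono (Set.subset_univ U) hb

theorem germA0_mul_germA0 {s t : S} (b : ccSubmodule (θ s).source)
    (c : ccSubmodule (θ t).source) :
    θ.germA0 s b * θ.germA0 t c = θ.germA0 (s * t) ⟨θ.twist t b c, twist_mem b.2 c.2⟩ :=
  Subtype.ext (conv_germFun_twist (mem_C0On_of_mem_ccSubmodule c.2))

theorem unitA0_mul_unitA0 (b c : ccSubmodule (Set.univ : Set X)) :
    θ.unitA0 b * θ.unitA0 c = θ.unitA0 ⟨(b : C₀(X, ℂ)) * c, mul_mem_ccSubmodule_right b.2 _⟩ := by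
  refine Subtype.ext ?_
  refine (EtaleCategory.conv_pull θ.isBisection_range_unit θ.isBisection_range_unit
    (d := ((b : C₀(X, ℂ)) * c : C₀(X, ℂ))) ?_).trans ?_
  · rintro _ ⟨x, rfl⟩ _ ⟨y, rfl⟩ -
    rw [θ.germCategory.src_unit, θ.germCategory.tgt_unit, ZeroAtInftyContinuousMap.mul_apply]
  · rw [EtaleCategory.mulSet_range_unit_left]
    rfl

theorem germA0_mul_unitA0 {s : S} (b : ccSubmodule (θ s).source)
    (c : ccSubmodule (Set.univ : Set X)) : θ.germA0 s b * θ.unitA0 c =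
      θ.germA0 s ⟨(b : C₀(X, ℂ)) * c, mul_mem_ccSubmodule_right b.2 _⟩ := by
  refine Subtype.ext ?_
  refine (EtaleCategory.conv_pull (θ.isBisection_germSet s) θ.isBisection_range_unit
    (d := ((b : C₀(X, ℂ)) * c : C₀(X, ℂ))) ?_).trans ?_
  · rintro z _ _ ⟨y, rfl⟩ -
    rw [θ.germCategory.src_unit, θ.germCategory.tgt_unit, ZeroAtInftyContinuousMap.mul_apply]
  · rw [EtaleCategory.mulSet_range_unit_right]
    rfl

theorem unitA0_mul_germA0 {s : S} (c : ccSubmodule (Set.univ : Set X))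
    (b : ccSubmodule (θ s).source) {d : C₀(X, ℂ)} (hd : d ∈ ccSubmodule (θ s).source)
    (h : ∀ x ∈ (θ s).source, d x = (c : C₀(X, ℂ)) (θ s x) * (b : C₀(X, ℂ)) x) :
    θ.unitA0 c * θ.germA0 s b = θ.germA0 s ⟨d, hd⟩ := by
  refine Subtype.ext ?_
  refine (EtaleCategory.conv_pull θ.isBisection_range_unit (θ.isBisection_germSet s)
    (d := d) ?_).trans ?_
  · rintro z _ _ ⟨x, hx, -, rfl⟩ -
    exact h x hx
  · rw [EtaleCategory.mulSet_range_unit_left]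
    rfl

/-- The germs of a projection are units, and b vanishes at the units outside D_e. -/
theorem germA0_proj {e : S} (he : e ∈ (proj : Set S)) (b : ccSubmodule (θ e).source) :
    θ.germA0 e b = θ.unitA0 ⟨b, mem_ccSubmodule_univ b.2⟩ := by
  refine Subtype.ext ?_
  funext z
  by_cases hz : z ∈ θ.germSet e Set.univ
  · exact (EtaleCategory.pull_of_mem _ hz).trans
      (EtaleCategory.pull_of_mem _ (θ.germSet_subset_range_unit he hz)).symm
  · refine (EtaleCategory.pull_of_notMem _ hz).trans ?_
    by_cases hzu : z ∈ Set.range θ.germCategory.unit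
    · refine Eq.symm ((EtaleCategory.pull_of_mem _ hzu).trans ?_)
      obtain ⟨x, rfl⟩ := hzu
      refine mem_C0On_of_mem_ccSubmodule b.2 _ fun hx => hz ?_
      rw [θ.germCategory.src_unit] at hx
      exact ⟨x, hx, trivial, θ.germUnit_eq he hx⟩
    · exact (EtaleCategory.pull_of_notMem _ hzu).symm

section

variable {H : Type (max u v)} [NormedAddCommGroup H] [InnerProductSpace ℂ H] [CompleteSpace H]
variable {ω : θ.germCategory.A0 →ₙₐ[ℂ] (H →L[ℂ] H)}

theorem norm_pull_le (U : Set θ.Germ) (b : C₀(X, ℂ)) :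
    ⨆ z, ‖θ.germCategory.pull U b z‖ ≤ ‖b‖ := by
  refine Real.iSup_le (fun z => ?_) (norm_nonneg _)
  by_cases hz : z ∈ U
  · rw [EtaleCategory.pull_of_mem _ hz]
    exact b.norm_apply_le _
  · rw [EtaleCategory.pull_of_notMem _ hz, norm_zero]
    exact norm_nonneg _

theorem norm_germA0_le (hω : θ.germCategory.IsRepresentation ω) {s : S}
    (b : ccSubmodule (θ s).source) : ‖ω (θ.germA0 s b)‖ ≤ ‖(b : C₀(X, ℂ))‖ :=
  (hω.norm_le _ (θ.isBisection_germSet s) (θ.germA0 s b)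
    ((θ.isBisection_germSet s).pull_mem_CcOn (by
      rw [image_src_germSet]
      exact b.2))).trans (norm_pull_le _ _)

theorem unitA0_mem_CcOn (b : ccSubmodule (Set.univ : Set X)) :
    (θ.unitA0 b : θ.Germ → ℂ) ∈ CcOn (Set.range θ.germCategory.unit) :=
  θ.isBisection_range_unit.pull_mem_CcOn (by
    rw [image_src_range_unit]
    exact b.2)

theorem norm_unitA0_le (hω : θ.germCategory.IsRepresentation ω)
    (b : ccSubmodule (Set.univ : Set X)) : ‖ω (θ.unitA0 b)‖ ≤ ‖(b : C₀(X, ℂ))‖ :=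
  (hω.norm_le _ θ.isBisection_range_unit (θ.unitA0 b) (unitA0_mem_CcOn b)).trans
    (norm_pull_le _ _)

theorem map_unitA0_star (hω : θ.germCategory.IsRepresentation ω)
    (a : ccSubmodule (Set.univ : Set X)) :
    ω (θ.unitA0 ⟨star (a : C₀(X, ℂ)), star_mem_ccSubmodule a.2⟩) = star (ω (θ.unitA0 a)) := by
  rw [ContinuousLinearMap.star_eq_adjoint]
  refine hω.map_conj _ _ (unitA0_mem_CcOn a) fun z => ?_
  by_cases hz : z ∈ Set.range θ.germCategory.unit
  · refine (EtaleCategory.pull_of_mem _ hz).trans ?_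
    exact congrArg (starRingEnd ℂ) (EtaleCategory.pull_of_mem (a : C₀(X, ℂ)) hz).symm
  · refine (EtaleCategory.pull_of_notMem _ hz).trans ?_
    rw [← map_zero (starRingEnd ℂ)]
    exact congrArg (starRingEnd ℂ) (EtaleCategory.pull_of_notMem (a : C₀(X, ℂ)) hz).symm

/-- The restriction of a representation of `A₀(𝒞)` to `C_c(X)` extends to `C₀(X)`. -/
theorem exists_starHom (hω : θ.germCategory.IsRepresentation ω) :
    ∃ π : C₀(X, ℂ) →⋆ₙₐ[ℂ] (H →L[ℂ] H),
      ∀ b : ccSubmodule (Set.univ : Set X), π b = ω (θ.unitA0 b) := by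
  have hd := denseRange_ccSubmodule_univ (X := X)
  obtain ⟨P, hP⟩ := exists_extension_of_denseRange (ccSubmodule Set.univ) hd
    ((ω : θ.germCategory.A0 →ₗ[ℂ] (H →L[ℂ] H)) ∘ₗ θ.unitA0) (norm_unitA0_le hω)
  replace hP : ∀ b : ccSubmodule (Set.univ : Set X), P b = ω (θ.unitA0 b) := hP
  have hmul : ∀ a b, P (a * b) = P a * P b := fun a b => by
    refine hd.induction_on₂ (p := fun a b => P (a * b) = P a * P b)
      (isClosed_eq (by fun_prop) (by fun_prop)) (fun a b => ?_) a b
    change P ((a : C₀(X, ℂ)) * b) = P a * P b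
    rw [hP, hP, ← map_mul, unitA0_mul_unitA0, ← hP]
  have hstar : ∀ a, P (star a) = star (P a) := fun a => by
    refine hd.induction_on (p := fun a => P (star a) = star (P a)) a
      (isClosed_eq (by fun_prop) (by fun_prop)) fun a => ?_
    change P (star (a : C₀(X, ℂ))) = star (P a)
    rw [hP, ← map_unitA0_star hω, ← hP]
  exact ⟨{ toFun := P
           map_smul' := P.map_smul
           map_zero' := P.map_zero
           map_add' := P.map_add
           map_mul' := hmul
           map_star' := hstar }, hP⟩

variable {π : C₀(X, ℂ) →⋆ₙₐ[ℂ] (H →L[ℂ] H)}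

/-- A local unit u for c factors the operator as ω(c ∘ 𝐝) = ω(c ∘ 𝐝) π(u), with u compactly
supported in D_{λ(s)}. -/
theorem germA0_apply_eq_zero (hπ : ∀ b : ccSubmodule (Set.univ : Set X), π b = ω (θ.unitA0 b))
    {s : S} (c : ccSubmodule (θ s).source) {h : H}
    (hh : ∀ b ∈ ccSubmodule (θ s).source, π b h = 0) : ω (θ.germA0 s c) h = 0 := by
  obtain ⟨u, hu, huc⟩ := exists_mul_eq_self (θ.isOpen_source s) c.2
  have h1 : θ.germA0 s c * θ.unitA0 ⟨u, mem_ccSubmodule_univ hu⟩ = θ.germA0 s c := by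
    rw [germA0_mul_unitA0]
    congr 1
    exact Subtype.ext ((mul_comm _ _).trans huc)
  rw [← h1, map_mul, ← hπ, mul_apply_eq_comp, hh u hu, map_zero]

/-- The span of the subspaces `π(b)H`, for `b` compactly supported in `D`. -/
def essential (π : C₀(X, ℂ) →⋆ₙₐ[ℂ] (H →L[ℂ] H)) (D : Set X) : Submodule ℂ H :=
  Submodule.span ℂ {h | ∃ b ∈ ccSubmodule D, ∃ k, h = π b k}

theorem mem_orthogonal_essential {D : Set X} {h : H} :
    h ∈ (essential π D)ᗮ ↔ ∀ b ∈ ccSubmodule D, π b h = 0 := by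
  rw [Submodule.mem_orthogonal]
  constructor
  · intro hh b hb
    rw [← inner_self_eq_zero (𝕜 := ℂ)]
    have h1 : π b = ContinuousLinearMap.adjoint (π (star b)) := by
      rw [← ContinuousLinearMap.star_eq_adjoint, ← map_star, star_star]
    nth_rw 2 [h1]
    rw [ContinuousLinearMap.adjoint_inner_right]
    exact hh _ (Submodule.subset_span ⟨_, star_mem_ccSubmodule hb, _, rfl⟩)
  · intro hh k hk
    induction hk using Submodule.span_induction with
    | mem k hk =>
      obtain ⟨b, hb, k, rfl⟩ := hk
      rw [← ContinuousLinearMap.adjoint_inner_right, ← ContinuousLinearMap.star_eq_adjoint,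
        ← map_star, hh _ (star_mem_ccSubmodule hb), inner_zero_right]
    | zero => exact inner_zero_left _
    | add x y _ _ hx hy => rw [inner_add_left, hx, hy, add_zero]
    | smul c x _ hx => rw [inner_smul_left, hx, mul_zero]

/-- H is the sum of the closure of the span of the π(b)H and its orthogonal complement, and the
latter is the common kernel of the π(b). An operator is therefore determined by its behaviour on
these two pieces. -/
theorem operator_ext (D : Set X) {A B : H →L[ℂ] H}
    (h1 : ∀ b ∈ ccSubmodule D, A * π b = B * π b)
    (h2 : ∀ h, (∀ b ∈ ccSubmodule D, π b h = 0) → A h = B h) : A = B := by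
  ext h
  have hc : CompleteSpace (essential π D).topologicalClosure :=
    (essential π D).isClosed_topologicalClosure.completeSpace_coe
  have htop : h ∈ (essential π D).topologicalClosure ⊔ (essential π D).topologicalClosureᗮ := by
    rw [Submodule.sup_orthogonal_of_hasOrthogonalProjection]
    trivial
  obtain ⟨a, ha, b, hb, rfl⟩ := Submodule.mem_sup.1 htop
  rw [Submodule.orthogonal_closure, mem_orthogonal_essential] at hb
  rw [map_add, map_add, h2 b hb]
  congr 1
  have hcl : IsClosed {x | A x = B x} := isClosed_eq A.continuous B.continuous
  refine closure_minimal (s := (essential π D : Set H)) (fun x hx => ?_) hcl ha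
  change x ∈ LinearMap.eqLocus A.toLinearMap B.toLinearMap
  refine Submodule.span_le.2 ?_ hx
  rintro _ ⟨b, hb, k, rfl⟩
  exact congrArg (fun T : H →L[ℂ] H => T k) (h1 b hb)

/-- The operator `σ_s` associated with a representation of `A₀(𝒞)`. -/
theorem exists_operator (hω : θ.germCategory.IsRepresentation ω)
    (hπ : ∀ b : ccSubmodule (Set.univ : Set X), π b = ω (θ.unitA0 b)) (s : S) :
    ∃ R : H →L[ℂ] H, ‖R‖ ≤ 1 ∧
      (∀ b : ccSubmodule (θ s).source, R * π b = ω (θ.germA0 s b)) ∧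
      ∀ h, R h ∈ closure {k | ∃ b, k = ω (θ.germA0 s b) h} := by
  -- The net is indexed by the compact subsets of D_{λ(s)}, directed by inclusion, and its members
  -- come from cut-offs equal to 1 on the given compact set.
  let ι := TopologicalSpace.Compacts (θ s).source
  have hK : ∀ K : ι, IsCompact (Subtype.val '' (K : Set (θ s).source)) := fun K =>
    K.isCompact.image continuous_subtype_val
  choose u hu hu1 hu2 _ using fun K : ι => exists_mem_ccSubmodule_eq_one (θ.isOpen_source s)
    (hK K) (Subtype.coe_image_subset _ _)
  let T : ι → H →L[ℂ] H := fun K => ω (θ.germA0 s ⟨u K, hu K⟩)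
  have hT : ∀ K, ‖T K‖ ≤ 1 := fun K => (norm_germA0_le hω _).trans
    (ZeroAtInftyContinuousMap.norm_le_of_forall zero_le_one (hu2 K))
  -- As soon as K contains the support of b, u_K b = b and T_K π(b)k no longer changes.
  have hconv : ∀ (b : ccSubmodule (θ s).source) k,
      Filter.Tendsto (fun K => T K (π b k)) Filter.atTop (nhds (ω (θ.germA0 s b) k)) := by
    intro b k
    obtain ⟨L, hLs, hL, hbL⟩ := b.2
    refine tendsto_const_nhds.congr' ?_
    filter_upwards [Filter.eventually_ge_atTop (⟨Subtype.val ⁻¹' L,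
      (Topology.IsInducing.subtypeVal.isCompact_preimage_iff (by simpa using hLs)).2 hL⟩ : ι)]
      with K hLK
    have h1 : u K * (b : C₀(X, ℂ)) = b := by
      ext x
      rw [ZeroAtInftyContinuousMap.mul_apply]
      by_cases hx : x ∈ L
      · rw [hu1 K x ⟨⟨x, hLs hx⟩, hLK hx, rfl⟩, one_mul]
      · rw [hbL x hx, mul_zero]
    have h2 : θ.germA0 s ⟨u K, hu K⟩ * θ.unitA0 ⟨b, mem_ccSubmodule_univ b.2⟩ = θ.germA0 s b := by
      rw [germA0_mul_unitA0]
      congr 1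
      exact Subtype.ext h1
    rw [← h2, map_mul, ← hπ]
    rfl
  obtain ⟨R, hR1, hR⟩ := exists_pointwise_limit T hT (essential π (θ s).source) (by
    intro h hh
    induction hh using Submodule.span_induction with
    | mem h hh =>
      obtain ⟨b, hb, k, rfl⟩ := hh
      exact ⟨_, hconv ⟨b, hb⟩ k⟩
    | zero => exact ⟨0, by simp⟩
    | add x y _ _ hx hy =>
      obtain ⟨l, hl⟩ := hx
      obtain ⟨m, hm⟩ := hy
      exact ⟨l + m, by simpa only [map_add] using hl.add hm⟩
    | smul c x _ hx =>
      obtain ⟨l, hl⟩ := hx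
      exact ⟨c • l, by simpa only [map_smul] using hl.const_smul c⟩) (by
    intro h hh
    -- On the orthogonal complement every member of the net is already 0.
    refine ⟨0, tendsto_const_nhds.congr fun K => ?_⟩
    exact (germA0_apply_eq_zero hπ _ (mem_orthogonal_essential.1 hh)).symm)
  refine ⟨R, hR1, fun b => ?_, fun h => ?_⟩
  · ext k
    exact tendsto_nhds_unique (hR (π b k)) (hconv b k)
  · exact mem_closure_of_tendsto (hR h) (Filter.Eventually.of_forall fun K => ⟨_, rfl⟩)

end

end EtaleAction

/-! ### The covariant pair obtained from a representation of A₀(𝒞). -/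

namespace EtaleAction

variable {S : Type u} [RestrictionSemigroup S] {X : Type v} [TopologicalSpace X]
variable [LocallyCompactSpace X] [T2Space X] {θ : EtaleAction S X}
variable {H : Type (max u v)} [NormedAddCommGroup H] [InnerProductSpace ℂ H] [CompleteSpace H]
variable {ω : θ.germCategory.A0 →ₙₐ[ℂ] (H →L[ℂ] H)}

/-- `π` and `σ` are obtained from the representation `ω` of `A₀(𝒞)`. -/
structure IsDisintegration (ω : θ.germCategory.A0 →ₙₐ[ℂ] (H →L[ℂ] H))
    (π : C₀(X, ℂ) →⋆ₙₐ[ℂ] (H →L[ℂ] H)) (σ : S → H →L[ℂ] H) : Prop where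
  apply_eq : ∀ b : ccSubmodule (Set.univ : Set X), π b = ω (θ.unitA0 b)
  norm_le : ∀ s, ‖σ s‖ ≤ 1
  mul_apply : ∀ s, ∀ b : ccSubmodule (θ s).source, σ s * π b = ω (θ.germA0 s b)
  mem_closure : ∀ s h, σ s h ∈ closure {k | ∃ b, k = ω (θ.germA0 s b) h}

theorem exists_isDisintegration (hω : θ.germCategory.IsRepresentation ω) :
    ∃ (π : C₀(X, ℂ) →⋆ₙₐ[ℂ] (H →L[ℂ] H)) (σ : S → H →L[ℂ] H), IsDisintegration ω π σ := by
  obtain ⟨π, hπ⟩ := exists_starHom hω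
  choose σ h1 h2 h3 using exists_operator hω hπ
  exact ⟨π, σ, hπ, h1, h2, h3⟩

namespace IsDisintegration

variable {π : C₀(X, ℂ) →⋆ₙₐ[ℂ] (H →L[ℂ] H)} {σ : S → H →L[ℂ] H}

/-- σ_s h is a limit of vectors ω(b ∘ 𝐝)h with b compactly supported in D_{λ(s)}, and these all
vanish. -/
theorem apply_eq_zero (hd : IsDisintegration ω π σ) {s : S} {h : H}
    (hh : ∀ b ∈ ccSubmodule (θ s).source, π b h = 0) : σ s h = 0 := by
  refine closure_minimal (t := {0}) ?_ isClosed_singleton (hd.mem_closure s h)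
  rintro _ ⟨b, rfl⟩
  exact germA0_apply_eq_zero hd.apply_eq b hh

/-- Identities which hold on `C_c(U)` extend to `C₀(U)`. -/
theorem forall_C0On {U : Set X} (hU : IsOpen U) {P Q : C₀(X, ℂ) → H} (hP : Continuous P)
    (hQ : Continuous Q) (h : ∀ a ∈ ccSubmodule U, P a = Q a) {a : C₀(X, ℂ)} (ha : a ∈ C0On U) :
    P a = Q a :=
  closure_minimal (s := (ccSubmodule U : Set C₀(X, ℂ))) h (isClosed_eq hP hQ)
    (C0On_subset_closure hU ha)

theorem continuous_apply (π : C₀(X, ℂ) →⋆ₙₐ[ℂ] (H →L[ℂ] H)) (h : H) :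
    Continuous fun a => π a h :=
  (ContinuousLinearMap.apply ℂ H h).continuous.comp
    (AddMonoidHomClass.continuous_of_bound π 1 fun a =>
      (NonUnitalStarAlgHom.norm_apply_le π a).trans_eq (one_mul _).symm)

/-- This is covariance at the level of A₀(𝒞): on germs of s, multiplying on the left by a ∘ θ_s⁻¹ at
the range equals multiplying by a at the source. -/
theorem apply_pushC0_mul (hd : IsDisintegration ω π σ) {s : S} {a : C₀(X, ℂ)}
    (ha : a ∈ C0On (θ s).source) (b : ccSubmodule (θ s).source) :
    π (θ.inducedAction s a) * ω (θ.germA0 s b) =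
      ω (θ.germA0 s ⟨a * b, mul_mem_ccSubmodule_left a b.2⟩) := by
  obtain ⟨u, hu, hub⟩ := exists_mul_eq_self (θ.isOpen_source s) b.2
  have key : ∀ c (hc : c ∈ ccSubmodule (θ s).source), π (θ.inducedAction s c) *
      ω (θ.germA0 s b) = ω (θ.germA0 s ⟨c * b, mul_mem_ccSubmodule_left c b.2⟩) := by
    intro c hc
    have h1 : θ.inducedAction s c ∈ ccSubmodule (Set.univ : Set X) :=
      mem_ccSubmodule_univ (pushC0_mem_ccSubmodule (θ.homeo s) subset_rfl hc)
    rw [show π (θ.inducedAction s c) = _ from hd.apply_eq ⟨_, h1⟩, ← map_mul]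
    refine congrArg ω (unitA0_mul_germA0 _ b _ fun x hx => ?_)
    rw [ZeroAtInftyContinuousMap.mul_apply]
    congr 1
    exact (pushC0_apply (θ.homeo s) (mem_C0On_of_mem_ccSubmodule hc) hx).symm
  have hub' : (⟨u * b, mul_mem_ccSubmodule_left u b.2⟩ : ccSubmodule (θ s).source) = b :=
    Subtype.ext hub
  -- A general a need not be compactly supported, so π(α_s(a)) is not directly a value of ω. With b
  -- = ub, the product au is compactly supported and `key` applies to both u and au.
  have h2 := key u hu
  rw [hub'] at h2
  have h3 := key (a * u) (mul_mem_ccSubmodule_left a hu)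
  rw [θ.inducedAction.apply_mul s a ha u (mem_C0On_of_mem_ccSubmodule hu), map_mul, mul_assoc,
    h2] at h3
  rw [h3]
  congr 3
  rw [mul_assoc, hub]

theorem covariant (hd : IsDisintegration ω π σ) {s : S} {a : C₀(X, ℂ)}
    (ha : a ∈ C0On (θ s).source) : π (θ.inducedAction s a) * σ s = σ s * π a := by
  refine operator_ext (π := π) (θ s).source (fun b hb => ?_) fun h hh => ?_
  · have h1 := hd.mul_apply s ⟨b, hb⟩
    have h2 := hd.mul_apply s ⟨a * b, mul_mem_ccSubmodule_left a hb⟩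
    rw [mul_assoc, mul_assoc, ← map_mul, h1, hd.apply_pushC0_mul ha ⟨b, hb⟩, h2]
  · rw [mul_apply_eq_comp, mul_apply_eq_comp, hd.apply_eq_zero hh, map_zero]
    rw [forall_C0On (θ.isOpen_source s) (continuous_apply π h) continuous_const hh ha, map_zero]

/-- Approximating σ_t h by vectors ω(b ∘ 𝐝)h turns the composite into values of ω at functions on
the germs of st, which kill h. -/
theorem germA0_mul (hd : IsDisintegration ω π σ) {s t : S} (c : ccSubmodule (θ s).source) {h : H}
    (hh : ∀ b ∈ ccSubmodule (θ (s * t)).source, π b h = 0) :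
    ω (θ.germA0 s c) (σ t h) = 0 := by
  refine closure_minimal (t := {v | ω (θ.germA0 s c) v = 0}) ?_
    (isClosed_eq (ω (θ.germA0 s c)).continuous continuous_const) (hd.mem_closure t h)
  rintro _ ⟨b, rfl⟩
  change ω (θ.germA0 s c) (ω (θ.germA0 t b) h) = 0
  rw [← mul_apply_eq_comp, ← map_mul, germA0_mul_germA0]
  exact germA0_apply_eq_zero hd.apply_eq _ hh

/-- On π(b)H, with u a local unit for b, σ_t π(b) = π(α_t(b)) ω(u ∘ 𝐝). Since α_t(b) is supported in
D_{λ(s)}, applying σ_s leads to a product in A₀(𝒞), namely b ∘ 𝐝 on the germs of st. On the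
complement both sides are 0. -/
theorem map_mul' (hd : IsDisintegration ω π σ) (s t : S) : σ (s * t) = σ s * σ t := by
  refine operator_ext (π := π) (θ (s * t)).source (fun b hb => ?_) fun h hh => ?_
  · have hsub : (θ (s * t)).source ⊆ (θ t).source := fun x hx => (θ.isHom.mem_source_mul.1 hx).1
    have hbt : b ∈ ccSubmodule (θ t).source := ccSubmodule_mono hsub hb
    have hbt0 := mem_C0On_of_mem_ccSubmodule hbt
    obtain ⟨u, hu, hub⟩ := exists_mul_eq_self (θ.isOpen_source t) hbt
    have hps : pushC0 (θ.homeo t) b ∈ ccSubmodule (θ s).source := by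
      refine ccSubmodule_mono ?_ (pushC0_mem_ccSubmodule (θ.homeo t) hsub hb)
      rintro _ ⟨x, hx, rfl⟩
      exact (θ.isHom.mem_source_mul.1 hx).2
    have h1 : π b = π b * π u := by rw [← map_mul, mul_comm, hub]
    have h2 : σ t * π b = π (θ.inducedAction t b) * ω (θ.germA0 t ⟨u, hu⟩) := by
      rw [hd.apply_pushC0_mul hbt0 ⟨u, hu⟩]
      refine (hd.mul_apply t ⟨b, hbt⟩).trans ?_
      congr 3
      exact hub.symm.trans (mul_comm _ _)
    have h3 : σ s * π (θ.inducedAction t b) = ω (θ.germA0 s ⟨_, hps⟩) := hd.mul_apply s ⟨_, hps⟩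
    rw [mul_assoc, h2, ← mul_assoc, h3, ← map_mul, germA0_mul_germA0]
    refine (hd.mul_apply (s * t) ⟨b, hb⟩).trans ?_
    refine congrArg ω (Subtype.ext (EtaleCategory.pull_congr ?_))
    rintro _ ⟨x, hx, -, rfl⟩
    have hxt := hsub hx
    refine Eq.symm ((twist_apply _ (mem_C0On_of_mem_ccSubmodule hu) hxt).trans ?_)
    have h4 : pushC0 (θ.homeo t) b (θ t x) = b x := pushC0_apply (θ.homeo t) hbt0 hxt
    rw [h4, mul_comm]
    exact congrArg (fun f : C₀(X, ℂ) => f x) hub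
  · rw [hd.apply_eq_zero hh, mul_apply_eq_comp]
    refine (closure_minimal (t := {0}) ?_ isClosed_singleton (hd.mem_closure s (σ t h))).symm
    rintro _ ⟨b, rfl⟩
    exact hd.germA0_mul b hh

theorem proj_mul_apply (hd : IsDisintegration ω π σ) {e : S} (he : e ∈ (proj : Set S))
    {a : C₀(X, ℂ)} (ha : a ∈ C0On (θ e).source) : σ e * π a = π a := by
  ext k
  refine forall_C0On (θ.isOpen_source e) (P := fun a => (σ e * π a) k) (Q := fun a => π a k)
    ((σ e).continuous.comp (continuous_apply π k)) (continuous_apply π k) (fun b hb => ?_) ha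
  have h1 := hd.mul_apply e ⟨b, hb⟩
  rw [germA0_proj he, ← hd.apply_eq] at h1
  exact congrArg (fun T : H →L[ℂ] H => T k) h1

theorem apply_mul_proj (hd : IsDisintegration ω π σ) {e : S} (he : e ∈ (proj : Set S))
    {a : C₀(X, ℂ)} (ha : a ∈ C0On (θ e).source) : π a * σ e = π a := by
  have h1 := hd.covariant ha
  rw [hd.proj_mul_apply he ha] at h1
  refine Eq.trans (congrArg (fun b => π b * σ e) ?_) h1
  have h2 : pushC0 (θ.homeo e) a = a := by
    refine pushC0_eq _ ha ?_ fun x hx => congrArg a (θ.isHom.apply_proj he hx)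
    have h3 := θ.isHom.source_rho e
    rw [rho_proj e he] at h3
    change a ∈ C0On (θ e).target
    rwa [← h3]
  exact h2.symm

/-- On π(b)H, take adjoints in π(b*)σ_e = π(b*). On the complement, each σ_e k is a limit of vectors
π(b)k, to which h is orthogonal, so σ_e* h = 0. -/
theorem adjoint_proj (hd : IsDisintegration ω π σ) {e : S} (he : e ∈ (proj : Set S)) :
    ContinuousLinearMap.adjoint (σ e) = σ e := by
  rw [← ContinuousLinearMap.star_eq_adjoint]
  refine operator_ext (π := π) (θ e).source (fun b hb => ?_) fun h hh => ?_
  · rw [hd.proj_mul_apply he (mem_C0On_of_mem_ccSubmodule hb)]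
    have h1 := congrArg star (hd.apply_mul_proj he
      (mem_C0On_of_mem_ccSubmodule (star_mem_ccSubmodule hb)))
    rwa [star_mul, ← map_star, star_star] at h1
  · rw [hd.apply_eq_zero hh, ContinuousLinearMap.star_eq_adjoint]
    refine ext_inner_right ℂ fun k => ?_
    rw [ContinuousLinearMap.adjoint_inner_left, inner_zero_left]
    refine closure_minimal (t := {v | inner ℂ h v = 0}) ?_
      (isClosed_eq (by fun_prop) continuous_const) (hd.mem_closure e k)
    rintro _ ⟨b, rfl⟩
    change inner ℂ h (ω (θ.germA0 e b) k) = 0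
    rw [germA0_proj he, ← hd.apply_eq, ← ContinuousLinearMap.adjoint_inner_left,
      ← ContinuousLinearMap.star_eq_adjoint, ← map_star, hh _ (star_mem_ccSubmodule b.2),
      inner_zero_left]

theorem isCovariantPair (hd : IsDisintegration ω π σ) : θ.inducedAction.IsCovariantPair π σ where
  isRep :=
    { map_mul := hd.map_mul'
      norm_le := hd.norm_le
      adjoint_proj := fun _ he => hd.adjoint_proj he
      sq_proj := fun e he => by rw [← hd.map_mul', proj_idem e he] }
  covariant _ _ ha := hd.covariant ha
  range_proj e he := by
    have hsq : σ e * σ e = σ e := by rw [← hd.map_mul', proj_idem e he]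
    apply subset_antisymm
    · have hr : Set.range (σ e) = {h | σ e h = h} := by
        ext h
        constructor
        · rintro ⟨k, rfl⟩
          exact congrArg (fun T : H →L[ℂ] H => T k) hsq
        · exact fun hh => ⟨h, hh⟩
      rw [hr]
      refine closure_minimal (fun x hx => ?_) (isClosed_eq (σ e).continuous continuous_id)
      change x ∈ LinearMap.eqLocus (σ e).toLinearMap LinearMap.id
      refine Submodule.span_le.2 ?_ hx
      rintro _ ⟨a, ha, k, rfl⟩
      exact congrArg (fun T : H →L[ℂ] H => T k) (hd.proj_mul_apply he ha)
    · rintro _ ⟨h, rfl⟩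
      refine closure_mono ?_ (hd.mem_closure e h)
      rintro _ ⟨b, rfl⟩
      refine Submodule.subset_span ⟨b, mem_C0On_of_mem_ccSubmodule b.2, h, ?_⟩
      rw [germA0_proj he, ← hd.apply_eq]

theorem integrated_eq (hd : IsDisintegration ω π σ) (x : θ.compactFormalSums) :
    θ.inducedAction.integrated π σ x = ω (θ.toA0 x) := by
  obtain ⟨n, s, b, hb, hx⟩ := exists_eq_sum_delta x.2
  have h1 : θ.toA0 x = ∑ k, θ.germA0 (s k) ⟨b k, hb k⟩ := by
    refine Subtype.ext ?_
    rw [coe_toA0, hx, map_sum, AddSubmonoidClass.coe_finsetSum]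
    exact Finset.sum_congr rfl fun k _ => toGermFun_delta _ (mem_C0On_of_mem_ccSubmodule (hb k))
  rw [h1, hx, map_sum, map_sum]
  refine Finset.sum_congr rfl fun k _ => ?_
  rw [hd.isCovariantPair.integrated_delta (mem_C0On_of_mem_ccSubmodule (hb k))]
  exact hd.mul_apply (s k) ⟨b k, hb k⟩

end IsDisintegration

theorem toA0_universalSeminorm_le (x : θ.compactFormalSums) :
    θ.germCategory.universalSeminorm.toSeminorm (θ.toA0 x) ≤
      θ.inducedAction.universalSeminorm.toSeminorm x := by
  refine θ.germCategory.universalSeminorm_le (apply_nonneg _ _) fun H _ _ _ ω hω => ?_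
  obtain ⟨π, σ, hd⟩ := exists_isDisintegration hω
  rw [← hd.integrated_eq]
  exact θ.inducedAction.norm_le_universalSeminorm hd.isCovariantPair _

end EtaleAction

theorem mainTheorem1 {S : Type u} [RestrictionSemigroup S] {X : Type v} [TopologicalSpace X]
    [SecondCountableTopology X] [LocallyCompactSpace X] [T2Space X] (θ : EtaleAction S X) :
    ∃ Φ : θ.germCategory.OperatorAlgebra ≃ₗᵢ[ℂ] θ.inducedAction.SemicrossedProduct,
      ∀ a b, Φ (a * b) = Φ a * Φ b :=
  AlgebraSeminorm.exists_completion_isometryEquiv _ _ θ.toA0 θ.compactFormalSums.subtype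
    EtaleAction.surjective_toA0 EtaleAction.denseRange_compactFormalSums
    (fun x => le_antisymm (EtaleAction.universalSeminorm_le_toA0 x)
      (EtaleAction.toA0_universalSeminorm_le x))
    fun x y => ⟨⟨x * y, EtaleAction.mul_mem_compactFormalSums x.2 y.2⟩,
      EtaleAction.toA0_mul x y, rfl⟩
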